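/- Let $(M,g)$ be a smooth Lorentzian manifold of dimension $d\ge 3$, of signature $(-,+,\dots,+)$, with Ricci tensor $R_{ab}$ and Weyl tensor $C_{abcd}$. A null frame at a point is a basis $\ell,n,m_{(2)},\dots,m_{(d-1)}$ of the tangent space with $\ell\cdot\ell=n\cdot n=\ell\cdot m_{(i)}=n\cdot m_{(i)}=0$, $\ell\cdot n=1$, $m_{(i)}\cdot m_{(j)}=\delta_{ij}$. The boost weight of a frame component of $C$ is the number of its arguments equal to $\ell$ minus the number of its arguments equal to $n$. A vector $\ell$ is a multiple Weyl aligned null direction (multiple WAND) at a point if it belongs to a null frame $\ell,n,m_{(i)}$ in which all components of $C$ of positive boost weight vanish. At a point, the Weyl tensor is of (genuine) type III if there is a null frame in which all components of $C$ of boost weight $\ge 0$ vanish but some component of boost weight $-1$ does not, and of (genuine) type N if there is a null frame in which all components of boost weight $\ge -1$ vanish but some component of boost weight $-2$ does not. Suppose that at each point of $M$ the Weyl tensor is of type III or N, and that $$R_{ab}=\lambda\, g_{ab}+\eta\, k_a k_b$$ on $M$, where $\lambda$ is a real constant, $\eta$ is a nowhere vanishing real function and $k$ is a nowhere vanishing null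 vector field. Then the spacetime is aligned: at each point $p\in M$ and for every multiple WAND $\ell$ at $p$ one has $k(p)=c\,\ell$ for some real $c\neq 0$. -/

import Mathlib

open scoped Manifold ContDiff

noncomputable section

namespace Spacetime

/-! ### Coordinate expressions for the curvature of a metric on `ℝ^d` -/

section Coordinates

variable {d : ℕ}

/-- The partial derivative `∂_i f` at `x`. -/
def pderiv (i : Fin d) (f : EuclideanSpace ℝ (Fin d) → ℝ) (x : EuclideanSpace ℝ (Fin d)) : ℝ :=
  fderiv ℝ f x (EuclideanSpace.single i 1)

variable (G : EuclideanSpace ℝ (Fin d) → Matrix (Fin d) (Fin d) ℝ)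

/-- `Γ^a_{bc} = ½ g^{as} (∂_b g_{cs} + ∂_c g_{bs} - ∂_s g_{bc})`. -/
def christoffel (a b c : Fin d) (x : EuclideanSpace ℝ (Fin d)) : ℝ :=
  (1 / 2) * ∑ s, (G x)⁻¹ a s *
    (pderiv b (fun y => G y c s) x + pderiv c (fun y => G y b s) x - pderiv s (fun y => G y b c) x)

/-- `R^a_{bce} = ∂_c Γ^a_{be} - ∂_e Γ^a_{bc} + Γ^a_{cs} Γ^s_{be} - Γ^a_{es} Γ^s_{bc}`. -/
def riemannUp (a b c e : Fin d) (x : EuclideanSpace ℝ (Fin d)) : ℝ :=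
  pderiv c (christoffel G a b e) x - pderiv e (christoffel G a b c) x +
    ∑ s, (christoffel G a c s x * christoffel G s b e x -
      christoffel G a e s x * christoffel G s b c x)

/-- `R_{abce} = g_{as} R^s_{bce}`. -/
def riemannCoeff (a b c e : Fin d) (x : EuclideanSpace ℝ (Fin d)) : ℝ :=
  ∑ s, G x a s * riemannUp G s b c e x

/-- The Ricci tensor `R_{ab} = R^s_{asb}`. -/
def ricciCoeff (a b : Fin d) (x : EuclideanSpace ℝ (Fin d)) : ℝ :=
  ∑ s, riemannUp G s a s b x

/-- The scalar curvature `R = g^{ab} R_{ab}`. -/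
def scalarCurv (x : EuclideanSpace ℝ (Fin d)) : ℝ :=
  ∑ a, ∑ b, (G x)⁻¹ a b * ricciCoeff G a b x

/-- The Weyl tensor
`C_{abce} = R_{abce} - (g_{ac} R_{be} - g_{ae} R_{bc} - g_{bc} R_{ae} + g_{be} R_{ac}) / (d - 2)
  + R (g_{ac} g_{be} - g_{ae} g_{bc}) / ((d - 1) (d - 2))`, for `d ≥ 3`. -/
def weylCoeff (a b c e : Fin d) (x : EuclideanSpace ℝ (Fin d)) : ℝ :=
  riemannCoeff G a b c e x
    - (G x a c * ricciCoeff G b e x - G x a e * ricciCoeff G b c x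
        - G x b c * ricciCoeff G a e x + G x b e * ricciCoeff G a c x) / ((d : ℝ) - 2)
    + scalarCurv G x * (G x a c * G x b e - G x a e * G x b c) / (((d : ℝ) - 1) * ((d : ℝ) - 2))

end Coordinates

/-! ### Lorentzian manifolds -/

/-- A smooth metric of signature `(-, +, …, +)` on the `d`-dimensional manifold `M`. -/
structure LorentzMetric (d : ℕ) (M : Type*) [TopologicalSpace M]
    [ChartedSpace (EuclideanSpace ℝ (Fin d)) M] [IsManifold (𝓡 d) ∞ M] where
  /-- The scalar product on each tangent space. -/
  inner (p : M) : TangentSpace (𝓡 d) p →L[ℝ] TangentSpace (𝓡 d) p →L[ℝ] ℝ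
  symm (p : M) (u v : TangentSpace (𝓡 d) p) : inner p u v = inner p v u
  /-- Each tangent space has an orthonormal basis with exactly one timelike vector. -/
  lorentzian (p : M) : ∃ (b : Module.Basis (Fin d) ℝ (TangentSpace (𝓡 d) p)) (t : Fin d),
    ∀ i j, inner p (b i) (b j) = if i = j then (if i = t then -1 else 1) else 0
  contMDiff : ContMDiff (𝓡 d)
    ((𝓡 d).prod 𝓘(ℝ, EuclideanSpace ℝ (Fin d) →L[ℝ] EuclideanSpace ℝ (Fin d) →L[ℝ] ℝ)) ∞
    (fun p ↦ Bundle.TotalSpace.mk'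
      (EuclideanSpace ℝ (Fin d) →L[ℝ] EuclideanSpace ℝ (Fin d) →L[ℝ] ℝ)
      (E := fun q : M ↦ TangentSpace (𝓡 d) q →L[ℝ] TangentSpace (𝓡 d) q →L[ℝ] ℝ) p (inner p))

section Manifold

variable {d : ℕ} {M : Type*} [TopologicalSpace M] [ChartedSpace (EuclideanSpace ℝ (Fin d)) M]

/-- The coordinate vector `∂_i` of the chart `e` at the point with coordinates `x`. -/
def coordVec (e : OpenPartialHomeomorph M (EuclideanSpace ℝ (Fin d)))
    (x : EuclideanSpace ℝ (Fin d)) (i : Fin d) : TangentSpace (𝓡 d) (e.symm x) :=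
  @mfderiv ℝ _ _ _ _ _ _ (𝓡 d) _ _ (chartedSpaceSelf _) _ _ _ _ _ (𝓡 d) M _ _ e.symm x
    (EuclideanSpace.single i (1 : ℝ) : EuclideanSpace ℝ (Fin d))

/-- The component `u^i` of the tangent vector `u` at `p` in the chart `e`. -/
def comp (e : OpenPartialHomeomorph M (EuclideanSpace ℝ (Fin d))) (p : M)
    (u : TangentSpace (𝓡 d) p) (i : Fin d) : ℝ :=
  EuclideanSpace.proj (𝕜 := ℝ) i
    (@mfderiv ℝ _ _ _ _ _ _ (𝓡 d) M _ _ _ _ _ _ _ (𝓡 d) _ _ (chartedSpaceSelf _) e p u)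

variable [IsManifold (𝓡 d) ∞ M]

/-- The components `g_{ij}` of the metric in the chart `e`, as functions of the coordinates. -/
def metricCoeff (g : LorentzMetric d M) (e : OpenPartialHomeomorph M (EuclideanSpace ℝ (Fin d)))
    (x : EuclideanSpace ℝ (Fin d)) : Matrix (Fin d) (Fin d) ℝ :=
  Matrix.of fun i j => g.inner (e.symm x) (coordVec e x i) (coordVec e x j)

/-- The Ricci tensor of `g` at `p`, computed in a chart `e` around `p`. As for every tensor, the
value on tangent vectors is the same for all charts of the smooth structure. -/
def ricci (g : LorentzMetric d M) (e : OpenPartialHomeomorph M (EuclideanSpace ℝ (Fin d))) (p : M)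
    (u v : TangentSpace (𝓡 d) p) : ℝ :=
  ∑ a, ∑ b, ricciCoeff (metricCoeff g e) a b (e p) * comp e p u a * comp e p v b

/-- The Weyl tensor of `g` at `p`, computed in a chart `e` around `p`. -/
def weyl (g : LorentzMetric d M) (e : OpenPartialHomeomorph M (EuclideanSpace ℝ (Fin d))) (p : M)
    (u v w z : TangentSpace (𝓡 d) p) : ℝ :=
  ∑ a, ∑ b, ∑ c, ∑ s, weylCoeff (metricCoeff g e) a b c s (e p) *
    comp e p u a * comp e p v b * comp e p w c * comp e p z s

end Manifold

/-! ### Null frames and the algebraic classification of the Weyl tensor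

Here `V` is a tangent space of a `d`-dimensional spacetime, `B` the metric and `C` the Weyl tensor
at that point. -/

section Algebra

variable {V : Type*}

/-- `ℓ, n, m_1, …, m_{d-2}` is a null frame:
`ℓ·ℓ = n·n = ℓ·m_i = n·m_i = 0`, `ℓ·n = 1`, `m_i·m_j = δ_{ij}`. -/
structure IsNullFrame (d : ℕ) (B : V → V → ℝ) (l n : V) (m : Fin (d - 2) → V) : Prop where
  l_l : B l l = 0
  n_n : B n n = 0
  l_n : B l n = 1
  l_m (i : Fin (d - 2)) : B l (m i) = 0
  n_m (i : Fin (d - 2)) : B n (m i) = 0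
  m_m (i j : Fin (d - 2)) : B (m i) (m j) = if i = j then 1 else 0

/-- The vectors `ℓ, n, m_i` of a null frame as one family. -/
def frameVec {d : ℕ} (l n : V) (m : Fin (d - 2) → V) : Fin 2 ⊕ Fin (d - 2) → V :=
  Sum.elim ![l, n] m

/-- The boost weight of a frame index: `+1` for `ℓ`, `-1` for `n`, `0` for each `m_i`. -/
def boostWeight {d : ℕ} : Fin 2 ⊕ Fin (d - 2) → ℤ :=
  Sum.elim ![1, -1] (fun _ => 0)

/-- In the frame `ℓ, n, m_i` all components of `C` of boost weight greater than `w` vanish. -/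
def BoostOrderLE {d : ℕ} (C : V → V → V → V → ℝ) (l n : V) (m : Fin (d - 2) → V) (w : ℤ) : Prop :=
  ∀ i j r s : Fin 2 ⊕ Fin (d - 2),
    w < boostWeight i + boostWeight j + boostWeight r + boostWeight s →
      C (frameVec l n m i) (frameVec l n m j) (frameVec l n m r) (frameVec l n m s) = 0

/-- `ℓ` is a multiple Weyl aligned null direction: in a null frame that starts with `ℓ`, the
components of boost weight `+2` and `+1` vanish. -/
def IsMultipleWAND (d : ℕ) (B : V → V → ℝ) (C : V → V → V → V → ℝ) (l : V) : Prop :=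
  ∃ (n : V) (m : Fin (d - 2) → V), IsNullFrame d B l n m ∧ BoostOrderLE C l n m 0

/-- Genuine type III: in some null frame all components of boost weight `≥ 0` vanish, and some
component of boost weight `-1` does not. -/
def IsTypeIII (d : ℕ) (B : V → V → ℝ) (C : V → V → V → V → ℝ) : Prop :=
  ∃ (l n : V) (m : Fin (d - 2) → V), IsNullFrame d B l n m ∧
    BoostOrderLE C l n m (-1) ∧ ¬ BoostOrderLE C l n m (-2)

/-- Genuine type N: in some null frame all components of boost weight `≥ -1` vanish, and some
component of boost weight `-2` does not. -/
def IsTypeN (d : ℕ) (B : V → V → ℝ) (C : V → V → V → V → ℝ) : Prop :=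
  ∃ (l n : V) (m : Fin (d - 2) → V), IsNullFrame d B l n m ∧
    BoostOrderLE C l n m (-2) ∧ ¬ BoostOrderLE C l n m (-3)

end Algebra

end Spacetime

end

/-! The question is local and is settled in one chart. Neither `k`, `η` nor the principal null
direction is assumed smooth, but `T = R_ab - λ g_ab` is. Near a point one can write `T = ε n ⊗ n`
with `ε` a nonzero constant and `n` a smooth null multiple of `k` (`aligned_of_null_ricci`). A
nonzero trace-free tensor of negative boost order has, up to scale, a single multiple WAND `l`
(`HasNegBoost.eq_smul_of_isMultipleWAND`), and a null vector orthogonal to `l` is a multiple of `l`.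
So it suffices to refute `n · l ≠ 0`. Dimension three is void, since there the Weyl tensor vanishes.

Suppose `n` is transverse to a smooth field `l` with `l · n = 1` on an open set (`IsTransverseOn`).
The doubly contracted Bianchi identity makes `n` geodesic. The Bianchi components of boost weight
one contain the Weyl tensor only multiplied by `κ = ∇_l l`. Eliminating `κ` by a trace
(`trace_elimination`) leaves `(d - 3) N_ik + N_ki = θ δ_ik` for the screen part `N` of `∇n`: `n` is
shear-free, and twist-free if `d ≥ 5`. The Ricci identity then writes the Weyl components of weight
`-2` as the square of `∇n` plus a pure trace. They vanish as soon as that square is a pure trace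
too, because `C` is trace-free.

For `d ≥ 5` the Ricci identity also makes the weight `-1` components pure trace. Substituted back
into the Bianchi equations this forces `θ = 0`, and then every component vanishes
(`weyl_eq_zero_of_five_le`). For `d = 4` the twist may survive. There `C` is encoded in one screen
vector field `v = ψ e + φ f`, whose derivatives are constrained by the Bianchi identity. The Ricci
identities for `v` and for `n` combine to `10 ψ² = 0` in a screen frame with `φ = 0` at the point
(`psi_eq_zero`). In both cases `C = 0`, which types III and N exclude.

It remains to produce a smooth `l`. A smooth field of two-forms `α` of the shape `l ∧ φ` with `φ(l)
= 0` determines `l` wherever `α(n, ·) ≠ 0`, so by the above `α(n, ·)` must vanish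
(`IsNullRicciOn.apply_eq_zero`). This is used twice. First `α` is the trace of the product of two
curvature operators of `C`. Its vanishing removes the components of weight `-1` at every transverse
point, by the algebraic fact `eq_zero_of_square_eq`. After that `α = C(n, m_i, ·, ·)` itself has the
required shape, and its vanishing removes weight `-2`. -/

open scoped Manifold ContDiff

noncomputable section

namespace Spacetime

/-! ### Levi-Civita connections on open sets of a vector space: curvature, Bianchi and Ricci
identities -/

section LeviCivita

set_option maxSynthPendingDepth 3

variable {V : Type*} [NormedAddCommGroup V] [NormedSpace ℝ V]

/-- `B` is a smooth family of nondegenerate symmetric bilinear forms on the open set `U`, and `Γ` its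
Levi-Civita connection. -/
structure IsLeviCivitaOn (U : Set V) (B : V → V →L[ℝ] V →L[ℝ] ℝ) (Γ : V → V →L[ℝ] V →L[ℝ] V) :
    Prop where
  isOpen : IsOpen U
  smooth_metric : ContDiffOn ℝ ∞ B U
  smooth_conn : ContDiffOn ℝ ∞ Γ U
  symm : ∀ x ∈ U, ∀ u v, B x u v = B x v u
  nondeg : ∀ x ∈ U, ∀ u, (∀ v, B x u v = 0) → u = 0
  torsion : ∀ x ∈ U, ∀ u v, Γ x u v = Γ x v u
  compat : ∀ x ∈ U, ∀ e u v, fderiv ℝ B x e u v = B x (Γ x e u) v + B x u (Γ x e v)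

/-- The covariant derivative of the vector field `Y` at `x` in the direction `e`. -/
def cov (Γ : V → V →L[ℝ] V →L[ℝ] V) (Y : V → V) (x e : V) : V := fderiv ℝ Y x e + Γ x e (Y x)

/-- The curvature operator `R(c, e) b`. -/
def curv (Γ : V → V →L[ℝ] V →L[ℝ] V) (x c e b : V) : V :=
  fderiv ℝ Γ x c e b - fderiv ℝ Γ x e c b + Γ x c (Γ x e b) - Γ x e (Γ x c b)

variable {U : Set V} {B : V → V →L[ℝ] V →L[ℝ] ℝ} {Γ : V → V →L[ℝ] V →L[ℝ] V} {x : V}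

lemma two_le_smooth : minSmoothness ℝ 2 ≤ ∞ := by
  rw [minSmoothness_of_isRCLikeNormedField]; exact WithTop.coe_le_coe.2 (le_top : (2 : ℕ∞) ≤ ⊤)

lemma fderiv_congr_of_mem {F : Type*} [NormedAddCommGroup F] [NormedSpace ℝ F] {f g : V → F}
    (hU : IsOpen U) (hx : x ∈ U) (h : ∀ y ∈ U, f y = g y) : fderiv ℝ f x = fderiv ℝ g x :=
  Filter.EventuallyEq.fderiv_eq (Filter.eventually_of_mem (hU.mem_nhds hx) h)

lemma fderiv_eq_zero_of_mem {F : Type*} [NormedAddCommGroup F] [NormedSpace ℝ F] {f : V → F} {c : F}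
    (hU : IsOpen U) (hx : x ∈ U) (h : ∀ y ∈ U, f y = c) : fderiv ℝ f x = 0 := by
  rw [fderiv_congr_of_mem (g := fun _ => c) hU hx h]; simp

lemma cov_add_right (Y : V → V) (x e f : V) : cov Γ Y x (e + f) = cov Γ Y x e + cov Γ Y x f := by
  simp [cov]; abel

lemma cov_smul_right (Y : V → V) (x : V) (c : ℝ) (e : V) :
    cov Γ Y x (c • e) = c • cov Γ Y x e := by
  simp [cov]

lemma cov_sub_right (Y : V → V) (x e f : V) : cov Γ Y x (e - f) = cov Γ Y x e - cov Γ Y x f := by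
  simp [cov]; abel

namespace IsLeviCivitaOn

variable (h : IsLeviCivitaOn U B Γ)
include h

lemma metric_at (hx : x ∈ U) : ContDiffAt ℝ ∞ B x :=
  h.smooth_metric.contDiffAt (h.isOpen.mem_nhds hx)

lemma conn_at (hx : x ∈ U) : ContDiffAt ℝ ∞ Γ x :=
  h.smooth_conn.contDiffAt (h.isOpen.mem_nhds hx)

lemma diff_metric (hx : x ∈ U) : DifferentiableAt ℝ B x :=
  (h.metric_at hx).differentiableAt (by simp)

lemma diff_conn (hx : x ∈ U) : DifferentiableAt ℝ Γ x :=
  (h.conn_at hx).differentiableAt (by simp)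

lemma fderiv_metric (hx : x ∈ U) {X Y : V → V} (hX : DifferentiableAt ℝ X x)
    (hY : DifferentiableAt ℝ Y x) (e : V) :
    fderiv ℝ (fun y => B y (X y) (Y y)) x e =
      B x (cov Γ X x e) (Y x) + B x (X x) (cov Γ Y x e) := by
  have hB := (h.diff_metric hx).hasFDerivAt
  rw [((hB.clm_apply hX.hasFDerivAt).clm_apply hY.hasFDerivAt).fderiv]
  simp [cov, h.compat x hx]
  ring

lemma contDiffAt_fderiv_conn (hx : x ∈ U) : ContDiffAt ℝ ∞ (fderiv ℝ Γ) x :=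
  (h.conn_at hx).fderiv_right (by simp)

lemma snd_fderiv_conn_symm (hx : x ∈ U) (a b : V) :
    fderiv ℝ (fderiv ℝ Γ) x a b = fderiv ℝ (fderiv ℝ Γ) x b a :=
  ((h.conn_at hx).isSymmSndFDerivAt two_le_smooth).eq a b

lemma fderiv_conn_symm (hx : x ∈ U) (e u v : V) :
    fderiv ℝ Γ x e u v = fderiv ℝ Γ x e v u := by
  have h1 : ∀ a b : V, fderiv ℝ (fun y => Γ y a b) x e = fderiv ℝ Γ x e a b := by
    intro a b
    have := ((h.diff_conn hx).hasFDerivAt.clm_apply (hasFDerivAt_const a x)).clm_apply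
      (hasFDerivAt_const b x)
    rw [this.fderiv]; simp
  rw [← h1, ← h1, fderiv_congr_of_mem h.isOpen hx (fun y hy => h.torsion y hy u v)]

omit h in
lemma curv_antisymm (x c e b : V) : curv Γ x c e b = - curv Γ x e c b := by
  simp [curv]; abel

lemma curv_cyclic (hx : x ∈ U) (c e b : V) :
    curv Γ x c e b + curv Γ x e b c + curv Γ x b c e = 0 := by
  simp only [curv]
  rw [h.fderiv_conn_symm hx c b e, h.fderiv_conn_symm hx e b c, h.fderiv_conn_symm hx b c e,
    h.torsion x hx e b, h.torsion x hx c b, h.torsion x hx c e]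
  abel

/-- Differentiating `compat` once more expresses the second derivative of the metric through `Γ` and
its derivative. The symmetry of that second derivative in its two directions is the skew-adjointness
of the curvature operator. -/
lemma curv_metric (hx : x ∈ U) (c e a b : V) :
    B x a (curv Γ x c e b) = - B x b (curv Γ x c e a) := by
  have hB := h.diff_metric hx
  have hG := h.diff_conn hx
  have key : ∀ c e : V, fderiv ℝ (fderiv ℝ B) x c e a b =
      B x (Γ x c (Γ x e a)) b + B x (Γ x e a) (Γ x c b) + B x (fderiv ℝ Γ x c e a) b
      + (B x (Γ x c a) (Γ x e b) + B x a (Γ x c (Γ x e b)) + B x a (fderiv ℝ Γ x c e b)) := by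
    intro c e
    have hB2 : DifferentiableAt ℝ (fderiv ℝ B) x :=
      ((h.metric_at hx).fderiv_right (m := ∞) (by simp)).differentiableAt (by simp)
    have e1 : fderiv ℝ (fun y => fderiv ℝ B y e a b) x c = fderiv ℝ (fderiv ℝ B) x c e a b := by
      have := (((hB2.hasFDerivAt).clm_apply (hasFDerivAt_const e x)).clm_apply
        (hasFDerivAt_const a x)).clm_apply (hasFDerivAt_const b x)
      rw [this.fderiv]; simp
    rw [← e1, fderiv_congr_of_mem h.isOpen hx (fun y hy => h.compat y hy e a b)]
    have hGa : ∀ a : V, HasFDerivAt (fun y => Γ y e a) _ x := fun a =>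
      (hG.hasFDerivAt.clm_apply (hasFDerivAt_const e x)).clm_apply (hasFDerivAt_const a x)
    have t1 := (hB.hasFDerivAt.clm_apply (hGa a)).clm_apply (hasFDerivAt_const b x)
    have t2 := (hB.hasFDerivAt.clm_apply (hasFDerivAt_const a x)).clm_apply (hGa b)
    erw [(t1.add t2).fderiv]
    simp [h.compat x hx]
    ring
  have hs : fderiv ℝ (fderiv ℝ B) x c e = fderiv ℝ (fderiv ℝ B) x e c :=
    ((h.metric_at hx).isSymmSndFDerivAt two_le_smooth).eq c e
  have h1 := key c e
  have h2 := key e c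
  rw [hs, h2] at h1
  simp only [curv, map_add, map_sub]
  rw [h.symm x hx b (Γ x c (Γ x e a)), h.symm x hx b (Γ x e (Γ x c a)),
    h.symm x hx b (fderiv ℝ Γ x c e a), h.symm x hx b (fderiv ℝ Γ x e c a)]
  linarith

/-- Pair symmetry of the Riemann tensor. -/
lemma curv_pair (hx : x ∈ U) (a b c e : V) :
    B x a (curv Γ x c e b) = B x c (curv Γ x a b e) := by
  have A := fun a b c e => h.curv_metric hx c e a b
  have S : ∀ a b c e, B x a (curv Γ x c e b) = - B x a (curv Γ x e c b) := by
    intro a b c e; rw [curv_antisymm (Γ := Γ) x c e b]; simp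
  have Cy : ∀ a b c e, B x a (curv Γ x c e b) + B x a (curv Γ x e b c)
      + B x a (curv Γ x b c e) = 0 := by
    intro a b c e
    rw [← map_add, ← map_add, h.curv_cyclic hx, map_zero]
  -- The octahedron argument: the cyclic identity for four arrangements of the arguments, combined
  -- using the two antisymmetries.
  linarith [Cy a b c e, Cy b c e a, Cy c e a b, Cy e a b c, A a b c e, A a c e b, A a e b c,
    A b c e a, A b e a c, A c e a b, S a b c e, S a c e b, S a e b c, S b a c e, S b c e a,
    S b e a c, S c a b e, S c b e a, S c e a b, S e a b c, S e b c a, S e c a b]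

/-- The differential Bianchi identity. -/
lemma bianchi_curv (hx : x ∈ U) (f c e b : V) :
    let D := fun f c e b => fderiv ℝ (fun y => curv Γ y c e b) x f + Γ x f (curv Γ x c e b)
      - curv Γ x (Γ x f c) e b - curv Γ x c (Γ x f e) b - curv Γ x c e (Γ x f b)
    D f c e b + D c e f b + D e f c b = 0 := by
  intro D
  have hG := (h.diff_conn hx).hasFDerivAt
  have hG2 : HasFDerivAt (fderiv ℝ Γ) _ x :=
    ((h.contDiffAt_fderiv_conn hx).differentiableAt (by simp)).hasFDerivAt
  have key : ∀ f c e b : V, fderiv ℝ (fun y => curv Γ y c e b) x f =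
      fderiv ℝ (fderiv ℝ Γ) x f c e b - fderiv ℝ (fderiv ℝ Γ) x f e c b
      + (fderiv ℝ Γ x f c (Γ x e b) + Γ x c (fderiv ℝ Γ x f e b))
      - (fderiv ℝ Γ x f e (Γ x c b) + Γ x e (fderiv ℝ Γ x f c b)) := by
    intro f c e b
    have k := fun v : V => hasFDerivAt_const (𝕜 := ℝ) v x
    have t1 := ((hG2.clm_apply (k c)).clm_apply (k e)).clm_apply (k b)
    have t2 := ((hG2.clm_apply (k e)).clm_apply (k c)).clm_apply (k b)
    have t3 := (hG.clm_apply (k c)).clm_apply ((hG.clm_apply (k e)).clm_apply (k b))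
    have t4 := (hG.clm_apply (k e)).clm_apply ((hG.clm_apply (k c)).clm_apply (k b))
    have t := ((t1.sub t2).add t3).sub t4
    have : (fun y => curv Γ y c e b) = fun y => fderiv ℝ Γ y c e b - fderiv ℝ Γ y e c b
      + Γ y c (Γ y e b) - Γ y e (Γ y c b) := by funext y; rfl
    rw [this]
    erw [t.fderiv]
    simp
    abel
  -- In the cyclic sum the second derivatives of `Γ` cancel by their symmetry; the lower-order terms
  -- cancel by torsion-freeness.
  simp only [D, key]
  rw [h.snd_fderiv_conn_symm hx f c, h.snd_fderiv_conn_symm hx f e, h.snd_fderiv_conn_symm hx e c]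
  simp only [curv, map_add, map_sub]
  rw [h.torsion x hx c f, h.torsion x hx e f, h.torsion x hx e c]
  abel

/-- The Ricci identity. -/
lemma ricci_identity (hx : x ∈ U) {Z X Y : V → V} (hZ : ContDiffAt ℝ ∞ Z x)
    (hX : DifferentiableAt ℝ X x) (hY : DifferentiableAt ℝ Y x) :
    cov Γ (fun y => cov Γ Z y (Y y)) x (X x) - cov Γ (fun y => cov Γ Z y (X y)) x (Y x)
      - cov Γ Z x (cov Γ Y x (X x) - cov Γ X x (Y x)) = curv Γ x (X x) (Y x) (Z x) := by
  have hG := (h.diff_conn hx).hasFDerivAt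
  have hZ1 := (hZ.differentiableAt (by simp)).hasFDerivAt
  have hZ2 : HasFDerivAt (fderiv ℝ Z) _ x :=
    ((hZ.fderiv_right (m := ∞) (by simp)).differentiableAt (by simp)).hasFDerivAt
  have key : ∀ (Y : V → V), DifferentiableAt ℝ Y x → ∀ e,
      fderiv ℝ (fun y => cov Γ Z y (Y y)) x e =
        fderiv ℝ (fderiv ℝ Z) x e (Y x) + fderiv ℝ Z x (fderiv ℝ Y x e)
        + (fderiv ℝ Γ x e (Y x) (Z x) + Γ x (fderiv ℝ Y x e) (Z x)
          + Γ x (Y x) (fderiv ℝ Z x e)) := by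
    intro Y hY e
    have t := (hZ2.clm_apply hY.hasFDerivAt).add
      ((hG.clm_apply hY.hasFDerivAt).clm_apply hZ1)
    have : (fun y => cov Γ Z y (Y y)) = fun y => fderiv ℝ Z y (Y y) + Γ y (Y y) (Z y) := by
      funext y; rfl
    rw [this]
    erw [t.fderiv]
    simp
    abel
  have hs : fderiv ℝ (fderiv ℝ Z) x (X x) (Y x) = fderiv ℝ (fderiv ℝ Z) x (Y x) (X x) :=
    (hZ.isSymmSndFDerivAt two_le_smooth).eq _ _
  simp only [cov, curv]
  have kX := key X hX (Y x)
  have kY := key Y hY (X x)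
  simp only [cov] at kX kY
  rw [kX, kY, hs]
  simp only [map_add, map_sub, add_apply, sub_apply]
  rw [h.torsion x hx (X x) (Y x)]
  abel

end IsLeviCivitaOn

end LeviCivita


/-! ### The Bianchi identity for the Weyl part of the curvature -/

section WeylDerivative

set_option maxSynthPendingDepth 3

variable {V : Type*} [NormedAddCommGroup V] [NormedSpace ℝ V]

/-- The covariant derivative `(∇_e Q)(a, b, c, d)` of a covariant tensor field of rank four. -/
def covTensor (Γ : V → V →L[ℝ] V →L[ℝ] V) (Q : V → V →L[ℝ] V →L[ℝ] V →L[ℝ] V →L[ℝ] ℝ)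
    (x e a b c d : V) : ℝ :=
  fderiv ℝ Q x e a b c d - Q x (Γ x e a) b c d - Q x a (Γ x e b) c d - Q x a b (Γ x e c) d
    - Q x a b c (Γ x e d)

/-- The symmetries of the Riemann tensor. -/
structure IsCurvatureLike (Q : V →L[ℝ] V →L[ℝ] V →L[ℝ] V →L[ℝ] ℝ) : Prop where
  antisymm : ∀ a b c d, Q a b c d = - Q b a c d
  pair : ∀ a b c d, Q a b c d = Q c d a b
  cyclic : ∀ a b c d, Q a b c d + Q a c d b + Q a d b c = 0

/-- The Riemann tensor is the sum of `C`, of `ν` times the Kulkarni-Nomizu product of the metric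
with `ε n ⊗ n`, and of a constant curvature part. -/
def IsWeylDecompOn (U : Set V) (B : V → V →L[ℝ] V →L[ℝ] ℝ) (Γ : V → V →L[ℝ] V →L[ℝ] V)
    (C : V → V →L[ℝ] V →L[ℝ] V →L[ℝ] V →L[ℝ] ℝ) (n : V → V) (ν ε μ : ℝ) : Prop :=
  ∀ x ∈ U, ∀ a b c e, B x a (curv Γ x c e b) = C x a b c e
    + ν * (B x a c * (ε * B x (n x) b * B x (n x) e) - B x a e * (ε * B x (n x) b * B x (n x) c)
      - B x b c * (ε * B x (n x) a * B x (n x) e) + B x b e * (ε * B x (n x) a * B x (n x) c))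
    + μ * (B x a c * B x b e - B x a e * B x b c)

/-- The Cotton-type tensor `∇_a T_{bc} - ∇_b T_{ac}` of `T = ε n ⊗ n`. -/
def cottonNull (B : V → V →L[ℝ] V →L[ℝ] ℝ) (Γ : V → V →L[ℝ] V →L[ℝ] V) (n : V → V) (ε : ℝ)
    (x a b c : V) : ℝ :=
  ε * ((B x (cov Γ n x a) b - B x (cov Γ n x b) a) * B x (n x) c
    + B x (n x) b * B x (cov Γ n x a) c - B x (n x) a * B x (cov Γ n x b) c)

variable {U : Set V} {B : V → V →L[ℝ] V →L[ℝ] ℝ} {Γ : V → V →L[ℝ] V →L[ℝ] V} {x : V}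
  {C : V → V →L[ℝ] V →L[ℝ] V →L[ℝ] V →L[ℝ] ℝ} {n : V → V} {ν ε μ : ℝ}

/-- The Leibniz rule in the form used throughout: when a component of `C` along vector fields
vanishes identically, the left side is zero and `∇C` becomes an algebraic expression in `C` and the
connection coefficients. -/
lemma fderiv_tensor (hC : DifferentiableAt ℝ C x) {X Y Z W : V → V}
    (hX : DifferentiableAt ℝ X x) (hY : DifferentiableAt ℝ Y x)
    (hZ : DifferentiableAt ℝ Z x) (hW : DifferentiableAt ℝ W x) (e : V) :
    fderiv ℝ (fun y => C y (X y) (Y y) (Z y) (W y)) x e =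
      covTensor Γ C x e (X x) (Y x) (Z x) (W x) + C x (cov Γ X x e) (Y x) (Z x) (W x)
      + C x (X x) (cov Γ Y x e) (Z x) (W x) + C x (X x) (Y x) (cov Γ Z x e) (W x)
      + C x (X x) (Y x) (Z x) (cov Γ W x e) := by
  rw [((((hC.hasFDerivAt.clm_apply hX.hasFDerivAt).clm_apply hY.hasFDerivAt).clm_apply
    hZ.hasFDerivAt).clm_apply hW.hasFDerivAt).fderiv]
  simp [cov, covTensor]
  ring

lemma fderiv_tensor_const (hC : DifferentiableAt ℝ C x) (e a b c d : V) :
    fderiv ℝ (fun y => C y a b c d) x e = fderiv ℝ C x e a b c d := by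
  have k := fun v : V => hasFDerivAt_const (𝕜 := ℝ) v x
  rw [((((hC.hasFDerivAt.clm_apply (k a)).clm_apply (k b)).clm_apply
    (k c)).clm_apply (k d)).fderiv]
  simp

lemma covTensor_curvatureLike (hU : IsOpen U) (hx : x ∈ U) (hC : DifferentiableAt ℝ C x)
    (hQ : ∀ y ∈ U, IsCurvatureLike (C y)) (e a b c d : V) :
    covTensor Γ C x e a b c d = - covTensor Γ C x e b a c d ∧
    covTensor Γ C x e a b c d = covTensor Γ C x e c d a b := by
  have d1 : fderiv ℝ C x e a b c d = - fderiv ℝ C x e b a c d := by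
    rw [← fderiv_tensor_const hC, ← fderiv_tensor_const hC,
      fderiv_congr_of_mem hU hx (fun y hy => (hQ y hy).antisymm a b c d)]
    simp
  have d2 : fderiv ℝ C x e a b c d = fderiv ℝ C x e c d a b := by
    rw [← fderiv_tensor_const hC, ← fderiv_tensor_const hC,
      fderiv_congr_of_mem hU hx (fun y hy => (hQ y hy).pair a b c d)]
  have q := hQ x hx
  constructor
  · simp only [covTensor]
    rw [d1, q.antisymm (Γ x e a), q.antisymm a (Γ x e b), q.antisymm a b (Γ x e c) d,
      q.antisymm a b c (Γ x e d)]
    ring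
  · simp only [covTensor]
    rw [d2, q.pair (Γ x e a), q.pair a (Γ x e b), q.pair a b (Γ x e c) d,
      q.pair a b c (Γ x e d)]
    ring

namespace IsLeviCivitaOn

variable (h : IsLeviCivitaOn U B Γ)
include h

lemma fderiv_metric_const (hx : x ∈ U) (e a b : V) :
    HasFDerivAt (fun y => B y a b) (fderiv ℝ (fun y => B y a b) x) x ∧
    fderiv ℝ (fun y => B y a b) x e = B x (Γ x e a) b + B x a (Γ x e b) := by
  have k := fun v : V => hasFDerivAt_const (𝕜 := ℝ) v x
  have t := ((h.diff_metric hx).hasFDerivAt.clm_apply (k a)).clm_apply (k b)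
  refine ⟨t.differentiableAt.hasFDerivAt, ?_⟩
  rw [h.fderiv_metric hx (differentiableAt_const a) (differentiableAt_const b)]
  simp [cov]

lemma fderiv_lower (hx : x ∈ U) (hn : DifferentiableAt ℝ n x) (e a : V) :
    HasFDerivAt (fun y => B y (n y) a) (fderiv ℝ (fun y => B y (n y) a) x) x ∧
    fderiv ℝ (fun y => B y (n y) a) x e = B x (cov Γ n x e) a + B x (n x) (Γ x e a) := by
  have k := fun v : V => hasFDerivAt_const (𝕜 := ℝ) v x
  have t := ((h.diff_metric hx).hasFDerivAt.clm_apply hn.hasFDerivAt).clm_apply (k a)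
  refine ⟨t.differentiableAt.hasFDerivAt, ?_⟩
  rw [h.fderiv_metric hx hn (differentiableAt_const a)]
  simp [cov]

set_option maxHeartbeats 800000 in
-- `C` is the curvature minus terms in `B` and `n`. The metric is parallel, so apart from the
-- curvature only `∇n` is differentiated. The bracket with `curv` is the expression whose cyclic sum
-- `bianchi_curv` annihilates.
lemma covTensor_eq (hx : x ∈ U) (hC : DifferentiableAt ℝ C x) (hn : DifferentiableAt ℝ n x)
    (hW : IsWeylDecompOn U B Γ C n ν ε μ) (f a b c e : V) :
    covTensor Γ C x f a b c e =
      B x a (fderiv ℝ (fun y => curv Γ y c e b) x f + Γ x f (curv Γ x c e b)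
        - curv Γ x (Γ x f c) e b - curv Γ x c (Γ x f e) b - curv Γ x c e (Γ x f b))
      - ν * ε * (
        B x a c * (B x (cov Γ n x f) b * B x (n x) e + B x (n x) b * B x (cov Γ n x f) e)
        - B x a e * (B x (cov Γ n x f) b * B x (n x) c + B x (n x) b * B x (cov Γ n x f) c)
        - B x b c * (B x (cov Γ n x f) a * B x (n x) e + B x (n x) a * B x (cov Γ n x f) e)
        + B x b e * (B x (cov Γ n x f) a * B x (n x) c + B x (n x) a * B x (cov Γ n x f) c)) := by
  have hcurv : DifferentiableAt ℝ (fun y => curv Γ y c e b) x := by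
    have hG := (h.diff_conn hx)
    have hG2 : DifferentiableAt ℝ (fderiv ℝ Γ) x :=
      ((h.contDiffAt_fderiv_conn hx).differentiableAt (by simp))
    unfold curv
    fun_prop
  have G := fun a b => (h.fderiv_metric_const hx f a b)
  have N := fun a => (h.fderiv_lower hx hn f a)
  have R := (h.diff_metric hx).hasFDerivAt.clm_apply (hasFDerivAt_const a x)
    |>.clm_apply hcurv.hasFDerivAt
  have Rv : fderiv ℝ (fun y => B y a (curv Γ y c e b)) x f =
      B x (Γ x f a) (curv Γ x c e b)
        + B x a (fderiv ℝ (fun y => curv Γ y c e b) x f + Γ x f (curv Γ x c e b)) := by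
    rw [h.fderiv_metric hx (differentiableAt_const a) hcurv]
    simp [cov]
  have P := fun a c b e => (G a c).1.mul ((((N b).1.const_mul ε)).mul (N e).1)
  have Q := ((((P a c b e).sub (P a e b c)).sub (P b c a e)).add (P b e a c)).const_mul ν
  have S := (((G a c).1.mul (G b e).1).sub ((G a e).1.mul (G b c).1)).const_mul μ
  have tot := (R.differentiableAt.hasFDerivAt.sub S).sub Q
  have k := fun v : V => hasFDerivAt_const (𝕜 := ℝ) v x
  have tC := (((hC.hasFDerivAt.clm_apply (k a)).clm_apply (k b)).clm_apply (k c)).clm_apply (k e)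
  have e1 := tC.unique (tot.congr_of_eventuallyEq (Filter.eventually_of_mem (h.isOpen.mem_nhds hx)
      (fun y hy => eq_sub_of_add_eq (eq_sub_of_add_eq (hW y hy a b c e).symm))))
  have e2 := DFunLike.congr_fun e1 f
  -- The decomposition with `Γ` inserted in each slot in turn converts the coordinate derivatives
  -- into covariant ones.
  have w := hW x hx
  have c1 := w (Γ x f a) b c e
  have c2 := w a (Γ x f b) c e
  have c3 := w a b (Γ x f c) e
  have c4 := w a b c (Γ x f e)
  simp [(G _ _).2, (N _).2, Rv] at e2
  simp only [covTensor, map_add, map_sub]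
  linear_combination e2 + c1 + c2 + c3 + c4

/-- The curvature and the two metric terms each have these symmetries, so the difference `C`
inherits them. -/
lemma curvatureLike_of_decomp (hW : IsWeylDecompOn U B Γ C n ν ε μ) (hx : x ∈ U) :
    IsCurvatureLike (C x) where
  antisymm a b c d := by
    linear_combination - hW x hx a b c d - hW x hx b a c d + h.curv_metric hx c d a b
  pair a b c d := by
    have hs := h.symm x hx
    have w1 := hW x hx a b c d
    have w2 := hW x hx c d a b
    rw [hs c a, hs c b, hs d a, hs d b] at w2
    linear_combination - w1 + w2 + h.curv_pair hx a b c d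
  cyclic a b c d := by
    have hs := h.symm x hx
    have w1 := hW x hx a b c d
    have w2 := hW x hx a c d b
    have w3 := hW x hx a d b c
    rw [hs c b] at w2
    rw [hs d b, hs d c] at w3
    have h0 : B x a (curv Γ x c d b) + B x a (curv Γ x d b c) + B x a (curv Γ x b c d) = 0 := by
      rw [← map_add, ← map_add, h.curv_cyclic hx, map_zero]
    linear_combination h0 - w1 - w2 - w3

/-- The differential Bianchi identity in terms of the Weyl part of the curvature. -/
lemma bianchi_weyl (hx : x ∈ U) (hC : DifferentiableAt ℝ C x) (hn : DifferentiableAt ℝ n x)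
    (hW : IsWeylDecompOn U B Γ C n ν ε μ) (e a b c d : V) :
    covTensor Γ C x e a b c d + covTensor Γ C x a b e c d + covTensor Γ C x b e a c d =
      ν * (B x a c * cottonNull B Γ n ε x b e d - B x a d * cottonNull B Γ n ε x b e c
        + B x b c * cottonNull B Γ n ε x e a d - B x b d * cottonNull B Γ n ε x e a c
        + B x e c * cottonNull B Γ n ε x a b d - B x e d * cottonNull B Γ n ε x a b c) := by
  have hs := h.symm x hx
  have key := congrArg (fun v => B x c v) (h.bianchi_curv hx e a b d)
  have pr := fun e a b => (covTensor_curvatureLike (Γ := Γ) h.isOpen hx hC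
    (fun y hy => h.curvatureLike_of_decomp hW hy) e a b c d).2
  -- Pair symmetry moves the cyclically permuted indices next to the direction of differentiation,
  -- into the antisymmetric pair of `bianchi_curv`.
  rw [pr, pr, pr, h.covTensor_eq hx hC hn hW, h.covTensor_eq hx hC hn hW,
    h.covTensor_eq hx hC hn hW]
  simp only [map_add, map_zero] at key
  simp only [map_add, map_sub] at key ⊢
  rw [hs a c, hs a d, hs b c, hs b d, hs e c, hs e d]
  simp only [cottonNull]
  linear_combination key

end IsLeviCivitaOn

end WeylDerivative


/-! ### The metric trace and its compatibility with covariant differentiation -/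

section Trace

set_option maxSynthPendingDepth 3
set_option linter.unusedSectionVars false

variable {V : Type*} [NormedAddCommGroup V] [NormedSpace ℝ V] [FiniteDimensional ℝ V]

/-- The trace of the bilinear form `f` with respect to the scalar product `b`. -/
def metricTrace (b f : V →L[ℝ] V →L[ℝ] ℝ) : ℝ :=
  LinearMap.trace ℝ V ((b.inverse ∘L f : V →L[ℝ] V) : V →ₗ[ℝ] V)

lemma exists_equiv_of_nondeg (b : V →L[ℝ] V →L[ℝ] ℝ) (hb : ∀ u, (∀ v, b u v = 0) → u = 0) :
    ∃ e : V ≃L[ℝ] (V →L[ℝ] ℝ), (e : V →L[ℝ] V →L[ℝ] ℝ) = b := by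
  have hinj : Function.Injective (b : V →ₗ[ℝ] V →L[ℝ] ℝ) := by
    rw [← LinearMap.ker_eq_bot, LinearMap.ker_eq_bot']
    intro u hu
    exact hb u (fun v => by have := DFunLike.congr_fun hu v; simpa using this)
  have hdim : Module.finrank ℝ V = Module.finrank ℝ (V →L[ℝ] ℝ) := by
    rw [← (LinearMap.toContinuousLinearMap (𝕜 := ℝ) (E := V) (F' := ℝ)).finrank_eq]
    exact (Subspace.dual_finrank_eq (K := ℝ) (V := V)).symm
  let e := (LinearMap.linearEquivOfInjective (b : V →ₗ[ℝ] V →L[ℝ] ℝ) hinj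
    hdim).toContinuousLinearEquiv
  exact ⟨e, by ext u v; rfl⟩

/-- `ContinuousLinearMap.inverse` takes the default value `0` on maps that are not invertible; in
finite dimension nondegeneracy makes `b` invertible. -/
lemma apply_inverse {b : V →L[ℝ] V →L[ℝ] ℝ} (hb : ∀ u, (∀ v, b u v = 0) → u = 0)
    (φ : V →L[ℝ] ℝ) : b (b.inverse φ) = φ := by
  obtain ⟨e, rfl⟩ := exists_equiv_of_nondeg b hb
  simp

lemma inverse_apply {b : V →L[ℝ] V →L[ℝ] ℝ} (hb : ∀ u, (∀ v, b u v = 0) → u = 0)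
    (u : V) : b.inverse (b u) = u := by
  obtain ⟨e, rfl⟩ := exists_equiv_of_nondeg b hb
  simp

variable {U : Set V} {B : V → V →L[ℝ] V →L[ℝ] ℝ} {Γ : V → V →L[ℝ] V →L[ℝ] V} {x : V}

lemma IsLeviCivitaOn.contDiffAt_inverse (h : IsLeviCivitaOn U B Γ) (hx : x ∈ U) :
    ContDiffAt ℝ ∞ (fun y => (B y).inverse) x := by
  obtain ⟨e, he⟩ := exists_equiv_of_nondeg (B x) (h.nondeg x hx)
  have h1 : ContDiffAt ℝ ∞ ContinuousLinearMap.inverse (B x) := he ▸ contDiffAt_map_inverse e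
  exact h1.comp x (h.metric_at hx)

/-- The covariant derivative commutes with the metric trace. -/
lemma IsLeviCivitaOn.metricTrace_cov_eq_zero (h : IsLeviCivitaOn U B Γ) (hx : x ∈ U)
    {F : V → V →L[ℝ] V →L[ℝ] ℝ} (hF : DifferentiableAt ℝ F x)
    (h0 : ∀ y ∈ U, metricTrace (B y) (F y) = 0) (e : V) (G : V →L[ℝ] V →L[ℝ] ℝ)
    (hG : ∀ u v, G u v = fderiv ℝ F x e u v - F x (Γ x e u) v - F x u (Γ x e v)) :
    metricTrace (B x) G = 0 := by
  set M : V → V →L[ℝ] V := fun y => (B y).inverse ∘L F y with hM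
  have hMd : DifferentiableAt ℝ M x :=
    ((h.contDiffAt_inverse hx).differentiableAt (by simp)).clm_comp hF
  have hBM : ∀ y ∈ U, ∀ u v, B y (M y u) v = F y u v := by
    intro y hy u v
    simp only [hM, ContinuousLinearMap.comp_apply, apply_inverse (h.nondeg y hy)]
  have k := fun v : V => hasFDerivAt_const (𝕜 := ℝ) v x
  have hder : ∀ u v, B x (fderiv ℝ M x e u + Γ x e (M x u) - M x (Γ x e u)) v = G u v := by
    intro u v
    have t1 := ((h.diff_metric hx).hasFDerivAt.clm_apply
      (hMd.hasFDerivAt.clm_apply (k u))).clm_apply (k v)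
    have t2 := (hF.hasFDerivAt.clm_apply (k u)).clm_apply (k v)
    have e1 := t1.unique (t2.congr_of_eventuallyEq
      (Filter.eventually_of_mem (h.isOpen.mem_nhds hx) (fun y hy => hBM y hy u v)))
    have e2 := DFunLike.congr_fun e1 e
    simp [h.compat x hx] at e2
    rw [hG, ← e2, ← hBM x hx, ← hBM x hx]
    simp
    ring
  have hinv : (B x).inverse ∘L G = fderiv ℝ M x e + (Γ x e ∘L M x) - (M x ∘L Γ x e) := by
    ext u
    have : G u = B x (fderiv ℝ M x e u + Γ x e (M x u) - M x (Γ x e u)) := by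
      ext v; exact (hder u v).symm
    simp [this, inverse_apply (h.nondeg x hx)]
  let τ : (V →L[ℝ] V) →L[ℝ] ℝ := LinearMap.toContinuousLinearMap
    (LinearMap.trace ℝ V ∘ₗ ContinuousLinearMap.coeLM ℝ)
  have hτ : τ (fderiv ℝ M x e) = 0 := by
    have t := τ.hasFDerivAt.comp x hMd.hasFDerivAt
    have := fderiv_eq_zero_of_mem (f := τ ∘ M) h.isOpen hx (fun y hy => h0 y hy)
    rw [t.fderiv] at this
    have := DFunLike.congr_fun this e
    simpa using this
  -- For the endomorphism `M = B⁻¹ F` the covariant derivative differs from the ordinary one by a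
  -- commutator with `Γ_e`, which has no trace.
  have hc : τ (Γ x e ∘L M x) = τ (M x ∘L Γ x e) :=
    LinearMap.trace_mul_comm ℝ ((Γ x e : V →L[ℝ] V) : V →ₗ[ℝ] V) ((M x : V →L[ℝ] V) : V →ₗ[ℝ] V)
  change τ ((B x).inverse ∘L G) = 0
  rw [hinv, map_sub, map_add, hτ, hc]
  simp

end Trace

/-! ### Null frames as bases with an explicit dual basis -/

section NullFrame

set_option maxSynthPendingDepth 3
set_option linter.unusedSectionVars false

variable {V : Type*} [NormedAddCommGroup V] [NormedSpace ℝ V] [FiniteDimensional ℝ V]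
  {d : ℕ} {b : V →L[ℝ] V →L[ℝ] ℝ} {l n : V} {m : Fin (d - 2) → V}

/-- The index of the frame vector dual to a given one. -/
def dualIndex : Fin 2 ⊕ Fin (d - 2) → Fin 2 ⊕ Fin (d - 2) := Sum.map (Equiv.swap 0 1) id

lemma IsNullFrame.apply_dual (hf : IsNullFrame d (fun u v => b u v) l n m)
    (hs : ∀ u v, b u v = b v u) (i j : Fin 2 ⊕ Fin (d - 2)) :
    b (frameVec l n m i) (frameVec l n m (dualIndex j)) = if i = j then 1 else 0 := by
  have h1 := hf.l_l; have h2 := hf.n_n; have h3 := hf.l_n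
  have h4 : b n l = 1 := by rw [hs]; exact h3
  have h5 := hf.l_m; have h6 := hf.n_m; have h7 := hf.m_m
  have h8 : ∀ i, b (m i) l = 0 := fun i => by rw [hs]; exact h5 i
  have h9 : ∀ i, b (m i) n = 0 := fun i => by rw [hs]; exact h6 i
  rcases i with i | i <;> rcases j with j | j
  · fin_cases i <;> fin_cases j <;> simp [frameVec, dualIndex, h1, h2, h3, h4]
  · fin_cases i <;> simp [frameVec, dualIndex, h5, h6]
  · fin_cases j <;> simp [frameVec, dualIndex, h8, h9]
  · simp [frameVec, dualIndex, h7]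

lemma IsNullFrame.linearIndependent (hf : IsNullFrame d (fun u v => b u v) l n m)
    (hs : ∀ u v, b u v = b v u) : LinearIndependent ℝ (frameVec l n m) := by
  rw [Fintype.linearIndependent_iff]
  intro c hc i
  have := congrArg (fun v => b v (frameVec l n m (dualIndex i))) hc
  simpa [-Fintype.sum_sum_type, hf.apply_dual hs] using this

/-- The basis given by a null frame. -/
def IsNullFrame.basis (hf : IsNullFrame d (fun u v => b u v) l n m)
    (hs : ∀ u v, b u v = b v u) (hd : 2 ≤ d) (hdim : Module.finrank ℝ V = d) :
    Module.Basis (Fin 2 ⊕ Fin (d - 2)) ℝ V :=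
  haveI : Nonempty (Fin 2 ⊕ Fin (d - 2)) := ⟨Sum.inl 0⟩
  basisOfLinearIndependentOfCardEqFinrank (hf.linearIndependent hs) (by
    rw [hdim]; simp; omega)

lemma IsNullFrame.basis_apply (hf : IsNullFrame d (fun u v => b u v) l n m)
    (hs : ∀ u v, b u v = b v u) (hd : 2 ≤ d) (hdim : Module.finrank ℝ V = d)
    (i : Fin 2 ⊕ Fin (d - 2)) : hf.basis hs hd hdim i = frameVec l n m i := by
  simp [IsNullFrame.basis]

lemma IsNullFrame.basis_repr (hf : IsNullFrame d (fun u v => b u v) l n m)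
    (hs : ∀ u v, b u v = b v u) (hd : 2 ≤ d) (hdim : Module.finrank ℝ V = d) (v : V)
    (i : Fin 2 ⊕ Fin (d - 2)) :
    (hf.basis hs hd hdim).repr v i = b v (frameVec l n m (dualIndex i)) := by
  conv_rhs => rw [← (hf.basis hs hd hdim).sum_repr v]
  simp [-Fintype.sum_sum_type, hf.basis_apply, hf.apply_dual hs]

lemma IsNullFrame.expand (hf : IsNullFrame d (fun u v => b u v) l n m)
    (hs : ∀ u v, b u v = b v u) (hd : 2 ≤ d) (hdim : Module.finrank ℝ V = d) (v : V) :
    v = b v n • l + b v l • n + ∑ i, b v (m i) • m i := by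
  conv_lhs => rw [← (hf.basis hs hd hdim).sum_repr v]
  simp [hf.basis_repr, hf.basis_apply, frameVec, dualIndex]

lemma IsNullFrame.ext_form (hf : IsNullFrame d (fun u v => b u v) l n m)
    (hs : ∀ u v, b u v = b v u) (hd : 2 ≤ d) (hdim : Module.finrank ℝ V = d) {u v : V}
    (h1 : b u l = b v l) (h2 : b u n = b v n) (h3 : ∀ i, b u (m i) = b v (m i)) : u = v := by
  rw [hf.expand hs hd hdim u, hf.expand hs hd hdim v, h1, h2]
  simp [h3]

lemma IsNullFrame.nondeg (hf : IsNullFrame d (fun u v => b u v) l n m)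
    (hs : ∀ u v, b u v = b v u) (hd : 2 ≤ d) (hdim : Module.finrank ℝ V = d) (u : V)
    (hu : ∀ v, b u v = 0) : u = 0 := by
  apply hf.ext_form hs hd hdim <;> simp [hu]

lemma IsNullFrame.metricTrace_eq (hf : IsNullFrame d (fun u v => b u v) l n m)
    (hs : ∀ u v, b u v = b v u) (hd : 2 ≤ d) (hdim : Module.finrank ℝ V = d)
    (f : V →L[ℝ] V →L[ℝ] ℝ) :
    metricTrace b f = f l n + f n l + ∑ i, f (m i) (m i) := by
  rw [metricTrace, LinearMap.trace_eq_matrix_trace ℝ (hf.basis hs hd hdim), Matrix.trace]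
  simp only [Matrix.diag, LinearMap.toMatrix_apply, hf.basis_repr, hf.basis_apply,
    ContinuousLinearMap.coe_coe, ContinuousLinearMap.comp_apply,
    apply_inverse (hf.nondeg hs hd hdim)]
  simp [frameVec, dualIndex]

end NullFrame


/-! ### Transverse configurations: normalisation, extension of vectors, traces of `∇C` -/

section Transverse

set_option maxSynthPendingDepth 3
set_option linter.unusedSectionVars false

variable {V : Type*} [NormedAddCommGroup V] [NormedSpace ℝ V]

/-- All components of `Q` of nonnegative boost weight with respect to the null vector `l` vanish. -/
structure HasNegBoost (b : V →L[ℝ] V →L[ℝ] ℝ) (Q : V →L[ℝ] V →L[ℝ] V →L[ℝ] V →L[ℝ] ℝ) (l : V) :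
    Prop where
  perp : ∀ X Y Z W, b X l = 0 → b Y l = 0 → b Z l = 0 → b W l = 0 → Q X Y Z W = 0
  left_perp : ∀ X Y Z, b X l = 0 → b Y l = 0 → Q l X Y Z = 0
  right_perp : ∀ X Y Z, b X l = 0 → b Y l = 0 → Q l Z X Y = 0
  left_left : ∀ Z W, Q l Z l W = 0

/-- The partial evaluation `(u, v) ↦ Q(u, b, v, e)`. -/
def slot (Q : V →L[ℝ] V →L[ℝ] V →L[ℝ] V →L[ℝ] ℝ) (b e : V) : V →L[ℝ] V →L[ℝ] ℝ :=
  ContinuousLinearMap.flip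
    ((ContinuousLinearMap.compL ℝ V (V →L[ℝ] ℝ) ℝ (ContinuousLinearMap.apply ℝ ℝ e)) ∘L
      Q.flip b).flip

@[simp] lemma slot_apply (Q : V →L[ℝ] V →L[ℝ] V →L[ℝ] V →L[ℝ] ℝ) (b e u v : V) :
    slot Q b e u v = Q u b v e := by
  simp [slot]

/-- A spacetime region with Ricci tensor `λ g + ε n ⊗ n` for a null vector field `n` transverse to
the null vector field `l`, with respect to which the Weyl tensor has negative boost order. -/
structure IsTransverseOn (d : ℕ) (U : Set V) (B : V → V →L[ℝ] V →L[ℝ] ℝ)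
    (Γ : V → V →L[ℝ] V →L[ℝ] V) (C : V → V →L[ℝ] V →L[ℝ] V →L[ℝ] V →L[ℝ] ℝ) (l n : V → V)
    (ε μ : ℝ) : Prop where
  lc : IsLeviCivitaOn U B Γ
  dim_ge : 4 ≤ d
  dim_eq : Module.finrank ℝ V = d
  smooth_C : ContDiffOn ℝ ∞ C U
  smooth_l : ContDiffOn ℝ ∞ l U
  smooth_n : ContDiffOn ℝ ∞ n U
  eps_ne : ε ≠ 0
  decomp : IsWeylDecompOn U B Γ C n (1 / ((d : ℝ) - 2)) ε μ
  traceless : ∀ x ∈ U, ∀ b e, metricTrace (B x) (slot (C x) b e) = 0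
  neg : ∀ x ∈ U, HasNegBoost (B x) (C x) (l x)
  frame : ∀ x ∈ U, ∃ m, IsNullFrame d (fun u v => B x u v) (l x) (n x) m

/-- Elimination of `κ` from the Bianchi equations of boost weight one. -/
lemma trace_elimination {ι : Type*} [Fintype ι] [DecidableEq ι] [Nonempty ι] {D ε ν : ℝ}
    (hD : D = Fintype.card ι) (hε : ε ≠ 0) {κ ψ : ι → ℝ} {Ψ : ι → ι → ι → ℝ} {N : ι → ι → ℝ}
    (hanti : ∀ i j k, Ψ i j k = - Ψ i k j) (hψ : ∀ i, ψ i = ∑ j, Ψ j j i)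
    (h1 : ∀ i j, D * (κ j * ψ i - ∑ k, κ k * Ψ i k j) = ε * (N i j + if i = j then 2 * ν else 0))
    (h2 : ∀ i j k m, D * (κ i * Ψ j k m - κ j * Ψ i k m + κ k * Ψ m i j - κ m * Ψ k i j) =
      ε * ((if i = k then N j m else 0) - (if i = m then N j k else 0)
        - (if j = k then N i m else 0) + (if j = m then N i k else 0))) :
    (∑ i, N i i = - 2 * ν) ∧
      ∀ i k, (D - 1) * N i k + N k i = if i = k then ∑ j, N j j else 0 := by
  have hDpos : 0 < D := by rw [hD]; exact_mod_cast Fintype.card_pos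
  -- Contracting the second and fourth indices of `h2` turns its `κ`-side into minus the
  -- symmetrisation of the left side of `h1`, so `κ` disappears from the sum.
  have key : ∀ i k, (D - 2) * N i k + (if i = k then ∑ j, N j j else 0) =
      - N i k - N k i - (if i = k then 4 * ν else 0) := by
    intro i k
    have hsum := Finset.sum_congr (rfl : (Finset.univ : Finset ι) = Finset.univ)
      (fun j _ => h2 i j k j)
    rw [← Finset.mul_sum, ← Finset.mul_sum] at hsum
    simp only [Finset.sum_add_distrib, Finset.sum_sub_distrib, ← Finset.mul_sum] at hsum
    have e1 : ∑ j, Ψ j k j = - ψ k := by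
      rw [hψ, ← Finset.sum_neg_distrib]; exact Finset.sum_congr rfl (fun j _ => hanti _ _ _)
    have e2 : ∑ j, Ψ j i j = - ψ i := by
      rw [hψ, ← Finset.sum_neg_distrib]; exact Finset.sum_congr rfl (fun j _ => hanti _ _ _)
    have e3 : ∀ i k, ∑ j, κ j * Ψ i k j = - ∑ j, κ j * Ψ i j k := by
      intro i k
      rw [← Finset.sum_neg_distrib]
      exact Finset.sum_congr rfl (fun j _ => by rw [hanti]; ring)
    rw [e1, e2, e3, e3] at hsum
    have hr : ∑ j, (if i = k then N j j else 0) = if i = k then ∑ j, N j j else 0 := by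
      split_ifs <;> simp
    rw [hr] at hsum
    simp only [Finset.sum_ite_eq, Finset.sum_ite_eq', Finset.mem_univ, if_true, Finset.sum_const,
      Finset.card_univ, nsmul_eq_mul, ← hD] at hsum
    have a1 := h1 i k
    have a2 := h1 k i
    have hsy : (if k = i then 2 * ν else 0) = if i = k then 2 * ν else 0 := by
      simp only [eq_comm]
    rw [hsy] at a2
    have h4 : (if i = k then 4 * ν else 0) = 2 * (if i = k then 2 * ν else 0) := by
      split_ifs <;> ring
    rw [h4]
    apply mul_left_cancel₀ hε
    linear_combination - hsum - a1 - a2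
  have tr : ∑ i, N i i = - 2 * ν := by
    have := Finset.sum_congr (rfl : (Finset.univ : Finset ι) = Finset.univ) (fun i _ => key i i)
    simp only [if_true, Finset.sum_add_distrib, Finset.sum_sub_distrib, ← Finset.mul_sum,
      Finset.sum_const, Finset.card_univ, nsmul_eq_mul, ← hD, Finset.sum_neg_distrib] at this
    apply mul_left_cancel₀ hDpos.ne'
    linear_combination this / 2
  refine ⟨tr, fun i k => ?_⟩
  have := key i k
  rw [tr] at this ⊢
  split_ifs at this ⊢ <;> linear_combination this

namespace IsTransverseOn

variable [FiniteDimensional ℝ V] {d : ℕ} {U : Set V} {B : V → V →L[ℝ] V →L[ℝ] ℝ}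
  {Γ : V → V →L[ℝ] V →L[ℝ] V} {C : V → V →L[ℝ] V →L[ℝ] V →L[ℝ] V →L[ℝ] ℝ} {l n : V → V} {ε μ : ℝ}
  {x : V}

variable (h : IsTransverseOn d U B Γ C l n ε μ) (hx : x ∈ U)
include h hx

lemma diff_C : DifferentiableAt ℝ C x :=
  (h.smooth_C.contDiffAt (h.lc.isOpen.mem_nhds hx)).differentiableAt (by simp)

lemma contDiffAt_l : ContDiffAt ℝ ∞ l x := h.smooth_l.contDiffAt (h.lc.isOpen.mem_nhds hx)

lemma contDiffAt_n : ContDiffAt ℝ ∞ n x := h.smooth_n.contDiffAt (h.lc.isOpen.mem_nhds hx)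

lemma diff_l : DifferentiableAt ℝ l x := (h.contDiffAt_l hx).differentiableAt (by simp)

lemma diff_n : DifferentiableAt ℝ n x := (h.contDiffAt_n hx).differentiableAt (by simp)

lemma curvatureLike : IsCurvatureLike (C x) := h.lc.curvatureLike_of_decomp h.decomp hx

lemma l_l : B x (l x) (l x) = 0 := by
  obtain ⟨m, hm⟩ := h.frame x hx; exact hm.l_l

lemma n_n : B x (n x) (n x) = 0 := by
  obtain ⟨m, hm⟩ := h.frame x hx; exact hm.n_n

lemma l_n : B x (l x) (n x) = 1 := by
  obtain ⟨m, hm⟩ := h.frame x hx; exact hm.l_n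

lemma n_l : B x (n x) (l x) = 1 := by
  rw [h.lc.symm x hx]; exact h.l_n hx

lemma cov_l_l (e : V) : B x (cov Γ l x e) (l x) = 0 := by
  have h1 := h.lc.fderiv_metric hx (h.diff_l hx) (h.diff_l hx) e
  rw [fderiv_eq_zero_of_mem h.lc.isOpen hx (fun y hy => h.l_l hy),
    h.lc.symm x hx (l x)] at h1
  simp at h1
  linarith

lemma cov_n_n (e : V) : B x (cov Γ n x e) (n x) = 0 := by
  have h1 := h.lc.fderiv_metric hx (h.diff_n hx) (h.diff_n hx) e
  rw [fderiv_eq_zero_of_mem h.lc.isOpen hx (fun y hy => h.n_n hy),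
    h.lc.symm x hx (n x)] at h1
  simp at h1
  linarith

lemma cov_l_n (e : V) : B x (cov Γ l x e) (n x) = - B x (cov Γ n x e) (l x) := by
  have h1 := h.lc.fderiv_metric hx (h.diff_l hx) (h.diff_n hx) e
  rw [fderiv_eq_zero_of_mem h.lc.isOpen hx (fun y hy => h.l_n hy),
    h.lc.symm x hx (l x)] at h1
  simp at h1
  linarith

/-- A vector orthogonal to `l x` extends to a vector field orthogonal to `l`. -/
lemma exists_perp_extension {v : V} (hv : B x v (l x) = 0) :
    ∃ X : V → V, X x = v ∧ DifferentiableAt ℝ X x ∧ (∀ y ∈ U, B y (X y) (l y) = 0) ∧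
      ∀ e, B x (cov Γ X x e) (l x) = - B x (cov Γ l x e) v := by
  have hB := h.lc.diff_metric hx
  have hl := h.diff_l hx
  have hn := h.diff_n hx
  -- Since `n · l = 1`, removing a multiple of `n` projects onto the orthogonal complement of `l`
  -- and changes nothing at `x`.
  set X : V → V := fun y => v - B y v (l y) • n y with hX
  have hXx : X x = v := by simp [hX, hv]
  have hXd : DifferentiableAt ℝ X x := by
    simp only [hX]; fun_prop
  have hXl : ∀ y ∈ U, B y (X y) (l y) = 0 := by
    intro y hy; simp [hX, h.n_l hy]
  refine ⟨X, hXx, hXd, hXl, fun e => ?_⟩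
  have h1 := h.lc.fderiv_metric hx hXd hl e
  rw [fderiv_eq_zero_of_mem h.lc.isOpen hx hXl, hXx, h.lc.symm x hx v] at h1
  simp at h1
  linarith

/-- A vector orthogonal to `l x` and `n x` extends to a vector field orthogonal to `l` and `n`. -/
lemma exists_screen_extension {v : V} (hv : B x v (l x) = 0) (hv' : B x v (n x) = 0) :
    ∃ X : V → V, X x = v ∧ ContDiffOn ℝ ∞ X U ∧ (∀ y ∈ U, B y (X y) (l y) = 0) ∧
      (∀ y ∈ U, B y (X y) (n y) = 0) ∧
      (∀ e, B x (cov Γ X x e) (l x) = - B x (cov Γ l x e) v) ∧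
      ∀ e, B x (cov Γ X x e) (n x) = - B x (cov Γ n x e) v := by
  have hB := h.lc.smooth_metric
  have hl := h.smooth_l
  have hn := h.smooth_n
  set X : V → V := fun y => v - B y v (l y) • n y - B y v (n y) • l y with hX
  have hXx : X x = v := by simp [hX, hv, hv']
  have hXd : ContDiffOn ℝ ∞ X U := by
    have h1 : ContDiffOn ℝ ∞ (fun y => B y v (l y)) U :=
      (hB.clm_apply contDiffOn_const).clm_apply hl
    have h2 : ContDiffOn ℝ ∞ (fun y => B y v (n y)) U :=
      (hB.clm_apply contDiffOn_const).clm_apply hn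
    exact (contDiffOn_const.sub (h1.smul hn)).sub (h2.smul hl)
  have hXd' : DifferentiableAt ℝ X x :=
    (hXd.contDiffAt (h.lc.isOpen.mem_nhds hx)).differentiableAt (by simp)
  have hXl : ∀ y ∈ U, B y (X y) (l y) = 0 := by
    intro y hy; simp [hX, h.n_l hy, h.l_l hy]
  have hXn : ∀ y ∈ U, B y (X y) (n y) = 0 := by
    intro y hy; simp [hX, h.l_n hy, h.n_n hy]
  refine ⟨X, hXx, hXd, hXl, hXn, fun e => ?_, fun e => ?_⟩
  · have h1 := h.lc.fderiv_metric hx hXd' (h.diff_l hx) e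
    rw [fderiv_eq_zero_of_mem h.lc.isOpen hx hXl, hXx, h.lc.symm x hx v] at h1
    simp at h1
    linarith
  · have h1 := h.lc.fderiv_metric hx hXd' (h.diff_n hx) e
    rw [fderiv_eq_zero_of_mem h.lc.isOpen hx hXn, hXx, h.lc.symm x hx v] at h1
    simp at h1
    linarith

lemma covTensor_antisymm (e a b c f : V) :
    covTensor Γ C x e a b c f = - covTensor Γ C x e b a c f :=
  (covTensor_curvatureLike h.lc.isOpen hx (h.diff_C hx) (fun _ hy => h.curvatureLike hy)
    e a b c f).1

lemma covTensor_pair (e a b c f : V) :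
    covTensor Γ C x e a b c f = covTensor Γ C x e c f a b :=
  (covTensor_curvatureLike h.lc.isOpen hx (h.diff_C hx) (fun _ hy => h.curvatureLike hy)
    e a b c f).2

lemma covTensor_traceless (e b f : V) (G : V →L[ℝ] V →L[ℝ] ℝ)
    (hG : ∀ u v, G u v = covTensor Γ C x e u b v f) : metricTrace (B x) G = 0 := by
  have hF : ∀ b f, DifferentiableAt ℝ (fun y => slot (C y) b f) x := by
    intro b f
    have : ContDiffOn ℝ ∞ (fun y => slot (C y) b f) U := by
      rw [contDiffOn_clm_apply]; intro u
      rw [contDiffOn_clm_apply]; intro v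
      simp only [slot_apply]
      exact (((h.smooth_C.clm_apply contDiffOn_const).clm_apply contDiffOn_const).clm_apply
        contDiffOn_const).clm_apply contDiffOn_const
    exact (this.contDiffAt (h.lc.isOpen.mem_nhds hx)).differentiableAt (by simp)
  have hd : ∀ b f u v, fderiv ℝ (fun y => slot (C y) b f) x e u v = fderiv ℝ C x e u b v f := by
    intro b f u v
    rw [← fderiv_tensor_const (h.diff_C hx)]
    have k := fun v : V => hasFDerivAt_const (𝕜 := ℝ) v x
    have t := ((hF b f).hasFDerivAt.clm_apply (k u)).clm_apply (k v)
    simp only [slot_apply] at t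
    rw [t.fderiv]; simp
  -- With `b` and `f` frozen, the covariant derivative of the slot lacks the corrections in these
  -- two arguments; they are themselves traces of `C`, hence zero.
  let G' : V →L[ℝ] V →L[ℝ] ℝ := G + slot (C x) (Γ x e b) f + slot (C x) b (Γ x e f)
  have key := h.lc.metricTrace_cov_eq_zero hx (hF b f) (fun y hy => h.traceless y hy b f) e G' (by
    intro u v
    simp only [G', hd, add_apply, slot_apply, hG, covTensor]
    ring)
  obtain ⟨m, hm⟩ := h.frame x hx
  have hs := h.lc.symm x hx
  have hd2 : 2 ≤ d := by have := h.dim_ge; omega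
  have t1 := h.traceless x hx (Γ x e b) f
  have t2 := h.traceless x hx b (Γ x e f)
  rw [hm.metricTrace_eq hs hd2 h.dim_eq] at key t1 t2 ⊢
  simp only [G', add_apply, Finset.sum_add_distrib] at key
  linarith

lemma covTensor_traceless_frame {m : Fin (d - 2) → V}
    (hm : IsNullFrame d (fun u v => B x u v) (l x) (n x) m) (e b f : V) :
    covTensor Γ C x e (l x) b (n x) f + covTensor Γ C x e (n x) b (l x) f
      + ∑ i, covTensor Γ C x e (m i) b (m i) f = 0 := by
  let G : V →L[ℝ] V →L[ℝ] ℝ := slot (fderiv ℝ C x e) b f - slot (C x) b f ∘L Γ x e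
    - slot (C x) (Γ x e b) f - ((slot (C x) b f).flip ∘L Γ x e).flip - slot (C x) b (Γ x e f)
  have hG : ∀ u v, G u v = covTensor Γ C x e u b v f := by
    intro u v; simp [G, covTensor]
  have := h.covTensor_traceless hx e b f G hG
  rw [hm.metricTrace_eq (h.lc.symm x hx) (by have := h.dim_ge; omega) h.dim_eq] at this
  simpa only [hG] using this

end IsTransverseOn

end Transverse


/-! ### Bianchi equations: `n` is geodesic and shear-free -/

section FirstOrder

set_option maxSynthPendingDepth 3
set_option linter.unusedSectionVars false

variable {V : Type*} [NormedAddCommGroup V] [NormedSpace ℝ V]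

lemma IsCurvatureLike.antisymm' {Q : V →L[ℝ] V →L[ℝ] V →L[ℝ] V →L[ℝ] ℝ} (q : IsCurvatureLike Q)
    (a b c d : V) : Q a b c d = - Q a b d c := by
  rw [q.pair, q.antisymm, q.pair]

lemma IsCurvatureLike.self_left {Q : V →L[ℝ] V →L[ℝ] V →L[ℝ] V →L[ℝ] ℝ} (q : IsCurvatureLike Q)
    (a c d : V) : Q a a c d = 0 := by
  linarith [q.antisymm a a c d]

lemma IsCurvatureLike.self_right {Q : V →L[ℝ] V →L[ℝ] V →L[ℝ] V →L[ℝ] ℝ}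
    (q : IsCurvatureLike Q) (a b c : V) : Q a b c c = 0 := by
  linarith [q.antisymm' a b c c]

namespace IsTransverseOn

variable [FiniteDimensional ℝ V] {d : ℕ} {U : Set V} {B : V → V →L[ℝ] V →L[ℝ] ℝ}
  {Γ : V → V →L[ℝ] V →L[ℝ] V} {C : V → V →L[ℝ] V →L[ℝ] V →L[ℝ] V →L[ℝ] ℝ} {l n : V → V} {ε μ : ℝ}
  {x : V}

variable (h : IsTransverseOn d U B Γ C l n ε μ) (hx : x ∈ U)
include h hx

/-- In a slot where `C` vanishes on vectors orthogonal to `l`, only the `n`-part matters. -/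
lemma shift_perp {v : V} {c : ℝ} (hv : B x v (l x) = - c) : B x (v + c • n x) (l x) = 0 := by
  simp [hv, h.n_l hx]

/-- Extended to fields orthogonal to `l`, the component vanishes identically. Differentiating an
argument lowers the boost weight by at most one, from one to zero, so the Leibniz corrections vanish
as well. -/
lemma covTensor_l_perp (e : V) {X Y Z : V} (hX : B x X (l x) = 0) (hY : B x Y (l x) = 0)
    (hZ : B x Z (l x) = 0) : covTensor Γ C x e (l x) X Y Z = 0 := by
  obtain ⟨X', rfl, dX, pX, cX⟩ := h.exists_perp_extension hx hX
  obtain ⟨Y', rfl, dY, pY, cY⟩ := h.exists_perp_extension hx hY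
  obtain ⟨Z', rfl, dZ, pZ, cZ⟩ := h.exists_perp_extension hx hZ
  have q := h.curvatureLike hx
  have hn := h.neg x hx
  have t := fderiv_tensor (Γ := Γ) (h.diff_C hx) (h.diff_l hx) dX dY dZ e
  rw [fderiv_eq_zero_of_mem h.lc.isOpen hx
    (fun y hy => (h.neg y hy).left_perp _ _ _ (pX y hy) (pY y hy))] at t
  rw [hn.perp _ _ _ _ (h.cov_l_l hx e) hX hY hZ, hn.right_perp _ _ _ hY hZ,
    q.antisymm' _ _ (cov Γ Y' x e), hn.left_perp _ _ _ hX hZ, hn.left_perp _ _ _ hX hY] at t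
  simpa using t.symm

/-- Here the weight can fall from zero to `-1`: the derivative of a field `X` orthogonal to `l` has
`n`-part `-(∇_e l · X) n`, and exactly these parts survive. -/
lemma covTensor_perp (e : V) {X Y Z W : V} (hX : B x X (l x) = 0) (hY : B x Y (l x) = 0)
    (hZ : B x Z (l x) = 0) (hW : B x W (l x) = 0) :
    covTensor Γ C x e X Y Z W =
      B x (cov Γ l x e) X * C x (n x) Y Z W - B x (cov Γ l x e) Y * C x (n x) X Z W
      + B x (cov Γ l x e) Z * C x (n x) W X Y - B x (cov Γ l x e) W * C x (n x) Z X Y := by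
  obtain ⟨X', rfl, dX, pX, cX⟩ := h.exists_perp_extension hx hX
  obtain ⟨Y', rfl, dY, pY, cY⟩ := h.exists_perp_extension hx hY
  obtain ⟨Z', rfl, dZ, pZ, cZ⟩ := h.exists_perp_extension hx hZ
  obtain ⟨W', rfl, dW, pW, cW⟩ := h.exists_perp_extension hx hW
  have q := h.curvatureLike hx
  have hn := h.neg x hx
  have t := fderiv_tensor (Γ := Γ) (h.diff_C hx) dX dY dZ dW e
  rw [fderiv_eq_zero_of_mem h.lc.isOpen hx
    (fun y hy => (h.neg y hy).perp _ _ _ _ (pX y hy) (pY y hy) (pZ y hy) (pW y hy))] at t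
  have s1 := hn.perp _ _ _ _ (h.shift_perp hx (cX e)) hY hZ hW
  have s2 := hn.perp _ _ _ _ hX (h.shift_perp hx (cY e)) hZ hW
  have s3 := hn.perp _ _ _ _ hX hY (h.shift_perp hx (cZ e)) hW
  have s4 := hn.perp _ _ _ _ hX hY hZ (h.shift_perp hx (cW e))
  simp only [map_add, map_smul, add_apply, smul_apply, smul_eq_mul, zero_apply] at s1 s2 s3 s4 t
  rw [q.antisymm (X' x) (n x)] at s2
  rw [q.pair _ _ (n x)] at s3
  rw [q.antisymm' _ _ (Z' x) (n x), q.pair _ _ (n x)] at s4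
  linarith

lemma covTensor_n_l (e : V) {X Z : V} (hX : B x X (l x) = 0) (hZ : B x Z (l x) = 0) :
    covTensor Γ C x e (n x) X (l x) Z =
      B x (cov Γ l x e) Z * C x (n x) X (l x) (n x) - C x (n x) X (cov Γ l x e) Z := by
  obtain ⟨X', rfl, dX, pX, cX⟩ := h.exists_perp_extension hx hX
  obtain ⟨Z', rfl, dZ, pZ, cZ⟩ := h.exists_perp_extension hx hZ
  have q := h.curvatureLike hx
  have hn := h.neg x hx
  have nlz : ∀ y ∈ U, ∀ X Z W, B y X (l y) = 0 → B y Z (l y) = 0 → C y W X (l y) Z = 0 := by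
    intro y hy X Z W hX hZ
    have q := h.curvatureLike hy
    rw [q.pair, q.antisymm', (h.neg y hy).left_perp _ _ _ hZ hX, neg_zero]
  have t := fderiv_tensor (Γ := Γ) (h.diff_C hx) (h.diff_n hx) dX (h.diff_l hx) dZ e
  rw [fderiv_eq_zero_of_mem h.lc.isOpen hx
    (fun y hy => nlz y hy _ _ (n y) (pX y hy) (pZ y hy))] at t
  rw [nlz x hx _ _ _ hX hZ] at t
  have s1 := nlz x hx _ _ (n x) (h.shift_perp hx (cX e)) hZ
  have s2 := nlz x hx _ _ (n x) hX (h.shift_perp hx (cZ e))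
  simp only [map_add, map_smul, add_apply, smul_apply, smul_eq_mul, zero_apply, q.self_left]
    at s1 s2 t
  linarith

/-- The vector field `n` is geodesic. -/
lemma geodesic {m : Fin (d - 2) → V} (hm : IsNullFrame d (fun u v => B x u v) (l x) (n x) m)
    (i : Fin (d - 2)) : B x (cov Γ n x (n x)) (m i) = 0 := by
  have hs := h.lc.symm x hx
  have hd := h.dim_ge
  set F := frameVec (l x) (n x) m with hF
  set Y := cottonNull B Γ n ε x with hY
  set K := covTensor Γ C x with hK
  have hYa : ∀ a b c, Y a b c = - Y b a c := by
    intro a b c; simp only [hY, cottonNull]; ring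
  have hKa : ∀ e a b c f, K e a b c f = - K e b a c f := h.covTensor_antisymm hx
  have hKp : ∀ e a b c f, K e a b c f = K e c f a b := h.covTensor_pair hx
  have hKa' : ∀ e a b c f, K e a b c f = - K e a b f c := by
    intro e a b c f; rw [hKp, hKa, hKp]
  have tr : ∀ e b f, ∑ A, K e (F A) b (F (dualIndex A)) f = 0 := by
    intro e b f
    have := h.covTensor_traceless_frame hx hm e b f
    simpa [frameVec, dualIndex, hF] using this
  have g : ∀ A A', B x (F A) (F (dualIndex A')) = if A = A' then 1 else 0 := hm.apply_dual hs
  set E : Fin 2 ⊕ Fin (d - 2) := Sum.inr i with hE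
  -- The Bianchi identity is contracted twice, over the dual pairs `A` and `A'`. Trace-freeness
  -- kills the left side, and the right side is a nonzero multiple of the contracted Cotton term
  -- `S`.
  have bi := fun A A' => h.lc.bianchi_weyl hx (h.diff_C hx) (h.diff_n hx) h.decomp (F E) (F A)
    (F A') (F (dualIndex A)) (F (dualIndex A'))
  have hsum := Finset.sum_congr (rfl : (Finset.univ : Finset (Fin 2 ⊕ Fin (d - 2))) = Finset.univ)
    (fun A _ => Finset.sum_congr (rfl : (Finset.univ : Finset (Fin 2 ⊕ Fin (d - 2))) = Finset.univ)
      (fun A' _ => bi A A'))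
  have hlhs : ∑ A, ∑ A', (K (F E) (F A) (F A') (F (dualIndex A)) (F (dualIndex A')) +
      K (F A) (F A') (F E) (F (dualIndex A)) (F (dualIndex A')) +
      K (F A') (F E) (F A) (F (dualIndex A)) (F (dualIndex A'))) = 0 := by
    simp only [Finset.sum_add_distrib]
    have z1 : ∑ A, ∑ A', K (F E) (F A) (F A') (F (dualIndex A)) (F (dualIndex A')) = 0 := by
      rw [Finset.sum_comm]; exact Finset.sum_eq_zero (fun A' _ => tr _ _ _)
    have z2 : ∑ A, ∑ A', K (F A) (F A') (F E) (F (dualIndex A)) (F (dualIndex A')) = 0 := by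
      refine Finset.sum_eq_zero (fun A _ => ?_)
      simp only [hKa' (F A) _ (F E) (F (dualIndex A))]
      rw [Finset.sum_neg_distrib, tr, neg_zero]
    have z3 : ∑ A, ∑ A', K (F A') (F E) (F A) (F (dualIndex A)) (F (dualIndex A')) = 0 := by
      rw [Finset.sum_comm]
      refine Finset.sum_eq_zero (fun A' _ => ?_)
      simp only [hKa (F A') (F E)]
      rw [Finset.sum_neg_distrib, tr, neg_zero]
    rw [z1, z2, z3]; simp
  have hsum' := hlhs.symm.trans hsum
  rw [← hY] at hsum'
  set S := ∑ A, Y (F A) (F E) (F (dualIndex A)) with hS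
  have hS' : ∑ A, Y (F E) (F A) (F (dualIndex A)) = - S := by
    rw [hS, ← Finset.sum_neg_distrib]; exact Finset.sum_congr rfl (fun A _ => hYa _ _ _)
  have hcard : (Fintype.card (Fin 2 ⊕ Fin (d - 2)) : ℝ) = d := by
    have : Fintype.card (Fin 2 ⊕ Fin (d - 2)) = d := by simp; omega
    rw [this]
  have hdR : (4 : ℝ) ≤ d := by exact_mod_cast hd
  simp only [← Finset.mul_sum, g, Finset.sum_add_distrib, Finset.sum_sub_distrib] at hsum'
  simp only [if_true, one_mul, ite_mul, zero_mul, Finset.sum_ite_eq, Finset.sum_ite_eq',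
    Finset.mem_univ, hS', ← hS, Finset.sum_const, Finset.card_univ, nsmul_eq_mul, hcard] at hsum'
  rw [← Finset.mul_sum, hS'] at hsum'
  have hS0 : S = 0 := by
    have h2 : (d : ℝ) - 2 ≠ 0 := by linarith
    field_simp at hsum'
    have : (2 * (d : ℝ) - 4) * S = 0 := by linear_combination - hsum'
    exact (mul_eq_zero.1 this).resolve_left (by linarith)
  -- Only the divergence of `ε n ⊗ n` along `m_i` is left, and this is the acceleration of `n`.
  have : S = ε * B x (cov Γ n x (n x)) (m i) := by
    have b2 := hm.n_n; have b3 := hm.n_m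
    simp [hS, hY, hF, hE, frameVec, dualIndex, cottonNull, h.cov_n_n hx, h.n_l hx, b2, b3]
  rw [this] at hS0
  exact (mul_eq_zero.1 hS0).resolve_left h.eps_ne

lemma frame_expand {m : Fin (d - 2) → V}
    (hm : IsNullFrame d (fun u v => B x u v) (l x) (n x) m) (v : V) :
    v = B x v (n x) • l x + B x v (l x) • n x + ∑ i, B x v (m i) • m i :=
  hm.expand (h.lc.symm x hx) (by have := h.dim_ge; omega) h.dim_eq v

lemma frame_perp {m : Fin (d - 2) → V}
    (hm : IsNullFrame d (fun u v => B x u v) (l x) (n x) m) (i : Fin (d - 2)) :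
    B x (m i) (l x) = 0 ∧ B x (m i) (n x) = 0 :=
  ⟨by rw [h.lc.symm x hx]; exact hm.l_m i, by rw [h.lc.symm x hx]; exact hm.n_m i⟩

lemma covTensor_l_l (e : V) {X : V} (hX : B x X (l x) = 0) :
    covTensor Γ C x e (l x) X (l x) (n x) = 0 := by
  obtain ⟨X', rfl, dX, pX, cX⟩ := h.exists_perp_extension hx hX
  have q := h.curvatureLike hx
  have hn := h.neg x hx
  have t := fderiv_tensor (Γ := Γ) (h.diff_C hx) (h.diff_l hx) dX (h.diff_l hx) (h.diff_n hx) e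
  rw [fderiv_eq_zero_of_mem h.lc.isOpen hx (fun y hy => (h.neg y hy).left_left _ _)] at t
  rw [q.pair (cov Γ l x e), hn.right_perp _ _ _ (h.cov_l_l hx e) hX, hn.left_left,
    hn.left_perp _ _ _ hX (h.cov_l_l hx e), hn.left_left] at t
  simpa using t.symm

/-- Trace-freeness in the slots `(n, X)`: of the two null terms of the trace one vanishes by
antisymmetry. -/
lemma psi_eq_trace {m : Fin (d - 2) → V}
    (hm : IsNullFrame d (fun u v => B x u v) (l x) (n x) m) (X : V) :
    C x (l x) (n x) (n x) X = ∑ j, C x (n x) (m j) (m j) X := by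
  have q := h.curvatureLike hx
  have t := h.traceless x hx (n x) X
  rw [hm.metricTrace_eq (h.lc.symm x hx) (by have := h.dim_ge; omega) h.dim_eq] at t
  simp only [slot_apply, q.self_left, fun j => q.antisymm (m j) (n x), Finset.sum_neg_distrib] at t
  linarith

/-- In the Bianchi component `(l, m_i, m_j; l, m_i)` with `i ≠ j` all derivatives of `C` vanish,
which leaves the Cotton component `(m_j, l, l)`. An index `i ≠ j` exists because `d ≥ 4`. -/
lemma cov_n_l_screen {m : Fin (d - 2) → V}
    (hm : IsNullFrame d (fun u v => B x u v) (l x) (n x) m) (j : Fin (d - 2)) :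
    B x (cov Γ n x (l x)) (m j) = 2 * B x (cov Γ n x (m j)) (l x) := by
  have hd := h.dim_ge
  have hdR : (4 : ℝ) ≤ d := by exact_mod_cast hd
  obtain ⟨i, hij⟩ : ∃ i : Fin (d - 2), i ≠ j := by
    have : Nontrivial (Fin (d - 2)) := Fin.nontrivial_iff_two_le.2 (by omega)
    exact exists_ne j
  have bi := h.lc.bianchi_weyl hx (h.diff_C hx) (h.diff_n hx) h.decomp (l x) (m i) (m j) (l x) (m i)
  have pi := (h.frame_perp hx hm i).1
  have pj := (h.frame_perp hx hm j).1
  have b1 : B x (m j) (m i) = 0 := by rw [hm.m_m j i, if_neg hij.symm]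
  have b2 : B x (m i) (m i) = 1 := by rw [hm.m_m i i, if_pos rfl]
  rw [h.covTensor_pair hx (l x), h.covTensor_l_perp hx _ pi pi pj, h.covTensor_antisymm hx (m i),
    h.covTensor_l_perp hx _ pj (h.l_l hx) pi, h.covTensor_l_perp hx _ pi (h.l_l hx) pi,
    pi, pj, b1, b2, h.l_l hx, hm.l_m i] at bi
  simp only [cottonNull, hm.n_m, h.n_l hx] at bi
  have h2 : (d : ℝ) - 2 ≠ 0 := by linarith
  field_simp at bi
  have h3 := h.eps_ne
  have : ε * (B x (cov Γ n x (l x)) (m j) - 2 * B x (cov Γ n x (m j)) (l x)) = 0 := by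
    linarith
  linarith [(mul_eq_zero.1 this).resolve_left h3]

/-- The Bianchi equations of boost weight one, with `κ = ∇_l l`. -/
lemma bianchi_weight_one {m : Fin (d - 2) → V}
    (hm : IsNullFrame d (fun u v => B x u v) (l x) (n x) m) (i j : Fin (d - 2)) :
    ((d : ℝ) - 2) * (B x (cov Γ l x (l x)) (m j) * C x (l x) (n x) (n x) (m i)
      - ∑ k, B x (cov Γ l x (l x)) (m k) * C x (n x) (m i) (m k) (m j)) =
    ε * (B x (cov Γ n x (m i)) (m j)
      + if i = j then 2 * B x (cov Γ n x (n x)) (l x) else 0) := by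
  have hd := h.dim_ge
  have hdR : (4 : ℝ) ≤ d := by exact_mod_cast hd
  have q := h.curvatureLike hx
  have hneg := h.neg x hx
  have bi := h.lc.bianchi_weyl hx (h.diff_C hx) (h.diff_n hx) h.decomp (l x) (n x) (m i) (l x) (m j)
  have pi := h.frame_perp hx hm i
  have pj := h.frame_perp hx hm j
  have hk : C x (n x) (m i) (cov Γ l x (l x)) (m j) =
      ∑ k, B x (cov Γ l x (l x)) (m k) * C x (n x) (m i) (m k) (m j) := by
    conv_lhs => rw [h.frame_expand hx hm (cov Γ l x (l x))]
    have z : C x (n x) (m i) (l x) (m j) = 0 := by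
      rw [q.pair, q.antisymm', hneg.left_perp _ _ _ pj.1 pi.1, neg_zero]
    simp [h.cov_l_l hx, z]
  rw [h.covTensor_n_l hx _ pi.1 pj.1, h.covTensor_antisymm hx (n x) (m i),
    h.covTensor_l_perp hx _ pi.1 (h.l_l hx) pj.1, h.covTensor_pair hx (m i),
    h.covTensor_l_l hx _ pj.1, hk, q.pair (n x) (m i) (l x), pi.1, h.n_l hx, h.l_l hx, hm.n_m j,
    hm.l_m j, hm.m_m i j] at bi
  simp only [cottonNull, hm.n_m, h.n_l hx, h.n_n hx, h.cov_n_n hx] at bi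
  have h2 : (d : ℝ) - 2 ≠ 0 := by linarith
  field_simp at bi
  split_ifs at bi ⊢ <;> linarith

/-- The Bianchi component `(l, m_i, m_j; m_k, m_r)`. Of its three derivatives of `C`, those along
the screen vanish by `covTensor_l_perp`, and the one along `l` brings in `κ = ∇_l l`. -/
lemma bianchi_weight_one' {m : Fin (d - 2) → V}
    (hm : IsNullFrame d (fun u v => B x u v) (l x) (n x) m) (i j k r : Fin (d - 2)) :
    ((d : ℝ) - 2) * (B x (cov Γ l x (l x)) (m i) * C x (n x) (m j) (m k) (m r)
      - B x (cov Γ l x (l x)) (m j) * C x (n x) (m i) (m k) (m r)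
      + B x (cov Γ l x (l x)) (m k) * C x (n x) (m r) (m i) (m j)
      - B x (cov Γ l x (l x)) (m r) * C x (n x) (m k) (m i) (m j)) =
    ε * ((if i = k then B x (cov Γ n x (m j)) (m r) else 0)
      - (if i = r then B x (cov Γ n x (m j)) (m k) else 0)
      - (if j = k then B x (cov Γ n x (m i)) (m r) else 0)
      + (if j = r then B x (cov Γ n x (m i)) (m k) else 0)) := by
  have hd := h.dim_ge
  have hdR : (4 : ℝ) ≤ d := by exact_mod_cast hd
  have bi := h.lc.bianchi_weyl hx (h.diff_C hx) (h.diff_n hx) h.decomp (l x) (m i) (m j) (m k) (m r)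
  have p := fun i => (h.frame_perp hx hm i).1
  rw [h.covTensor_perp hx _ (p i) (p j) (p k) (p r), h.covTensor_antisymm hx (m i),
    h.covTensor_l_perp hx _ (p j) (p k) (p r), h.covTensor_l_perp hx _ (p i) (p k) (p r),
    hm.l_m, hm.l_m, hm.m_m, hm.m_m, hm.m_m, hm.m_m] at bi
  simp only [cottonNull, hm.n_m, h.n_l hx] at bi
  have h2 : (d : ℝ) - 2 ≠ 0 := by linarith
  field_simp at bi
  simp only [ite_mul, one_mul, zero_mul] at bi
  split_ifs at bi ⊢ <;> linarith

/-- The vector field `n` is shear-free, and twist-free in dimension at least five. -/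
lemma shear_free_frame {m : Fin (d - 2) → V}
    (hm : IsNullFrame d (fun u v => B x u v) (l x) (n x) m) (i k : Fin (d - 2)) :
    ((d : ℝ) - 3) * B x (cov Γ n x (m i)) (m k) + B x (cov Γ n x (m k)) (m i) =
      if i = k then - 2 * B x (cov Γ n x (n x)) (l x) else 0 := by
  have hd := h.dim_ge
  have : Nonempty (Fin (d - 2)) := ⟨⟨0, by omega⟩⟩
  have q := h.curvatureLike hx
  have key := trace_elimination (ι := Fin (d - 2)) (D := (d : ℝ) - 2) (by
      rw [Fintype.card_fin, Nat.cast_sub (by omega)]; norm_num) h.eps_ne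
    (κ := fun i => B x (cov Γ l x (l x)) (m i)) (ψ := fun i => C x (l x) (n x) (n x) (m i))
    (Ψ := fun i j k => C x (n x) (m i) (m j) (m k)) (N := fun i j => B x (cov Γ n x (m i)) (m j))
    (fun i j k => q.antisymm' _ _ _ _) (fun i => h.psi_eq_trace hx hm (m i))
    (h.bianchi_weight_one hx hm) (h.bianchi_weight_one' hx hm)
  have := key.2 i k
  rw [key.1] at this
  rw [← this]; ring

end IsTransverseOn

end FirstOrder


/-! ### Ricci identities: the remaining Weyl components, and the case `d ≥ 5` -/

section SecondOrder

set_option maxSynthPendingDepth 3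
set_option linter.unusedSectionVars false

variable {V : Type*} [NormedAddCommGroup V] [NormedSpace ℝ V]

/-- The components `Q(n, m_i, m_j, m_k)` control all components of boost weight `-1`. -/
lemma HasNegBoost.weight_neg_one_eq_zero [FiniteDimensional ℝ V] {d : ℕ} {b : V →L[ℝ] V →L[ℝ] ℝ} {Q : V →L[ℝ] V →L[ℝ] V →L[ℝ] V →L[ℝ] ℝ}
    {l n : V} {m : Fin (d - 2) → V} (hn : HasNegBoost b Q l) (q : IsCurvatureLike Q)
    (hs : ∀ u v, b u v = b v u) (hd : 2 ≤ d) (hdim : Module.finrank ℝ V = d)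
    (ht : ∀ u v, metricTrace b (slot Q u v) = 0)
    (hm : IsNullFrame d (fun u v => b u v) l n m) (h1 : ∀ i j k, Q n (m i) (m j) (m k) = 0) :
    (∀ X Y Z, b X l = 0 → b Y l = 0 → b Z l = 0 → Q n X Y Z = 0) ∧
      ∀ X, b X l = 0 → Q l n n X = 0 := by
  have ex : ∀ X, b X l = 0 → X = b X n • l + ∑ i, b X (m i) • m i := by
    intro X hX
    conv_lhs => rw [hm.expand hs hd hdim X, hX]
    simp
  have p : ∀ i, b (m i) l = 0 := fun i => by rw [hs]; exact hm.l_m i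
  have P1 : ∀ X Y Z, b X l = 0 → b Y l = 0 → b Z l = 0 →
      Q n X Y Z = 0 := by
    intro X Y Z hX hY hZ
    have a1 : ∀ Y Z, b Y l = 0 → b Z l = 0 → Q n l Y Z = 0 := by
      intro Y Z hY hZ
      rw [q.antisymm, hn.right_perp _ _ _ hY hZ, neg_zero]
    have a2 : ∀ X Z, b X l = 0 → b Z l = 0 → Q n X l Z = 0 := by
      intro X Z hX hZ
      rw [q.pair, q.antisymm', hn.left_perp _ _ _ hZ hX, neg_zero]
    have a3 : ∀ X Z, b X l = 0 → b Z l = 0 → Q n X Z l = 0 := by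
      intro X Z hX hZ
      rw [q.antisymm', a2 X Z hX hZ, neg_zero]
    have s1 : ∀ i j, Q n (m i) (m j) Z = 0 := by
      intro i j
      rw [ex Z hZ]; simp [a3 _ _ (p i) (p j), h1]
    have s2 : ∀ i, Q n (m i) Y Z = 0 := by
      intro i
      rw [ex Y hY]; simp [a2 _ _ (p i) hZ, s1]
    rw [ex X hX]; simp [a1 _ _ hY hZ, s2]
  have ψ0 : ∀ X, b X l = 0 → Q l n n X = 0 := by
    intro X hX
    have t := ht n X
    rw [hm.metricTrace_eq hs hd hdim] at t
    have t' : ∑ j, Q n (m j) (m j) X = 0 :=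
      Finset.sum_eq_zero (fun j _ => P1 _ _ _ (p j) (p j) hX)
    simp only [slot_apply, q.self_left, fun j => q.antisymm (m j) n, Finset.sum_neg_distrib, t'] at t
    linarith
  exact ⟨P1, ψ0⟩

/-- A trace-free tensor of negative boost order vanishes if its frame components
`Q(n, m_i, m_j, m_k)` and `Q(n, m_i, n, m_j)` do. -/
lemma HasNegBoost.eq_zero [FiniteDimensional ℝ V] {d : ℕ} {b : V →L[ℝ] V →L[ℝ] ℝ} {Q : V →L[ℝ] V →L[ℝ] V →L[ℝ] V →L[ℝ] ℝ}
    {l n : V} {m : Fin (d - 2) → V} (hn : HasNegBoost b Q l) (q : IsCurvatureLike Q)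
    (hs : ∀ u v, b u v = b v u) (hd : 2 ≤ d) (hdim : Module.finrank ℝ V = d)
    (ht : ∀ u v, metricTrace b (slot Q u v) = 0)
    (hm : IsNullFrame d (fun u v => b u v) l n m) (h1 : ∀ i j k, Q n (m i) (m j) (m k) = 0)
    (h2 : ∀ i j, Q n (m i) n (m j) = 0) : Q = 0 := by
  obtain ⟨P1, ψ0⟩ := hn.weight_neg_one_eq_zero q hs hd hdim ht hm h1
  have ex : ∀ X, b X l = 0 → X = b X n • l + ∑ i, b X (m i) • m i := by
    intro X hX
    conv_lhs => rw [hm.expand hs hd hdim X, hX]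
    simp
  have p : ∀ i, b (m i) l = 0 := fun i => by rw [hs]; exact hm.l_m i
  have hl := hm.l_l
  have hnl : b n l = 1 := by rw [hs]; exact hm.l_n
  have P2 : ∀ X Y, b X l = 0 → b Y l = 0 → Q n X n Y = 0 := by
    intro X Y hX hY
    have a1 : ∀ Y, b Y l = 0 → Q n l n Y = 0 := by
      intro Y hY; rw [q.antisymm, ψ0 Y hY, neg_zero]
    have a2 : ∀ Y, b Y l = 0 → Q n Y n l = 0 := by
      intro Y hY; rw [q.pair, a1 Y hY]
    have s1 : ∀ i, Q n (m i) n Y = 0 := by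
      intro i
      rw [ex Y hY]; simp [a2 _ (p i), h2]
    rw [ex X hX]; simp [a1 _ hY, s1]
  -- Splitting each argument into a part orthogonal to `l` and a multiple of `n` reduces everything
  -- to weights `0`, `-1` and `-2`.
  have dec : ∀ v, ∃ (w : V) (c : ℝ), b w l = 0 ∧ v = w + c • n := by
    intro v
    exact ⟨v - b v l • n, b v l, by simp [hnl], by simp⟩
  ext a a' c e
  obtain ⟨a, ca, ha, rfl⟩ := dec a
  obtain ⟨a', cb, hb, rfl⟩ := dec a'
  obtain ⟨c, cc, hc, rfl⟩ := dec c
  obtain ⟨e, ce, he, rfl⟩ := dec e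
  have b1 : Q a n c e = 0 := by rw [q.antisymm, P1 _ _ _ ha hc he, neg_zero]
  have b2 : Q a a' n e = 0 := by rw [q.pair, P1 _ _ _ he ha hb]
  have b3 : Q a a' c n = 0 := by rw [q.antisymm', q.pair, P1 _ _ _ hc ha hb, neg_zero]
  have b4 : Q a n n e = 0 := by rw [q.antisymm, P2 _ _ ha he, neg_zero]
  have b5 : Q a n c n = 0 := by rw [q.antisymm, q.antisymm', P2 _ _ ha hc]; simp
  have b6 : Q n a' c n = 0 := by rw [q.antisymm', P2 _ _ hb hc, neg_zero]
  simp [hn.perp _ _ _ _ ha hb hc he, P1 _ _ _ hb hc he, P2 _ _ hb he, b1, b2, b3, b4, b5, b6,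
    q.self_left, q.self_right]

/-- The covariant derivative at `x` as a linear map of the direction. -/
def covMap (Γ : V → V →L[ℝ] V →L[ℝ] V) (Y : V → V) (x : V) : V →L[ℝ] V :=
  fderiv ℝ Y x + (Γ x).flip (Y x)

@[simp] lemma covMap_apply (Γ : V → V →L[ℝ] V →L[ℝ] V) (Y : V → V) (x e : V) :
    covMap Γ Y x e = cov Γ Y x e := by
  simp [covMap, cov]

lemma IsLeviCivitaOn.diff_cov {U : Set V} {B : V → V →L[ℝ] V →L[ℝ] ℝ}
    {Γ : V → V →L[ℝ] V →L[ℝ] V} {x : V} (h : IsLeviCivitaOn U B Γ) (hx : x ∈ U) {Z Y : V → V}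
    (hZ : ContDiffAt ℝ ∞ Z x) (hY : DifferentiableAt ℝ Y x) :
    DifferentiableAt ℝ (fun y => cov Γ Z y (Y y)) x := by
  have h1 : DifferentiableAt ℝ (fderiv ℝ Z) x :=
    (hZ.fderiv_right (m := ∞) (by simp)).differentiableAt (by simp)
  have h2 := h.diff_conn hx
  have h3 : DifferentiableAt ℝ Z x := hZ.differentiableAt (by simp)
  unfold cov
  fun_prop

/-- The Ricci identity for the components of the covariant derivative of `Z`. -/
lemma IsLeviCivitaOn.ricci_scalar {U : Set V} {B : V → V →L[ℝ] V →L[ℝ] ℝ}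
    {Γ : V → V →L[ℝ] V →L[ℝ] V} {x : V} (h : IsLeviCivitaOn U B Γ) (hx : x ∈ U)
    {Z X Y W : V → V} (hZ : ContDiffAt ℝ ∞ Z x) (hX : DifferentiableAt ℝ X x)
    (hY : DifferentiableAt ℝ Y x) (hW : DifferentiableAt ℝ W x) :
    fderiv ℝ (fun y => B y (cov Γ Z y (Y y)) (W y)) x (X x)
      - B x (cov Γ Z x (Y x)) (cov Γ W x (X x))
      - (fderiv ℝ (fun y => B y (cov Γ Z y (X y)) (W y)) x (Y x)
        - B x (cov Γ Z x (X x)) (cov Γ W x (Y x)))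
      - (B x (cov Γ Z x (cov Γ Y x (X x))) (W x) - B x (cov Γ Z x (cov Γ X x (Y x))) (W x))
      = B x (W x) (curv Γ x (X x) (Y x) (Z x)) := by
  rw [← h.ricci_identity hx hZ hX hY, h.fderiv_metric hx (h.diff_cov hx hZ hY) hW,
    h.fderiv_metric hx (h.diff_cov hx hZ hX) hW, h.symm x hx (W x), cov_sub_right]
  simp only [map_sub, sub_apply]
  ring

namespace IsTransverseOn

variable [FiniteDimensional ℝ V] {d : ℕ} {U : Set V} {B : V → V →L[ℝ] V →L[ℝ] ℝ}
  {Γ : V → V →L[ℝ] V →L[ℝ] V} {C : V → V →L[ℝ] V →L[ℝ] V →L[ℝ] V →L[ℝ] ℝ} {l n : V → V} {ε μ : ℝ}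
  {x : V}

variable (h : IsTransverseOn d U B Γ C l n ε μ)
include h

/-- The function is the expansion `θ` of `n`: by `shear_free_frame` the screen trace of `∇n` equals
`-2 (∇_n n · l)`. This form of `θ` needs no choice of screen vectors. -/
lemma smooth_expansion :
    ContDiffOn ℝ ∞ (fun y => - 2 * B y (cov Γ n y (n y)) (l y)) U := by
  have h1 : ContDiffOn ℝ ∞ (fderiv ℝ n) U :=
    h.smooth_n.fderiv_of_isOpen h.lc.isOpen (by simp)
  have h2 : ContDiffOn ℝ ∞ (fun y => cov Γ n y (n y)) U :=
    (h1.clm_apply h.smooth_n).add ((h.lc.smooth_conn.clm_apply h.smooth_n).clm_apply h.smooth_n)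
  exact contDiffOn_const.mul ((h.lc.smooth_metric.clm_apply h2).clm_apply h.smooth_l)

variable (hx : x ∈ U)
include hx

lemma diff_expansion : DifferentiableAt ℝ (fun y => - 2 * B y (cov Γ n y (n y)) (l y)) x :=
  (h.smooth_expansion.contDiffAt (h.lc.isOpen.mem_nhds hx)).differentiableAt (by simp)

/-- Linear forms that agree on the frame vectors `m i` and on `n` agree on `n^⊥`. -/
lemma linear_ext {m : Fin (d - 2) → V}
    (hm : IsNullFrame d (fun u v => B x u v) (l x) (n x) m) {f g : V →L[ℝ] ℝ}
    (hn : f (n x) = g (n x)) (hfg : ∀ i, f (m i) = g (m i)) {X : V} (hX : B x X (n x) = 0) :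
    f X = g X := by
  rw [h.frame_expand hx hm X, hX]
  simp [hn, hfg]

lemma cov_n_along_n {X : V} (hX : B x X (n x) = 0) : B x (cov Γ n x (n x)) X = 0 := by
  obtain ⟨m, hm⟩ := h.frame x hx
  exact h.linear_ext hx hm (g := 0) (f := B x (cov Γ n x (n x))) (by simp [h.cov_n_n hx])
    (fun i => by simp [h.geodesic hx hm i]) hX

lemma cov_n_along_l {X : V} (hX : B x X (n x) = 0) (hX' : B x X (l x) = 0) :
    B x (cov Γ n x (l x)) X = 2 * B x (cov Γ n x X) (l x) := by
  obtain ⟨m, hm⟩ := h.frame x hx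
  conv_lhs => rw [h.frame_expand hx hm X, hX, hX']
  conv_rhs => rw [h.frame_expand hx hm X, hX, hX', ← covMap_apply]
  simp [h.cov_n_l_screen hx hm, Finset.mul_sum]
  exact Finset.sum_congr rfl (fun i _ => by ring)

/-- Linear combinations of `∇n` and its transpose are determined on `n^⊥` by the frame. -/
lemma cov_n_bilinear {m : Fin (d - 2) → V}
    (hm : IsNullFrame d (fun u v => B x u v) (l x) (n x) m) (a b c : ℝ)
    (hab : ∀ i k, a * B x (cov Γ n x (m i)) (m k) + b * B x (cov Γ n x (m k)) (m i) =
      c * B x (m i) (m k)) {X Y : V} (hX : B x X (n x) = 0) (hY : B x Y (n x) = 0) :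
    a * B x (cov Γ n x X) Y + b * B x (cov Γ n x Y) X = c * B x X Y := by
  have hs := h.lc.symm x hx
  have hn0 : ∀ {Z : V}, B x Z (n x) = 0 → B x (cov Γ n x (n x)) Z = 0 := h.cov_n_along_n hx
  have step : ∀ i, a * B x (cov Γ n x (m i)) Y + b * B x (cov Γ n x Y) (m i) =
      c * B x (m i) Y := by
    intro i
    exact h.linear_ext hx hm
      (f := a • B x (cov Γ n x (m i)) + b • ((B x).flip (m i) ∘L covMap Γ n x))
      (g := c • B x (m i))
      (by simp [h.cov_n_n hx, hn0 (h.frame_perp hx hm i).2, (h.frame_perp hx hm i).2])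
      (fun k => by simpa using hab i k) hY
  exact h.linear_ext hx hm
    (f := a • ((B x).flip Y ∘L covMap Γ n x) + b • B x (cov Γ n x Y))
    (g := c • (B x).flip Y)
    (by simp [h.cov_n_n hx, hn0 hY, hs (n x) Y, hY])
    (fun k => by simpa using step k) hX

/-- Adding `shear_free_frame` to its transpose leaves `d - 2` times the symmetric part of `∇n`,
valid also when `d = 4` and a twist is present. -/
lemma shear_free {X Y : V} (hX : B x X (n x) = 0) (hY : B x Y (n x) = 0) :
    B x (cov Γ n x X) Y + B x (cov Γ n x Y) X =
      2 * (- 2 * B x (cov Γ n x (n x)) (l x)) / ((d : ℝ) - 2) * B x X Y := by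
  obtain ⟨m, hm⟩ := h.frame x hx
  have hdR : (4 : ℝ) ≤ d := by exact_mod_cast h.dim_ge
  have h2 : (d : ℝ) - 2 ≠ 0 := by linarith
  have := h.cov_n_bilinear hx hm 1 1
    (2 * (- 2 * B x (cov Γ n x (n x)) (l x)) / ((d : ℝ) - 2)) (fun i k => by
      have e1 := h.shear_free_frame hx hm i k
      have e2 := h.shear_free_frame hx hm k i
      rw [hm.m_m i k]
      by_cases hik : i = k
      · subst hik
        rw [if_pos rfl] at e1 e2 ⊢
        field_simp
        linarith
      · rw [if_neg hik] at e1 ⊢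
        rw [if_neg (Ne.symm hik)] at e2
        apply mul_left_cancel₀ h2
        linarith) hX hY
  simpa using this

/-- Off the diagonal `shear_free_frame` and its transpose form a linear system with determinant `(d
- 3)² - 1 = (d - 2)(d - 4)`, which is nonzero exactly because `d ≠ 4`. -/
lemma twist_free (hd : 5 ≤ d) {X Y : V} (hX : B x X (n x) = 0) (hY : B x Y (n x) = 0) :
    B x (cov Γ n x X) Y = (- 2 * B x (cov Γ n x (n x)) (l x)) / ((d : ℝ) - 2) * B x X Y := by
  obtain ⟨m, hm⟩ := h.frame x hx
  have hdR : (5 : ℝ) ≤ d := by exact_mod_cast hd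
  have h2 : (d : ℝ) - 2 ≠ 0 := by linarith
  have := h.cov_n_bilinear hx hm 1 0
    ((- 2 * B x (cov Γ n x (n x)) (l x)) / ((d : ℝ) - 2)) (fun i k => by
      have e1 := h.shear_free_frame hx hm i k
      have e2 := h.shear_free_frame hx hm k i
      rw [hm.m_m i k]
      by_cases hik : i = k
      · subst hik
        rw [if_pos rfl] at e1 e2 ⊢
        field_simp
        linarith
      · rw [if_neg hik] at e1 ⊢
        rw [if_neg (Ne.symm hik)] at e2
        have h4 : (d : ℝ) - 4 ≠ 0 := by linarith
        apply mul_left_cancel₀ (mul_ne_zero h2 h4)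
        linear_combination ((d : ℝ) - 3) * e1 - e2) hX hY
  simpa using this

/-- Up to the frame-independent trace, the Ricci identity expresses the components of boost weight
`-2` of the Weyl tensor through the square of `∇n`. -/
lemma ricci_weight_neg_two : ∃ c : ℝ, ∀ {X Y : V}, B x X (n x) = 0 → B x X (l x) = 0 →
    B x Y (n x) = 0 → B x Y (l x) = 0 →
    C x (n x) X (n x) Y = B x (cov Γ n x X) (cov Γ n x Y) + c * B x X Y := by
  have hs := h.lc.symm x hx
  set θ : V → ℝ := fun y => - 2 * B y (cov Γ n y (n y)) (l y) with hθ
  -- The Ricci identity for `n` in the plane of `n` and `X`, paired with `Y`. It is later averaged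
  -- over exchanging `X` and `Y`, because only the symmetric part of `∇n` is known in dimension
  -- four.
  have half : ∀ {X Y : V → V}, DifferentiableAt ℝ X x → DifferentiableAt ℝ Y x →
      (∀ y ∈ U, B y (X y) (n y) = 0) → (∀ y ∈ U, B y (Y y) (n y) = 0) →
      fderiv ℝ (fun y => B y (cov Γ n y (X y)) (Y y)) x (n x)
        - B x (cov Γ n x (X x)) (cov Γ Y x (n x)) - B x (cov Γ n x (cov Γ X x (n x))) (Y x)
        + θ x / 2 * B x (cov Γ n x (X x)) (Y x) + B x (cov Γ n x (cov Γ n x (X x))) (Y x)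
        = - C x (n x) (Y x) (n x) (X x) := by
    intro X Y dX dY hX hY
    have r := h.lc.ricci_scalar hx (h.contDiffAt_n hx) (h.diff_n hx) dX dY
    rw [fderiv_eq_zero_of_mem (f := fun y => B y (cov Γ n y (n y)) (Y y)) h.lc.isOpen hx
      (fun y hy => h.cov_n_along_n hy (hY y hy)), h.decomp x hx] at r
    -- `∇_X Y` need not be orthogonal to `n`. Removing its `l`-part makes `cov_n_along_n`
    -- applicable, and the removed part produces `θ / 2`.
    have c1 : B x (cov Γ n x (n x)) (cov Γ Y x (X x)) = θ x / 2 * B x (cov Γ n x (X x)) (Y x) := by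
      have e1 := h.lc.fderiv_metric hx dY (h.diff_n hx) (X x)
      rw [fderiv_eq_zero_of_mem h.lc.isOpen hx hY, hs (Y x)] at e1
      set v := cov Γ Y x (X x) with hv
      have e2 : B x (v - B x v (n x) • l x) (n x) = 0 := by simp [h.l_n hx]
      have e3 := h.cov_n_along_n hx e2
      simp only [map_sub, map_smul, smul_eq_mul, zero_apply] at e3 e1
      rw [hθ]
      linear_combination e3 - (B x (cov Γ n x (n x)) (l x)) * e1
    have b1 := hX x hx
    have b2 := hY x hx
    rw [hs] at b1 b2
    rw [c1, h.n_n hx, hs (Y x) (n x), b1, b2] at r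
    have q := h.curvatureLike hx
    rw [q.antisymm (Y x)] at r
    simp only [zero_apply] at r
    linear_combination r
  have hdR : (4 : ℝ) ≤ d := by exact_mod_cast h.dim_ge
  refine ⟨- ((fderiv ℝ θ x (n x) / ((d : ℝ) - 2)) + θ x / 2 * (θ x / ((d : ℝ) - 2))
    + 2 * (θ x / ((d : ℝ) - 2)) * (θ x / ((d : ℝ) - 2))), ?_⟩
  intro X Y hXn hXl hYn hYl
  obtain ⟨X, rfl, dX, -, pX, -, -⟩ := h.exists_screen_extension hx hXl hXn
  obtain ⟨Y, rfl, dY, -, pY, -, -⟩ := h.exists_screen_extension hx hYl hYn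
  have dX : DifferentiableAt ℝ X x :=
    (dX.contDiffAt (h.lc.isOpen.mem_nhds hx)).differentiableAt (by simp)
  have dY : DifferentiableAt ℝ Y x :=
    (dY.contDiffAt (h.lc.isOpen.mem_nhds hx)).differentiableAt (by simp)
  have r1 := half dX dY pX pY
  have r2 := half dY dX pY pX
  have q := h.curvatureLike hx
  have qp := q.pair (n x) (X x) (n x) (Y x)
  have perp : ∀ {Z : V → V}, DifferentiableAt ℝ Z x → (∀ y ∈ U, B y (Z y) (n y) = 0) →
      B x (cov Γ Z x (n x)) (n x) = 0 := by
    intro Z dZ hZ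
    have e1 := h.lc.fderiv_metric hx dZ (h.diff_n hx) (n x)
    rw [fderiv_eq_zero_of_mem h.lc.isOpen hx hZ, hs (Z x), h.cov_n_along_n hx (hZ x hx)] at e1
    simpa using e1.symm
  have s1 := h.shear_free hx (perp dX pX) hYn
  have s2 := h.shear_free hx hXn (perp dY pY)
  have s3 := h.shear_free hx (h.cov_n_n hx (X x)) hYn
  have s4 := h.shear_free hx (h.cov_n_n hx (Y x)) hXn
  have s5 := h.shear_free hx hXn hYn
  have D1 : ∀ {X Y : V → V}, DifferentiableAt ℝ X x → DifferentiableAt ℝ Y x →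
      DifferentiableAt ℝ (fun y => B y (cov Γ n y (X y)) (Y y)) x := by
    intro X Y dX dY
    exact ((h.lc.diff_metric hx).clm_apply (h.lc.diff_cov hx (h.contDiffAt_n hx) dX)).clm_apply dY
  have D2 : DifferentiableAt ℝ (fun y => B y (X y) (Y y)) x :=
    ((h.lc.diff_metric hx).clm_apply dX).clm_apply dY
  have D3 : DifferentiableAt ℝ θ x := h.diff_expansion hx
  have s8 : fderiv ℝ (fun y => B y (cov Γ n y (X y)) (Y y)) x (n x)
      + fderiv ℝ (fun y => B y (cov Γ n y (Y y)) (X y)) x (n x) =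
      2 * (fderiv ℝ θ x (n x)) / ((d : ℝ) - 2) * B x (X x) (Y x)
      + 2 * θ x / ((d : ℝ) - 2) * (B x (cov Γ X x (n x)) (Y x) + B x (X x) (cov Γ Y x (n x))) := by
    rw [← h.lc.fderiv_metric hx dX dY (n x)]
    have t1 := ((D1 dX dY).hasFDerivAt.add (D1 dY dX).hasFDerivAt)
    have t2 := ((D3.hasFDerivAt.const_mul 2).mul_const (((d : ℝ) - 2)⁻¹)).mul D2.hasFDerivAt
    have t3 := t1.unique (t2.congr_of_eventuallyEq (Filter.eventually_of_mem
      (h.lc.isOpen.mem_nhds hx) (fun y hy => by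
        simpa [hθ, div_eq_mul_inv] using h.shear_free hy (pX y hy) (pY y hy))))
    have t4 := DFunLike.congr_fun t3 (n x)
    simp at t4
    rw [t4]
    ring
  have hBB := hs (cov Γ n x (Y x)) (cov Γ n x (X x))
  have hθx : - 2 * B x (cov Γ n x (n x)) (l x) = θ x := rfl
  rw [hθx] at s1 s2 s3 s4 s5
  rw [hBB] at s3
  linear_combination r1 / 2 + r2 / 2 - s8 / 2 + s1 / 2 + s2 / 2 - s3 / 2 - s4 / 2
    - (θ x / 4 + θ x / ((d : ℝ) - 2)) * s5 + qp / 2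

/-- The Weyl components of boost weight `-2` vanish if `∇n` is conformal on the screen. -/
lemma weight_neg_two_eq_zero {m : Fin (d - 2) → V}
    (hm : IsNullFrame d (fun u v => B x u v) (l x) (n x) m) (c : ℝ)
    (hc : ∀ i j, B x (cov Γ n x (m i)) (cov Γ n x (m j)) = if i = j then c else 0)
    (i j : Fin (d - 2)) : C x (n x) (m i) (n x) (m j) = 0 := by
  obtain ⟨c', hc'⟩ := h.ricci_weight_neg_two hx
  have p := h.frame_perp hx hm
  have e : ∀ i j, C x (n x) (m i) (n x) (m j) = if i = j then c + c' else 0 := by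
    intro i j
    rw [hc' (p i).2 (p i).1 (p j).2 (p j).1, hc, hm.m_m]
    split_ifs <;> ring
  have q := h.curvatureLike hx
  have t := h.traceless x hx (n x) (n x)
  rw [hm.metricTrace_eq (h.lc.symm x hx) (by have := h.dim_ge; omega) h.dim_eq] at t
  simp only [slot_apply, q.self_left, q.self_right, fun j => q.antisymm (m j) (n x),
    fun j => q.antisymm' (n x) (m j) (m j), e, neg_neg] at t
  have hd := h.dim_ge
  have h2 : ((d - 2 : ℕ) : ℝ) ≠ 0 := by
    have : d - 2 ≠ 0 := by omega
    exact_mod_cast this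
  simp at t
  -- The components are `(c + c') δ_ij`, and trace-freeness in the slots `(n, n)` forces their sum
  -- `(d - 2)(c + c')` to vanish.
  have h3 : c + c' = 0 := by
    apply mul_left_cancel₀ h2
    linarith
  rw [e, h3]; simp

/-- The Weyl tensor vanishes if its frame components `C(n, m_i, m_j, m_k)` and
`C(n, m_i, n, m_j)` do. -/
lemma weyl_eq_zero {m : Fin (d - 2) → V}
    (hm : IsNullFrame d (fun u v => B x u v) (l x) (n x) m)
    (h1 : ∀ i j k, C x (n x) (m i) (m j) (m k) = 0)
    (h2 : ∀ i j, C x (n x) (m i) (n x) (m j) = 0) : C x = 0 :=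
  (h.neg x hx).eq_zero (h.curvatureLike hx) (h.lc.symm x hx) (by have := h.dim_ge; omega) h.dim_eq
    (h.traceless x hx) hm h1 h2

/-- The Ricci identity for `n` on the screen in the twist-free case. -/
lemma weight_neg_one_pure_trace (hd : 5 ≤ d) {m : Fin (d - 2) → V}
    (hm : IsNullFrame d (fun u v => B x u v) (l x) (n x) m) (i j k : Fin (d - 2)) :
    let θ : V → ℝ := fun y => - 2 * B y (cov Γ n y (n y)) (l y)
    let w := fun i => (fderiv ℝ θ x (m i) - θ x * B x (cov Γ n x (m i)) (l x)) / ((d : ℝ) - 2)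
    C x (n x) (m k) (m i) (m j) =
      (if i = k then w j else 0) - (if j = k then w i else 0) := by
  intro θ w
  have hs := h.lc.symm x hx
  have p := h.frame_perp hx hm
  have hdR : (5 : ℝ) ≤ d := by exact_mod_cast hd
  obtain ⟨X, hX, dX, lX, nX, cXl, cXn⟩ := h.exists_screen_extension hx (p i).1 (p i).2
  obtain ⟨Y, hY, dY, lY, nY, cYl, cYn⟩ := h.exists_screen_extension hx (p j).1 (p j).2
  obtain ⟨Z, hZ, dZ, lZ, nZ, cZl, cZn⟩ := h.exists_screen_extension hx (p k).1 (p k).2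
  have dd : ∀ {X : V → V}, ContDiffOn ℝ ∞ X U → DifferentiableAt ℝ X x := fun dX =>
    (dX.contDiffAt (h.lc.isOpen.mem_nhds hx)).differentiableAt (by simp)
  have D3 : DifferentiableAt ℝ θ x := h.diff_expansion hx
  have r := h.lc.ricci_scalar hx (h.contDiffAt_n hx) (dd dX) (dd dY) (dd dZ)
  have der : ∀ {Y Z : V → V}, ContDiffOn ℝ ∞ Y U → ContDiffOn ℝ ∞ Z U →
      (∀ y ∈ U, B y (Y y) (n y) = 0) → (∀ y ∈ U, B y (Z y) (n y) = 0) → ∀ e,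
      fderiv ℝ (fun y => B y (cov Γ n y (Y y)) (Z y)) x e =
        fderiv ℝ θ x e / ((d : ℝ) - 2) * B x (Y x) (Z x)
        + θ x / ((d : ℝ) - 2) * (B x (cov Γ Y x e) (Z x) + B x (Y x) (cov Γ Z x e)) := by
    intro Y Z dY dZ nY nZ e
    rw [← h.lc.fderiv_metric hx (dd dY) (dd dZ) e]
    have D2 : DifferentiableAt ℝ (fun y => B y (Y y) (Z y)) x :=
      ((h.lc.diff_metric hx).clm_apply (dd dY)).clm_apply (dd dZ)
    have t2 := (D3.hasFDerivAt.mul_const (((d : ℝ) - 2)⁻¹)).mul D2.hasFDerivAt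
    rw [fderiv_congr_of_mem h.lc.isOpen hx (fun y hy => h.twist_free hy hd (nY y hy) (nZ y hy))]
    have t3 := (t2.congr_of_eventuallyEq (f₁ := fun y => (- 2 * B y (cov Γ n y (n y)) (l y))
      / ((d : ℝ) - 2) * B y (Y y) (Z y)) (Filter.Eventually.of_forall (fun y => by
        simp [θ, div_eq_mul_inv]))).fderiv
    rw [t3]
    simp
    ring
  -- Derivatives of screen fields leave the orthogonal complement of `n`. Adding `c l` brings `v`
  -- back so that `twist_free` applies, and `∇_l n` is known from `cov_n_along_l`.
  have nv : ∀ {a v : V} {c : ℝ}, B x a (n x) = 0 → B x a (l x) = 0 → B x v (n x) = - c →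
      B x (cov Γ n x a) v = θ x / ((d : ℝ) - 2) * B x a v - c * B x (cov Γ n x a) (l x) ∧
      B x (cov Γ n x v) a = θ x / ((d : ℝ) - 2) * B x v a - 2 * c * B x (cov Γ n x a) (l x) := by
    intro a v c ha ha' hv
    have hv' : B x (v + c • l x) (n x) = 0 := by simp [hv, h.l_n hx]
    have e1 := h.twist_free hx hd ha hv'
    have e2 := h.twist_free hx hd hv' ha
    rw [cov_add_right, cov_smul_right] at e2
    simp only [map_add, map_smul, add_apply, smul_apply, smul_eq_mul,
      h.cov_n_along_l hx ha ha', ha', hs (l x) a] at e1 e2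
    constructor
    · linear_combination e1
    · linear_combination e2
  rw [der dY dZ nY nZ, der dX dZ nX nZ, h.decomp x hx] at r
  rw [hX, hY, hZ] at r
  rw [(nv (p j).2 (p j).1 (cZn (m i))).1, (nv (p i).2 (p i).1 (cZn (m j))).1,
    (nv (p k).2 (p k).1 (cYn (m i))).2, (nv (p k).2 (p k).1 (cXn (m j))).2] at r
  have tf := fun a b => h.twist_free hx hd (p a).2 (p b).2
  have hθx : - 2 * B x (cov Γ n x (n x)) (l x) = θ x := rfl
  simp only [tf, hm.m_m, hm.n_m, hθx] at r
  rw [(h.curvatureLike hx).antisymm (m k)] at r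
  have sij : (if j = i then (1 : ℝ) else 0) = if i = j then 1 else 0 := by simp only [eq_comm]
  rw [sij] at r
  have e1 : (if i = k then w j else 0) = (if i = k then 1 else 0) * w j := by split_ifs <;> simp
  have e2 : (if j = k then w i else 0) = (if j = k then 1 else 0) * w i := by split_ifs <;> simp
  rw [e1, e2]
  simp only [w]
  linear_combination r

/-- In dimension at least five the expansion of `n` vanishes. -/
lemma expansion_eq_zero (hd : 5 ≤ d) : - 2 * B x (cov Γ n x (n x)) (l x) = 0 := by
  obtain ⟨m, hm⟩ := h.frame x hx
  have hdR : (5 : ℝ) ≤ d := by exact_mod_cast hd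
  set θ : V → ℝ := fun y => - 2 * B y (cov Γ n y (n y)) (l y) with hθ
  set w := fun i => (fderiv ℝ θ x (m i) - θ x * B x (cov Γ n x (m i)) (l x)) / ((d : ℝ) - 2)
    with hw
  set κ := fun i => B x (cov Γ l x (l x)) (m i) with hκ
  have hΨ : ∀ i j k, C x (n x) (m k) (m i) (m j) =
      (if i = k then w j else 0) - (if j = k then w i else 0) :=
    h.weight_neg_one_pure_trace hx hd hm
  have hcard : ((d - 2 : ℕ) : ℝ) = (d : ℝ) - 2 := by
    rw [Nat.cast_sub (by omega)]; norm_num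
  have hψ : ∀ i, C x (l x) (n x) (n x) (m i) = ((d : ℝ) - 3) * w i := by
    intro i
    rw [h.psi_eq_trace hx hm (m i)]
    simp [hΨ, hcard]
    ring
  have p := h.frame_perp hx hm
  have hθx : - 2 * B x (cov Γ n x (n x)) (l x) = θ x := rfl
  -- The weight-one Bianchi equation with the pure-trace form of the Weyl components substituted: an
  -- equation for the matrix `κ_j w_i`.
  have eq1 : ∀ i j, ((d : ℝ) - 2) * (κ j * (((d : ℝ) - 3) * w i) - (κ i * w j
      - if i = j then ∑ k, κ k * w k else 0)) =
      if i = j then ε * (θ x / ((d : ℝ) - 2) - θ x) else 0 := by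
    intro i j
    have b := h.bianchi_weight_one hx hm i j
    rw [hψ, h.twist_free hx hd (p i).2 (p j).2, hm.m_m, hθx] at b
    have e : ∑ k, B x (cov Γ l x (l x)) (m k) * C x (n x) (m i) (m k) (m j) =
        κ i * w j - if i = j then ∑ k, κ k * w k else 0 := by
      simp only [hΨ, mul_sub, Finset.sum_sub_distrib]
      congr 1
      · simp [hκ]
      · rcases eq_or_ne i j with rfl | hij
        · simp [hκ]
        · simp [hij, hij.symm]
    rw [e] at b
    rw [b, ← hθx]
    split_ifs <;> ring
  have h2 : (d : ℝ) - 2 ≠ 0 := by linarith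
  have h4 : (d : ℝ) - 4 ≠ 0 := by linarith
  have off : ∀ i j, i ≠ j → κ j * w i = 0 := by
    intro i j hij
    have a1 := eq1 i j
    have a2 := eq1 j i
    rw [if_neg hij, if_neg hij] at a1
    rw [if_neg (Ne.symm hij), if_neg (Ne.symm hij)] at a2
    have a3 : ((d : ℝ) - 2) * ((d : ℝ) - 2) * ((d : ℝ) - 4) * (κ j * w i) = 0 := by
      linear_combination ((d : ℝ) - 3) * a1 + a2
    exact (mul_eq_zero.1 a3).resolve_left (mul_ne_zero (mul_ne_zero h2 h2) h4)
  set S := ∑ k, κ k * w k with hS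
  have diag : ∀ i, ((d : ℝ) - 2) * (((d : ℝ) - 4) * (κ i * w i) + S) =
      ε * (θ x / ((d : ℝ) - 2) - θ x) := by
    intro i
    have a := eq1 i i
    rw [if_pos rfl, if_pos rfl] at a
    linear_combination a
  -- The diagonal products agree, and `(κ_i w_i)(κ_j w_j) = (κ_j w_i)(κ_i w_j)` is a product of
  -- vanishing off-diagonal ones.
  have zero : ∀ i, κ i * w i = 0 := by
    intro i
    have : Nontrivial (Fin (d - 2)) := Fin.nontrivial_iff_two_le.2 (by omega)
    obtain ⟨j, hji⟩ := exists_ne i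
    have e1 : κ i * w i = κ j * w j := by
      have := (diag i).trans (diag j).symm
      have := mul_left_cancel₀ h2 this
      have : ((d : ℝ) - 4) * (κ i * w i) = ((d : ℝ) - 4) * (κ j * w j) := by linarith
      exact mul_left_cancel₀ h4 this
    have e2 : (κ i * w i) * (κ i * w i) = 0 := by
      nth_rewrite 2 [e1]
      linear_combination (κ j * w i) * off j i hji
    exact mul_self_eq_zero.1 e2
  have hS0 : S = 0 := Finset.sum_eq_zero (fun i _ => zero i)
  have a := diag ⟨0, by omega⟩
  rw [zero, hS0] at a
  rw [hθx]
  field_simp at a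
  have a' : ε * ((d : ℝ) - 3) * θ x = 0 := by linarith
  exact (mul_eq_zero.1 a').resolve_left (mul_ne_zero h.eps_ne (by linarith))

/-- In dimension at least five a transverse configuration is conformally flat. -/
theorem weyl_eq_zero_of_five_le (hd : 5 ≤ d) : C x = 0 := by
  obtain ⟨m, hm⟩ := h.frame x hx
  have p := h.frame_perp hx hm
  have θ0 := h.expansion_eq_zero hx hd
  -- The expansion vanishes on all of `U`, so both `θ` and `dθ` drop out of the pure-trace formula.
  have dθ : fderiv ℝ (fun y => - 2 * B y (cov Γ n y (n y)) (l y)) x = 0 :=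
    fderiv_eq_zero_of_mem h.lc.isOpen hx (fun y hy => h.expansion_eq_zero hy hd)
  refine h.weyl_eq_zero hx hm (fun i j k => ?_) (h.weight_neg_two_eq_zero hx hm 0 (fun i j => ?_))
  · have := h.weight_neg_one_pure_trace hx hd hm j k i
    simp only [dθ, θ0] at this
    simpa using this
  · rw [h.twist_free hx hd (p i).2 (h.cov_n_n hx (m j)), θ0]
    simp

end IsTransverseOn

end SecondOrder


/-! ### Dimension four: screen frames and vanishing of weight `-2` -/

section FourDim

set_option maxSynthPendingDepth 3
set_option linter.unusedSectionVars false

variable {V : Type*} [NormedAddCommGroup V] [NormedSpace ℝ V]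

/-- Smooth vector fields `e`, `f` that complete `l`, `n` to a null frame in dimension four. -/
structure IsScreenFrameOn (U : Set V) (B : V → V →L[ℝ] V →L[ℝ] ℝ) (l n e f : V → V) : Prop where
  smooth_e : ContDiffOn ℝ ∞ e U
  smooth_f : ContDiffOn ℝ ∞ f U
  e_e : ∀ y ∈ U, B y (e y) (e y) = 1
  f_f : ∀ y ∈ U, B y (f y) (f y) = 1
  e_f : ∀ y ∈ U, B y (e y) (f y) = 0
  f_e : ∀ y ∈ U, B y (f y) (e y) = 0
  e_l : ∀ y ∈ U, B y (e y) (l y) = 0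
  e_n : ∀ y ∈ U, B y (e y) (n y) = 0
  f_l : ∀ y ∈ U, B y (f y) (l y) = 0
  f_n : ∀ y ∈ U, B y (f y) (n y) = 0

lemma IsScreenFrameOn.swap {U : Set V} {B : V → V →L[ℝ] V →L[ℝ] ℝ} {l n e f : V → V}
    (s : IsScreenFrameOn U B l n e f) : IsScreenFrameOn U B l n f e :=
  ⟨s.smooth_f, s.smooth_e, s.f_f, s.e_e, s.f_e, s.e_f, s.f_l, s.f_n, s.e_l, s.e_n⟩

variable [FiniteDimensional ℝ V] {U : Set V} {B : V → V →L[ℝ] V →L[ℝ] ℝ}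
  {Γ : V → V →L[ℝ] V →L[ℝ] V} {C : V → V →L[ℝ] V →L[ℝ] V →L[ℝ] V →L[ℝ] ℝ} {l n : V → V} {ε μ : ℝ}
  {x : V} {e f : V → V}

lemma IsTransverseOn.screen_nullFrame (h : IsTransverseOn 4 U B Γ C l n ε μ)
    (s : IsScreenFrameOn U B l n e f) (hx : x ∈ U) :
    IsNullFrame 4 (fun u v => B x u v) (l x) (n x) (![e x, f x] : Fin 2 → V) where
  l_l := h.l_l hx
  n_n := h.n_n hx
  l_n := h.l_n hx
  l_m i := by
    rw [h.lc.symm x hx]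
    -- `Fin (4 - 2)` is `Fin 2` by reduction; the change of type lets `fin_cases` enumerate the two
    -- screen indices.
    change Fin 2 at i
    fin_cases i
    · exact s.e_l x hx
    · exact s.f_l x hx
  n_m i := by
    rw [h.lc.symm x hx]
    change Fin 2 at i
    fin_cases i
    · exact s.e_n x hx
    · exact s.f_n x hx
  m_m i j := by
    change Fin 2 at i j
    fin_cases i <;> fin_cases j <;> simp [s.e_e x hx, s.f_f x hx, s.e_f x hx, s.f_e x hx]

namespace IsScreenFrameOn

variable (s : IsScreenFrameOn U B l n e f) (h : IsTransverseOn 4 U B Γ C l n ε μ) (hx : x ∈ U)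
include s h hx

lemma diff_e : DifferentiableAt ℝ e x :=
  (s.smooth_e.contDiffAt (h.lc.isOpen.mem_nhds hx)).differentiableAt (by simp)

lemma diff_f : DifferentiableAt ℝ f x := s.swap.diff_e h hx

lemma expand (v : V) : v = B x v (n x) • l x + B x v (l x) • n x + B x v (e x) • e x
    + B x v (f x) • f x := by
  have := h.frame_expand hx (h.screen_nullFrame s hx) v
  erw [Fin.sum_univ_two] at this
  simpa [add_assoc] using this

/-- The components of `∇n`: it is shear-free. -/
lemma cov_n_ee : B x (cov Γ n x (e x)) (e x) = - B x (cov Γ n x (n x)) (l x) := by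
  have := h.shear_free hx (s.e_n x hx) (s.e_n x hx)
  rw [s.e_e x hx] at this
  norm_num at this
  linarith

lemma cov_n_fe : B x (cov Γ n x (f x)) (e x) = - B x (cov Γ n x (e x)) (f x) := by
  have := h.shear_free hx (s.e_n x hx) (s.f_n x hx)
  rw [s.e_f x hx] at this
  linarith

lemma cov_n_eq (u : V) : cov Γ n x u = B x (cov Γ n x u) (l x) • n x
    + B x (cov Γ n x u) (e x) • e x + B x (cov Γ n x u) (f x) • f x := by
  conv_lhs => rw [s.expand h hx (cov Γ n x u), h.cov_n_n hx]
  simp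

lemma cov_l_eq (u : V) : cov Γ l x u = - B x (cov Γ n x u) (l x) • l x
    + B x (cov Γ l x u) (e x) • e x + B x (cov Γ l x u) (f x) • f x := by
  conv_lhs => rw [s.expand h hx (cov Γ l x u), h.cov_l_l hx, h.cov_l_n hx]
  simp

lemma cov_f_e (u : V) : B x (cov Γ f x u) (e x) = - B x (cov Γ e x u) (f x) := by
  have h1 := h.lc.fderiv_metric hx (s.diff_e h hx) (s.diff_f h hx) u
  rw [fderiv_eq_zero_of_mem h.lc.isOpen hx s.e_f, h.lc.symm x hx (e x)] at h1
  simp at h1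
  linarith

lemma cov_e_eq (u : V) : cov Γ e x u = - B x (cov Γ n x u) (e x) • l x
    - B x (cov Γ l x u) (e x) • n x + B x (cov Γ e x u) (f x) • f x := by
  have hs := h.lc.symm x hx
  have h1 := h.lc.fderiv_metric hx (s.diff_e h hx) (s.diff_e h hx) u
  rw [fderiv_eq_zero_of_mem h.lc.isOpen hx s.e_e, hs (e x)] at h1
  have h2 := h.lc.fderiv_metric hx (s.diff_e h hx) (h.diff_l hx) u
  rw [fderiv_eq_zero_of_mem h.lc.isOpen hx s.e_l, hs (e x)] at h2
  have h3 := h.lc.fderiv_metric hx (s.diff_e h hx) (h.diff_n hx) u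
  rw [fderiv_eq_zero_of_mem h.lc.isOpen hx s.e_n, hs (e x)] at h3
  simp only [zero_apply] at h1 h2 h3
  have e1 : B x (cov Γ e x u) (e x) = 0 := by linarith
  have e2 : B x (cov Γ e x u) (l x) = - B x (cov Γ l x u) (e x) := by linarith
  have e3 : B x (cov Γ e x u) (n x) = - B x (cov Γ n x u) (e x) := by linarith
  conv_lhs => rw [s.expand h hx (cov Γ e x u), e1, e2, e3]
  simp
  abel

lemma cov_f_eq (u : V) : cov Γ f x u = - B x (cov Γ n x u) (f x) • l x
    - B x (cov Γ l x u) (f x) • n x - B x (cov Γ e x u) (f x) • e x := by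
  rw [s.swap.cov_e_eq h hx u, s.cov_f_e h hx]
  simp
  abel

/-- On a two-dimensional screen a shear-free `∇n` is a multiple of a rotation, so `∇_e n` and `∇_f
n` are orthogonal with equal squares, up to `n`-parts that do not contribute. The criterion
`weight_neg_two_eq_zero` therefore holds even with twist. -/
lemma weyl_neg_two : C x (n x) (e x) (n x) (e x) = 0 ∧ C x (n x) (e x) (n x) (f x) = 0 ∧
    C x (n x) (f x) (n x) (e x) = 0 ∧ C x (n x) (f x) (n x) (f x) = 0 := by
  have hs := h.lc.symm x hx
  have key := h.weight_neg_two_eq_zero hx (h.screen_nullFrame s hx)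
    (B x (cov Γ n x (n x)) (l x) ^ 2 + B x (cov Γ n x (e x)) (f x) ^ 2) (by
      have a1 := s.cov_n_ee h hx
      have a2 := s.swap.cov_n_ee h hx
      have a3 := s.cov_n_fe h hx
      have b1 : ∀ v, B x (cov Γ n x (e x)) v = B x (cov Γ n x (e x)) (l x) * B x (n x) v
          - B x (cov Γ n x (n x)) (l x) * B x (e x) v
          + B x (cov Γ n x (e x)) (f x) * B x (f x) v := by
        intro v
        conv_lhs => rw [s.cov_n_eq h hx (e x), a1]
        simp
        ring
      have b2 : ∀ v, B x (cov Γ n x (f x)) v = B x (cov Γ n x (f x)) (l x) * B x (n x) v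
          - B x (cov Γ n x (e x)) (f x) * B x (e x) v
          - B x (cov Γ n x (n x)) (l x) * B x (f x) v := by
        intro v
        conv_lhs => rw [s.cov_n_eq h hx (f x), a2, a3]
        simp
        ring
      have c1 := h.cov_n_n hx (e x)
      have c2 := h.cov_n_n hx (f x)
      intro i j
      change Fin 2 at i j
      fin_cases i <;> fin_cases j
      · change B x (cov Γ n x (e x)) (cov Γ n x (e x)) = _
        rw [b1 (cov Γ n x (e x)), hs (n x), hs (e x), hs (f x), c1, a1]
        simp
        ring
      · change B x (cov Γ n x (e x)) (cov Γ n x (f x)) = _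
        rw [b1 (cov Γ n x (f x)), hs (n x), hs (e x), hs (f x), c2, a2, a3]
        simp
        ring
      · change B x (cov Γ n x (f x)) (cov Γ n x (e x)) = _
        rw [b2 (cov Γ n x (e x)), hs (n x), hs (e x), hs (f x), c1, a1]
        simp
        ring
      · change B x (cov Γ n x (f x)) (cov Γ n x (f x)) = _
        rw [b2 (cov Γ n x (f x)), hs (n x), hs (e x), hs (f x), c2, a2, a3]
        simp
        ring)
  exact ⟨key (0 : Fin 2) (0 : Fin 2), key (0 : Fin 2) (1 : Fin 2), key (1 : Fin 2) (0 : Fin 2),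
    key (1 : Fin 2) (1 : Fin 2)⟩

lemma psi_f : C x (n x) (e x) (e x) (f x) = C x (l x) (n x) (n x) (f x) := by
  have := h.psi_eq_trace hx (h.screen_nullFrame s hx) (f x)
  erw [Fin.sum_univ_two] at this
  simp [(h.curvatureLike hx).self_right] at this
  exact this.symm

end IsScreenFrameOn

end FourDim


/-! ### Dimension four: connection coefficients and the Bianchi equations for `ψ` and `φ` -/

section FourDimWeyl

set_option maxSynthPendingDepth 3
set_option linter.unusedSectionVars false
set_option linter.unusedSimpArgs false

variable {V : Type*} [NormedAddCommGroup V] [NormedSpace ℝ V]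

variable [FiniteDimensional ℝ V] {U : Set V} {B : V → V →L[ℝ] V →L[ℝ] ℝ}
  {Γ : V → V →L[ℝ] V →L[ℝ] V} {C : V → V →L[ℝ] V →L[ℝ] V →L[ℝ] V →L[ℝ] ℝ} {l n : V → V} {ε μ : ℝ}
  {x : V} {e f : V → V}

/-- The connection coefficients of a null frame `l, n, e, f` with `∇n` as forced by the field
equations. -/
structure ScreenConnection (B : V → V →L[ℝ] V →L[ℝ] ℝ) (Γ : V → V →L[ℝ] V →L[ℝ] V)
    (l n e f : V → V) (x : V) where
  /-- Half the negative of the expansion of `n`. -/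
  β : ℝ
  /-- The twist of `n`. -/
  α : ℝ
  (ae af σ τe τf κe κf Lee Lef Lfe Lff sn sl se sf : ℝ)
  n_n : cov Γ n x (n x) = β • n x
  n_e : cov Γ n x (e x) = ae • n x - β • e x + α • f x
  n_f : cov Γ n x (f x) = af • n x - α • e x - β • f x
  n_l : cov Γ n x (l x) = σ • n x + (2 * ae) • e x + (2 * af) • f x
  l_n : cov Γ l x (n x) = - β • l x + τe • e x + τf • f x
  l_e : cov Γ l x (e x) = - ae • l x + Lee • e x + Lef • f x
  l_f : cov Γ l x (f x) = - af • l x + Lfe • e x + Lff • f x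
  l_l : cov Γ l x (l x) = - σ • l x + κe • e x + κf • f x
  e_n : cov Γ e x (n x) = - τe • n x + sn • f x
  e_e : cov Γ e x (e x) = β • l x - Lee • n x + se • f x
  e_f : cov Γ e x (f x) = α • l x - Lfe • n x + sf • f x
  e_l : cov Γ e x (l x) = - (2 * ae) • l x - κe • n x + sl • f x
  f_n : cov Γ f x (n x) = - τf • n x - sn • e x
  f_e : cov Γ f x (e x) = - α • l x - Lef • n x - se • e x
  f_f : cov Γ f x (f x) = β • l x - Lff • n x - sf • e x
  f_l : cov Γ f x (l x) = - (2 * af) • l x - κf • n x - sl • e x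

namespace IsScreenFrameOn

variable (s : IsScreenFrameOn U B l n e f) (h : IsTransverseOn 4 U B Γ C l n ε μ) (hx : x ∈ U)

/-- The connection coefficients of a screen frame. -/
def connection : ScreenConnection B Γ l n e f x where
  β := B x (cov Γ n x (n x)) (l x)
  α := B x (cov Γ n x (e x)) (f x)
  ae := B x (cov Γ n x (e x)) (l x)
  af := B x (cov Γ n x (f x)) (l x)
  σ := B x (cov Γ n x (l x)) (l x)
  τe := B x (cov Γ l x (n x)) (e x)
  τf := B x (cov Γ l x (n x)) (f x)
  κe := B x (cov Γ l x (l x)) (e x)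
  κf := B x (cov Γ l x (l x)) (f x)
  Lee := B x (cov Γ l x (e x)) (e x)
  Lef := B x (cov Γ l x (e x)) (f x)
  Lfe := B x (cov Γ l x (f x)) (e x)
  Lff := B x (cov Γ l x (f x)) (f x)
  sn := B x (cov Γ e x (n x)) (f x)
  sl := B x (cov Γ e x (l x)) (f x)
  se := B x (cov Γ e x (e x)) (f x)
  sf := B x (cov Γ e x (f x)) (f x)
  n_n := by
    conv_lhs => rw [s.cov_n_eq h hx, h.cov_n_along_n hx (s.e_n x hx),
      h.cov_n_along_n hx (s.f_n x hx)]
    simp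
  n_e := by
    conv_lhs => rw [s.cov_n_eq h hx, s.cov_n_ee h hx]
    module
  n_f := by
    conv_lhs => rw [s.cov_n_eq h hx, s.swap.cov_n_ee h hx, s.cov_n_fe h hx]
    module
  n_l := by
    conv_lhs => rw [s.cov_n_eq h hx, h.cov_n_along_l hx (s.e_n x hx) (s.e_l x hx),
      h.cov_n_along_l hx (s.f_n x hx) (s.f_l x hx)]
  l_n := s.cov_l_eq h hx _
  l_e := s.cov_l_eq h hx _
  l_f := s.cov_l_eq h hx _
  l_l := s.cov_l_eq h hx _
  e_n := by
    conv_lhs => rw [s.cov_e_eq h hx, h.cov_n_along_n hx (s.e_n x hx)]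
    module
  e_e := by
    conv_lhs => rw [s.cov_e_eq h hx, s.cov_n_ee h hx]
    module
  e_f := by
    conv_lhs => rw [s.cov_e_eq h hx, s.cov_n_fe h hx]
    module
  e_l := by
    conv_lhs => rw [s.cov_e_eq h hx, h.cov_n_along_l hx (s.e_n x hx) (s.e_l x hx)]
  f_n := by
    conv_lhs => rw [s.cov_f_eq h hx, h.cov_n_along_n hx (s.f_n x hx)]
    module
  f_e := s.cov_f_eq h hx _
  f_f := by
    conv_lhs => rw [s.cov_f_eq h hx, s.swap.cov_n_ee h hx]
    module
  f_l := by
    conv_lhs => rw [s.cov_f_eq h hx, h.cov_n_along_l hx (s.f_n x hx) (s.f_l x hx)]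

include s h hx

/-- The products of the frame vectors. -/
lemma products : (B x (n x) (n x) = 0 ∧ B x (l x) (l x) = 0 ∧ B x (n x) (l x) = 1 ∧
    B x (l x) (n x) = 1) ∧ (B x (l x) (e x) = 0 ∧ B x (l x) (f x) = 0 ∧ B x (n x) (e x) = 0 ∧
    B x (n x) (f x) = 0) ∧ (B x (e x) (l x) = 0 ∧ B x (f x) (l x) = 0 ∧ B x (e x) (n x) = 0 ∧
    B x (f x) (n x) = 0) ∧ (B x (e x) (e x) = 1 ∧ B x (f x) (f x) = 1 ∧ B x (e x) (f x) = 0 ∧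
    B x (f x) (e x) = 0) := by
  have hs := h.lc.symm x hx
  refine ⟨⟨h.n_n hx, h.l_l hx, h.n_l hx, h.l_n hx⟩, ⟨?_, ?_, ?_, ?_⟩,
    ⟨s.e_l x hx, s.f_l x hx, s.e_n x hx, s.f_n x hx⟩,
    ⟨s.e_e x hx, s.f_f x hx, s.e_f x hx, s.f_e x hx⟩⟩ <;> rw [hs]
  exacts [s.e_l x hx, s.f_l x hx, s.e_n x hx, s.f_n x hx]

/-- The Weyl tensor in terms of its components `C(l, n, n, e)` and `C(l, n, n, f)`. -/
lemma weyl_formula {ψ φ : ℝ} (hψ : C x (l x) (n x) (n x) (e x) = ψ)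
    (hφ : C x (l x) (n x) (n x) (f x) = φ) (u v w z : V) :
    let q := fun a b => B x a (n x) * B x b (l x) - B x a (l x) * B x b (n x)
    let r := fun a b => B x a (e x) * B x b (f x) - B x a (f x) * B x b (e x)
    let P := fun a b => B x a (l x) * B x b (e x) - B x a (e x) * B x b (l x)
    let Q := fun a b => B x a (l x) * B x b (f x) - B x a (f x) * B x b (l x)
    C x u v w z = P u v * (ψ * q w z + φ * r w z) + Q u v * (φ * q w z - ψ * r w z)
      + P w z * (ψ * q u v + φ * r u v) + Q w z * (φ * q u v - ψ * r u v) := by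
  intro q r P Q
  subst hψ hφ
  have k := h.curvatureLike hx
  have hn := h.neg x hx
  have hl := h.l_l hx
  have el := s.e_l x hx
  have fl := s.f_l x hx
  -- Expansion of the first bivector in the six basis bivectors of the frame; pair symmetry later
  -- allows the same for the second one.
  have ex : ∀ a b c d, C x a b c d = q a b * C x (l x) (n x) c d + r a b * C x (e x) (f x) c d
      + P a b * C x (n x) (e x) c d + Q a b * C x (n x) (f x) c d
      + (B x a (n x) * B x b (e x) - B x a (e x) * B x b (n x)) * C x (l x) (e x) c d
      + (B x a (n x) * B x b (f x) - B x a (f x) * B x b (n x)) * C x (l x) (f x) c d := by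
    intro a b c d
    conv_lhs => rw [s.expand h hx a, s.expand h hx b]
    simp only [map_add, map_smul, add_apply, smul_apply, smul_eq_mul, k.self_left]
    rw [k.antisymm (n x) (l x), k.antisymm (e x) (l x), k.antisymm (f x) (l x),
      k.antisymm (f x) (e x), k.antisymm (e x) (n x), k.antisymm (f x) (n x)]
    simp only [q, r, P, Q]
    ring
  obtain ⟨o1, o2, o3, o4⟩ := s.weyl_neg_two h hx
  have zz : ∀ X Y, B x X (l x) = 0 → B x Y (l x) = 0 → ∀ Z, C x (l x) X Z Y = 0 := by
    intro X Y hX hY Z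
    rw [k.antisymm', hn.left_perp _ _ _ hX hY, neg_zero]
  have t1 : ∀ X, B x X (l x) = 0 → C x (n x) X (l x) (n x) = C x (l x) (n x) (n x) X :=
    fun X _ => k.pair _ _ _ _
  set ψ := C x (l x) (n x) (n x) (e x) with hψ
  set φ := C x (l x) (n x) (n x) (f x) with hφ
  have t2 : C x (n x) (f x) (e x) (f x) = - ψ := by
    rw [k.antisymm', s.swap.psi_f h hx]
  have t3 := s.psi_f h hx
  have t4 : C x (e x) (f x) (n x) (e x) = φ := by rw [k.pair, t3]
  have t5 : C x (e x) (f x) (n x) (f x) = - ψ := by rw [k.pair, t2]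
  have t6 : C x (e x) (f x) (l x) (n x) = 0 := by rw [k.pair, hn.right_perp _ _ _ el fl]
  have w1 : ∀ a b, C x a b (l x) (n x) = ψ * P a b + φ * Q a b := by
    intro a b
    rw [ex a b, hn.left_left, hn.left_left, hn.left_left, t6, t1 _ el, t1 _ fl]
    ring
  have w2 : ∀ a b, C x a b (e x) (f x) = φ * P a b - ψ * Q a b := by
    intro a b
    rw [ex a b, hn.right_perp _ _ _ el fl, hn.perp _ _ _ _ el fl el fl, zz _ _ el fl, zz _ _ fl fl,
      t2, t3]
    ring
  have w3 : ∀ a b, C x a b (n x) (e x) = ψ * q a b + φ * r a b := by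
    intro a b
    rw [ex a b, o1, o3, zz _ _ el el, zz _ _ fl el, t4]
    ring
  have w4 : ∀ a b, C x a b (n x) (f x) = φ * q a b - ψ * r a b := by
    intro a b
    rw [ex a b, o2, o4, zz _ _ el fl, zz _ _ fl fl, t5]
    ring
  have w5 : ∀ X, B x X (l x) = 0 → ∀ a b, C x a b (l x) X = 0 := by
    intro X hX a b
    have y1 : C x (e x) (f x) (l x) X = 0 := by rw [k.pair, hn.left_perp _ _ _ hX el]
    have y2 : ∀ Y, B x Y (l x) = 0 → C x (n x) Y (l x) X = 0 := by
      intro Y hY; rw [k.pair, zz _ _ hX hY]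
    rw [ex a b, hn.left_left, hn.left_left, hn.left_left, y1, y2 _ el, y2 _ fl]
    ring
  rw [k.pair u v w z, ex w z]
  rw [k.pair (l x) (n x) u v, k.pair (e x) (f x) u v, k.pair (n x) (e x) u v,
    k.pair (n x) (f x) u v, k.pair (l x) (e x) u v, k.pair (l x) (f x) u v, w1, w2, w3, w4,
    w5 _ el, w5 _ fl]
  ring


/-- The Bianchi equations of boost weight `-2`. -/
lemma transport_n (c : ScreenConnection B Γ l n e f x) :
    let ψ := fun y => C y (l y) (n y) (n y) (e y)
    let φ := fun y => C y (l y) (n y) (n y) (f y)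
    fderiv ℝ ψ x (n x) - c.sn * φ x = 5 * c.β * ψ x + 4 * c.α * φ x ∧
    fderiv ℝ φ x (n x) + c.sn * ψ x = 5 * c.β * φ x - 4 * c.α * ψ x := by
  intro ψ φ
  have b := s.products h hx
  have dC := h.diff_C hx
  have dn := h.diff_n hx
  have de := s.diff_e h hx
  have df := s.diff_f h hx
  obtain ⟨p, hp⟩ : ∃ p, ψ x = p := ⟨_, rfl⟩
  obtain ⟨q, hq⟩ : ∃ q, φ x = q := ⟨_, rfl⟩
  have W := s.weyl_formula h hx hp hq
  simp only at W
  have o := fun y (hy : y ∈ U) => s.weyl_neg_two h hy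
  have k := fun y (hy : y ∈ U) => h.curvatureLike hy
  constructor
  -- The Cotton terms drop out because `n` is null and orthogonal to the screen. The components
  -- under the derivatives along the screen vanish identically, so only `ψ` is differentiated, along
  -- `n`.
  · have bi := h.lc.bianchi_weyl hx dC dn h.decomp (n x) (e x) (f x) (n x) (f x)
    have t1 := fderiv_tensor (Γ := Γ) dC de df dn df (n x)
    have t2 := fderiv_tensor (Γ := Γ) dC df dn dn df (e x)
    have t3 := fderiv_tensor (Γ := Γ) dC dn de dn df (f x)
    rw [fderiv_congr_of_mem (g := fun y => - ψ y) h.lc.isOpen hx (fun y hy => by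
      rw [(k y hy).pair, (k y hy).antisymm', s.swap.psi_f h hy])] at t1
    rw [fderiv_eq_zero_of_mem h.lc.isOpen hx (fun y hy => by
      rw [(k y hy).antisymm, (o y hy).2.2.2, neg_zero])] at t2
    rw [fderiv_eq_zero_of_mem h.lc.isOpen hx (fun y hy => (o y hy).2.1)] at t3
    simp [cottonNull, W, c.n_n, c.n_e, c.n_f, c.e_n, c.f_n, c.f_e, c.f_f, c.e_e, c.e_f, b]
      at bi t1 t2 t3
    rw [hp, hq]
    linear_combination - t1 - t2 - t3 - bi
  · have bi := h.lc.bianchi_weyl hx dC dn h.decomp (n x) (e x) (f x) (n x) (e x)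
    have t1 := fderiv_tensor (Γ := Γ) dC de df dn de (n x)
    have t2 := fderiv_tensor (Γ := Γ) dC df dn dn de (e x)
    have t3 := fderiv_tensor (Γ := Γ) dC dn de dn de (f x)
    rw [fderiv_congr_of_mem (g := φ) h.lc.isOpen hx (fun y hy => by
      rw [(k y hy).pair, s.psi_f h hy])] at t1
    rw [fderiv_eq_zero_of_mem h.lc.isOpen hx (fun y hy => by
      rw [(k y hy).antisymm, (o y hy).2.2.1, neg_zero])] at t2
    rw [fderiv_eq_zero_of_mem h.lc.isOpen hx (fun y hy => (o y hy).1)] at t3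
    simp [cottonNull, W, c.n_n, c.n_e, c.n_f, c.e_n, c.f_n, c.f_e, c.f_f, c.e_e, c.e_f, b]
      at bi t1 t2 t3
    rw [hp, hq]
    linear_combination t1 + t2 + t3 + bi

set_option maxHeartbeats 1000000 in
/-- The Bianchi equations of boost weight `-1`. -/
lemma transport_screen (c : ScreenConnection B Γ l n e f x) :
    let ψ := fun y => C y (l y) (n y) (n y) (e y)
    let φ := fun y => C y (l y) (n y) (n y) (f y)
    fderiv ℝ ψ x (e x) - c.se * φ x = c.ae * ψ x + (c.τe * ψ x + c.τf * φ x)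
      + 4 * (c.ae * ψ x - c.af * φ x) ∧
    fderiv ℝ φ x (f x) + c.sf * ψ x = c.af * φ x + (c.τe * ψ x + c.τf * φ x)
      - 4 * (c.ae * ψ x - c.af * φ x) ∧
    fderiv ℝ φ x (e x) + c.se * ψ x = c.ae * φ x + (c.τe * φ x - c.τf * ψ x)
      + 4 * (c.ae * φ x + c.af * ψ x) ∧
    fderiv ℝ ψ x (f x) - c.sf * φ x = c.af * ψ x + (c.τf * ψ x - c.τe * φ x)
      + 4 * (c.ae * φ x + c.af * ψ x) := by
  intro ψ φ
  have b := s.products h hx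
  have dC := h.diff_C hx
  have dl := h.diff_l hx
  have dn := h.diff_n hx
  have de := s.diff_e h hx
  have df := s.diff_f h hx
  obtain ⟨p, hp⟩ : ∃ p, ψ x = p := ⟨_, rfl⟩
  obtain ⟨q, hq⟩ : ∃ q, φ x = q := ⟨_, rfl⟩
  have W := s.weyl_formula h hx hp hq
  simp only at W
  have o := fun y (hy : y ∈ U) => s.weyl_neg_two h hy
  have k := fun y (hy : y ∈ U) => h.curvatureLike hy
  refine ⟨?_, ?_, ?_, ?_⟩
  -- The component differentiated along `n` vanishes by negative boost order and the one along `l`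
  -- by `weyl_neg_two`, leaving a derivative of `ψ` along the screen. The three other cases choose
  -- other screen vectors.
  · have bi := h.lc.bianchi_weyl hx dC dn h.decomp (n x) (e x) (l x) (n x) (e x)
    have t1 := fderiv_tensor (Γ := Γ) dC de dl dn de (n x)
    have t2 := fderiv_tensor (Γ := Γ) dC dl dn dn de (e x)
    have t3 := fderiv_tensor (Γ := Γ) dC dn de dn de (l x)
    rw [fderiv_eq_zero_of_mem h.lc.isOpen hx (fun y hy => by
      rw [(k y hy).antisymm, (k y hy).antisymm', (h.neg y hy).left_perp _ _ _ (s.e_l y hy)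
        (s.e_l y hy), neg_zero, neg_zero])] at t1
    rw [fderiv_eq_zero_of_mem h.lc.isOpen hx (fun y hy => (o y hy).1)] at t3
    change fderiv ℝ ψ x (e x) = _ at t2
    simp [cottonNull, W, c.n_n, c.n_e, c.n_f, c.n_l, c.l_n, c.l_e, c.l_f, c.e_n, c.f_n, c.f_e,
      c.f_f, c.e_e, c.e_f, c.e_l, c.f_l, b] at bi t1 t2 t3
    rw [hp, hq]
    linear_combination t1 + t2 + t3 + bi
  · have bi := h.lc.bianchi_weyl hx dC dn h.decomp (n x) (f x) (l x) (n x) (f x)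
    have t1 := fderiv_tensor (Γ := Γ) dC df dl dn df (n x)
    have t2 := fderiv_tensor (Γ := Γ) dC dl dn dn df (f x)
    have t3 := fderiv_tensor (Γ := Γ) dC dn df dn df (l x)
    rw [fderiv_eq_zero_of_mem h.lc.isOpen hx (fun y hy => by
      rw [(k y hy).antisymm, (k y hy).antisymm', (h.neg y hy).left_perp _ _ _ (s.f_l y hy)
        (s.f_l y hy), neg_zero, neg_zero])] at t1
    rw [fderiv_eq_zero_of_mem h.lc.isOpen hx (fun y hy => (o y hy).2.2.2)] at t3
    change fderiv ℝ φ x (f x) = _ at t2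
    simp [cottonNull, W, c.n_n, c.n_e, c.n_f, c.n_l, c.l_n, c.l_e, c.l_f, c.e_n, c.f_n, c.f_e,
      c.f_f, c.e_e, c.e_f, c.e_l, c.f_l, b] at bi t1 t2 t3
    rw [hp, hq]
    linear_combination t1 + t2 + t3 + bi
  · have bi := h.lc.bianchi_weyl hx dC dn h.decomp (n x) (e x) (l x) (n x) (f x)
    have t1 := fderiv_tensor (Γ := Γ) dC de dl dn df (n x)
    have t2 := fderiv_tensor (Γ := Γ) dC dl dn dn df (e x)
    have t3 := fderiv_tensor (Γ := Γ) dC dn de dn df (l x)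
    rw [fderiv_eq_zero_of_mem h.lc.isOpen hx (fun y hy => by
      rw [(k y hy).antisymm, (k y hy).antisymm', (h.neg y hy).left_perp _ _ _ (s.e_l y hy)
        (s.f_l y hy), neg_zero, neg_zero])] at t1
    rw [fderiv_eq_zero_of_mem h.lc.isOpen hx (fun y hy => (o y hy).2.1)] at t3
    change fderiv ℝ φ x (e x) = _ at t2
    simp [cottonNull, W, c.n_n, c.n_e, c.n_f, c.n_l, c.l_n, c.l_e, c.l_f, c.e_n, c.f_n, c.f_e,
      c.f_f, c.e_e, c.e_f, c.e_l, c.f_l, b] at bi t1 t2 t3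
    rw [hp, hq]
    linear_combination t1 + t2 + t3 + bi
  · have bi := h.lc.bianchi_weyl hx dC dn h.decomp (n x) (f x) (l x) (n x) (e x)
    have t1 := fderiv_tensor (Γ := Γ) dC df dl dn de (n x)
    have t2 := fderiv_tensor (Γ := Γ) dC dl dn dn de (f x)
    have t3 := fderiv_tensor (Γ := Γ) dC dn df dn de (l x)
    rw [fderiv_eq_zero_of_mem h.lc.isOpen hx (fun y hy => by
      rw [(k y hy).antisymm, (k y hy).antisymm', (h.neg y hy).left_perp _ _ _ (s.f_l y hy)
        (s.e_l y hy), neg_zero, neg_zero])] at t1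
    rw [fderiv_eq_zero_of_mem h.lc.isOpen hx (fun y hy => (o y hy).2.2.1)] at t3
    change fderiv ℝ ψ x (f x) = _ at t2
    simp [cottonNull, W, c.n_n, c.n_e, c.n_f, c.n_l, c.l_n, c.l_e, c.l_f, c.e_n, c.f_n, c.f_e,
      c.f_f, c.e_e, c.e_f, c.e_l, c.f_l, b] at bi t1 t2 t3
    rw [hp, hq]
    linear_combination t1 + t2 + t3 + bi

end IsScreenFrameOn

end FourDimWeyl


/-! ### Dimension four: the integrability condition `10 ψ² = 0` -/

section FourDimRicci

set_option maxSynthPendingDepth 3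
set_option linter.unusedSectionVars false
set_option linter.unusedSimpArgs false

variable {V : Type*} [NormedAddCommGroup V] [NormedSpace ℝ V]

variable [FiniteDimensional ℝ V] {U : Set V} {B : V → V →L[ℝ] V →L[ℝ] ℝ}
  {Γ : V → V →L[ℝ] V →L[ℝ] V} {C : V → V →L[ℝ] V →L[ℝ] V →L[ℝ] V →L[ℝ] ℝ} {l n : V → V} {ε μ : ℝ}
  {x : V} {e f : V → V}

lemma cov_neg_right (Y : V → V) (x e : V) : cov Γ Y x (- e) = - cov Γ Y x e := by
  simp [cov]; abel

namespace IsScreenFrameOn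

variable (s : IsScreenFrameOn U B l n e f) (h : IsTransverseOn 4 U B Γ C l n ε μ) (hx : x ∈ U)
include s h hx

/-- The Ricci identities for `n`. -/
lemma ricci_n (c : ScreenConnection B Γ l n e f x) :
    let ψ := C x (l x) (n x) (n x) (e x)
    let a := fun y => B y (cov Γ n y (e y)) (l y)
    let b := fun y => B y (cov Γ n y (n y)) (l y)
    let t := fun y => B y (cov Γ n y (e y)) (f y)
    2 * (fderiv ℝ a x (n x) - c.sn * c.af) =
      ψ - c.β * c.τe - c.α * c.τf + 2 * c.β * c.ae + 2 * c.α * c.af ∧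
    fderiv ℝ a x (n x) - c.sn * c.af = ψ - 2 * c.β * c.τe + c.α * c.τf - c.α * c.af
      + fderiv ℝ b x (e x) ∧
    - fderiv ℝ b x (e x) - fderiv ℝ t x (f x) + 5 * c.α * c.af + c.β * c.ae = ψ := by
  intro ψ a b t
  have g := s.products h hx
  have dl := h.diff_l hx
  have dn := h.diff_n hx
  have de := s.diff_e h hx
  have df := s.diff_f h hx
  obtain ⟨p, hp⟩ : ∃ p, ψ = p := ⟨_, rfl⟩
  obtain ⟨q, hq⟩ : ∃ q, C x (l x) (n x) (n x) (f x) = q := ⟨_, rfl⟩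
  have W := s.weyl_formula h hx hp hq
  simp only at W
  have hn := h.contDiffAt_n hx
  have da : DifferentiableAt ℝ a x :=
    ((h.lc.diff_metric hx).clm_apply (h.lc.diff_cov hx hn de)).clm_apply dl
  have db : DifferentiableAt ℝ b x :=
    ((h.lc.diff_metric hx).clm_apply (h.lc.diff_cov hx hn dn)).clm_apply dl
  rw [hp]
  refine ⟨?_, ?_, ?_⟩
  -- The plane of `n` and `l`, paired with `e`. By `cov_n_along_l` the differentiated function is
  -- `2a`, which gives a second expression for the derivative of `a` along `n` besides the plane of
  -- `n` and `e`.
  · have r := h.lc.ricci_scalar hx hn dn dl de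
    rw [fderiv_congr_of_mem (g := fun y => 2 * a y) h.lc.isOpen hx
      (fun y hy => h.cov_n_along_l hy (s.e_n y hy) (s.e_l y hy)), fderiv_const_mul da,
      fderiv_eq_zero_of_mem h.lc.isOpen hx (fun y hy => h.cov_n_along_n hy (s.e_n y hy)),
      h.decomp x hx] at r
    simp [W, c.n_n, c.n_e, c.n_f, c.n_l, c.l_n, c.e_n, c.e_l, cov_add_right, cov_sub_right,
      cov_smul_right, cov_neg_right, g] at r
    linear_combination r
  · have r := h.lc.ricci_scalar hx hn dn de dl
    rw [h.decomp x hx] at r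
    change fderiv ℝ a x _ - _ - (fderiv ℝ b x _ - _) - _ = _ at r
    simp [W, c.n_n, c.n_e, c.n_f, c.n_l, c.l_n, c.e_n, c.l_e, cov_add_right, cov_sub_right,
      cov_smul_right, cov_neg_right, g] at r
    linear_combination r
  · have r := h.lc.ricci_scalar hx hn de df df
    rw [h.decomp x hx, fderiv_congr_of_mem (g := fun y => - b y) h.lc.isOpen hx
      (fun y hy => s.swap.cov_n_ee h hy)] at r
    change fderiv ℝ (fun y => - b y) x _ - _ - (fderiv ℝ t x _ - _) - _ = _ at r
    rw [fderiv_fun_neg] at r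
    simp [W, c.n_n, c.n_e, c.n_f, c.n_l, c.f_f, c.f_e, c.e_f, cov_add_right, cov_sub_right,
      cov_smul_right, cov_neg_right, g] at r
    linear_combination r

lemma contDiffOn_psi : ContDiffOn ℝ ∞ (fun y => C y (l y) (n y) (n y) (e y)) U :=
  (((h.smooth_C.clm_apply h.smooth_l).clm_apply h.smooth_n).clm_apply h.smooth_n).clm_apply
    s.smooth_e

/-- The covariant derivative of the vector field `v = ψ e + φ f`. -/
lemma cov_psi (u : V) : 
    let ψ := fun y => C y (l y) (n y) (n y) (e y)
    let φ := fun y => C y (l y) (n y) (n y) (f y)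
    cov Γ (fun y => ψ y • e y + φ y • f y) x u = fderiv ℝ ψ x u • e x + ψ x • cov Γ e x u
      + fderiv ℝ φ x u • f x + φ x • cov Γ f x u := by
  intro ψ φ
  have de := (s.diff_e h hx).hasFDerivAt
  have df := (s.diff_f h hx).hasFDerivAt
  have dψ : HasFDerivAt ψ (fderiv ℝ ψ x) x := (((s.contDiffOn_psi h hx).contDiffAt
    (h.lc.isOpen.mem_nhds hx)).differentiableAt (by simp)).hasFDerivAt
  have dφ : HasFDerivAt φ (fderiv ℝ φ x) x := (((s.swap.contDiffOn_psi h hx).contDiffAt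
    (h.lc.isOpen.mem_nhds hx)).differentiableAt (by simp)).hasFDerivAt
  simp only [cov]
  erw [((dψ.smul de).add (dφ.smul df)).fderiv]
  simp
  module

set_option maxHeartbeats 1000000 in
-- The Bianchi equations express `∇_n v` on the screen, and the difference `∇_e v · e - ∇_f v · f`,
-- algebraically through `v` and `∇n`, where `v = ψ e + φ f`. The Ricci identity for `v` in the
-- planes `(n, e)` and `(n, f)` is the integrability condition of these equations; the derivatives
-- of the coefficients of `∇n` in it are removed by the Ricci identities for `n`. As `φ` is only
-- assumed zero at `x`, its derivatives are retained.
lemma psi_eq_zero (hφ : C x (l x) (n x) (n x) (f x) = 0) : C x (l x) (n x) (n x) (e x) = 0 := by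
  set ψ := fun y => C y (l y) (n y) (n y) (e y) with hψ
  set φ := fun y => C y (l y) (n y) (n y) (f y) with hφ'
  set v := fun y => ψ y • e y + φ y • f y with hv
  set a := fun y => B y (cov Γ n y (e y)) (l y) with ha
  set a' := fun y => B y (cov Γ n y (f y)) (l y) with ha'
  set b := fun y => B y (cov Γ n y (n y)) (l y) with hb
  set t := fun y => B y (cov Γ n y (e y)) (f y) with ht
  have g := s.products h hx
  have dl := h.diff_l hx
  have dn := h.diff_n hx
  have de := s.diff_e h hx
  have df := s.diff_f h hx
  have hn := h.contDiffAt_n hx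
  have cψ : ContDiffAt ℝ ∞ ψ x := (s.contDiffOn_psi h hx).contDiffAt (h.lc.isOpen.mem_nhds hx)
  have cφ : ContDiffAt ℝ ∞ φ x := (s.swap.contDiffOn_psi h hx).contDiffAt (h.lc.isOpen.mem_nhds hx)
  have cv : ContDiffAt ℝ ∞ v x :=
    (cψ.smul (s.smooth_e.contDiffAt (h.lc.isOpen.mem_nhds hx))).add
      (cφ.smul (s.smooth_f.contDiffAt (h.lc.isOpen.mem_nhds hx)))
  have dψ : DifferentiableAt ℝ ψ x := cψ.differentiableAt (by simp)
  have dφ : DifferentiableAt ℝ φ x := cφ.differentiableAt (by simp)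
  have hB := h.lc.diff_metric hx
  have da : DifferentiableAt ℝ a x := (hB.clm_apply (h.lc.diff_cov hx hn de)).clm_apply dl
  have da' : DifferentiableAt ℝ a' x := (hB.clm_apply (h.lc.diff_cov hx hn df)).clm_apply dl
  have db : DifferentiableAt ℝ b x := (hB.clm_apply (h.lc.diff_cov hx hn dn)).clm_apply dl
  have dt : DifferentiableAt ℝ t x := (hB.clm_apply (h.lc.diff_cov hx hn de)).clm_apply df
  have c := s.connection h hx
  have Pe : ∀ y ∈ U, ∀ u, B y (cov Γ v y u) (e y) = fderiv ℝ ψ y u - B y (cov Γ e y u) (f y) * φ y := by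
    intro y hy u
    rw [hv, s.cov_psi h hy u]
    have c1 := s.cov_f_e h hy u
    have gy := s.products h hy
    have c2 : B y (cov Γ e y u) (e y) = 0 := by
      rw [s.cov_e_eq h hy u]; simp [gy]
    simp [c1, c2, gy]
    ring
  have Pf : ∀ y ∈ U, ∀ u, B y (cov Γ v y u) (f y) = fderiv ℝ φ y u + B y (cov Γ e y u) (f y) * ψ y := by
    intro y hy u
    rw [hv, s.cov_psi h hy u]
    have gy := s.products h hy
    have c2 : B y (cov Γ f y u) (f y) = 0 := by
      rw [s.cov_f_eq h hy u]; simp [gy]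
    simp [c2, gy]
    ring
  have dP : ∀ {Y W : V → V}, DifferentiableAt ℝ Y x → DifferentiableAt ℝ W x →
      DifferentiableAt ℝ (fun y => B y (cov Γ v y (Y y)) (W y)) x := fun dY dW =>
    (hB.clm_apply (h.lc.diff_cov hx cv dY)).clm_apply dW
  have Pdiff : fderiv ℝ (fun y => B y (cov Γ v y (e y)) (e y)) x (n x)
      - fderiv ℝ (fun y => B y (cov Γ v y (f y)) (f y)) x (n x)
      = 9 * (fderiv ℝ a x (n x) * ψ x + a x * fderiv ℝ ψ x (n x)
        - fderiv ℝ a' x (n x) * φ x - a' x * fderiv ℝ φ x (n x)) := by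
    have k := congrArg (fun F => F (n x)) (fderiv_congr_of_mem
      (f := fun y => B y (cov Γ v y (e y)) (e y) - B y (cov Γ v y (f y)) (f y))
      (g := fun y => 9 * (a y * ψ y - a' y * φ y)) h.lc.isOpen hx (fun y hy => by
        have ts := s.transport_screen h hy (s.connection h hy)
        rw [Pe y hy, Pf y hy]
        simp only [connection] at ts
        linear_combination ts.1 - ts.2.1))
    rw [fderiv_fun_sub (dP de de) (dP df df), fderiv_const_mul ((da.fun_mul dψ).fun_sub (da'.fun_mul dφ)),
      fderiv_fun_sub (da.fun_mul dψ) (da'.fun_mul dφ), fderiv_fun_mul da dψ, fderiv_fun_mul da' dφ] at k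
    simp at k
    linear_combination k
  have Pne : fderiv ℝ (fun y => B y (cov Γ v y (n y)) (e y)) x (e x) =
      5 * (fderiv ℝ b x (e x) * ψ x + b x * fderiv ℝ ψ x (e x))
      + 4 * (fderiv ℝ t x (e x) * φ x + t x * fderiv ℝ φ x (e x)) := by
    rw [fderiv_congr_of_mem (g := fun y => 5 * (b y * ψ y) + 4 * (t y * φ y)) h.lc.isOpen hx
      (fun y hy => by
        have ts := s.transport_n h hy (s.connection h hy)
        rw [Pe y hy]
        simp only [connection] at ts
        linear_combination ts.1),
      fderiv_fun_add ((db.fun_mul dψ).const_mul 5) ((dt.fun_mul dφ).const_mul 4),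
      fderiv_const_mul (db.fun_mul dψ), fderiv_const_mul (dt.fun_mul dφ), fderiv_fun_mul db dψ,
      fderiv_fun_mul dt dφ]
    simp
    ring
  have Pnf : fderiv ℝ (fun y => B y (cov Γ v y (n y)) (f y)) x (f x) =
      5 * (fderiv ℝ b x (f x) * φ x + b x * fderiv ℝ φ x (f x))
      - 4 * (fderiv ℝ t x (f x) * ψ x + t x * fderiv ℝ ψ x (f x)) := by
    rw [fderiv_congr_of_mem (g := fun y => 5 * (b y * φ y) - 4 * (t y * ψ y)) h.lc.isOpen hx
      (fun y hy => by
        have ts := s.transport_n h hy (s.connection h hy)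
        rw [Pf y hy]
        simp only [connection] at ts
        linear_combination ts.2),
      fderiv_fun_sub ((db.fun_mul dφ).const_mul 5) ((dt.fun_mul dψ).const_mul 4),
      fderiv_const_mul (db.fun_mul dφ), fderiv_const_mul (dt.fun_mul dψ), fderiv_fun_mul db dφ,
      fderiv_fun_mul dt dψ]
    simp
    ring
  have r1 := h.lc.ricci_scalar hx cv dn de de
  have r2 := h.lc.ricci_scalar hx cv dn df df
  obtain ⟨p, hp⟩ : ∃ p, ψ x = p := ⟨_, rfl⟩
  have W := s.weyl_formula h hx hp hφ
  simp only at W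
  have covv : ∀ u, cov Γ v x u = fderiv ℝ ψ x u • e x + ψ x • cov Γ e x u
      + fderiv ℝ φ x u • f x + φ x • cov Γ f x u := s.cov_psi h hx
  have tn : fderiv ℝ ψ x (n x) - c.sn * φ x = _ ∧ fderiv ℝ φ x (n x) + c.sn * ψ x = _ :=
    s.transport_n h hx c
  have ts : fderiv ℝ ψ x (e x) - c.se * φ x = _ ∧ fderiv ℝ φ x (f x) + c.sf * ψ x = _ ∧
    fderiv ℝ φ x (e x) + c.se * ψ x = _ ∧ fderiv ℝ ψ x (f x) - c.sf * φ x = _ :=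
    s.transport_screen h hx c
  have rn := s.ricci_n h hx c
  have hφx : φ x = 0 := hφ
  have hax : a x = c.ae := by simp [ha, c.n_e, g]
  have hax' : a' x = c.af := by simp [ha', c.n_f, g]
  have hbx : b x = c.β := by simp [hb, c.n_n, g]
  have htx : t x = c.α := by simp [ht, c.n_e, g]
  rw [← hψ, ← hφ', hp, hφx] at tn ts
  simp only [← ha, ← hb, ← ht] at rn
  have hpx : C x (l x) (n x) (n x) (e x) = p := hp
  rw [hpx] at rn ⊢
  rw [hax, hax', hp, hφx] at Pdiff
  rw [hbx, htx, hp, hφx] at Pne Pnf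
  have tn1 := eq_add_of_sub_eq tn.1
  have tn2 := eq_sub_of_add_eq tn.2
  have ts1 := eq_add_of_sub_eq ts.1
  have ts2 := eq_sub_of_add_eq ts.2.1
  have ts3 := eq_sub_of_add_eq ts.2.2.1
  have ts4 := eq_add_of_sub_eq ts.2.2.2
  rw [Pne, h.decomp x hx] at r1
  rw [Pnf, h.decomp x hx] at r2
  have hvx : v x = p • e x := by simp [hv, hp, hφx]
  simp [covv, hvx, W, hp, hφx, c.n_n, c.n_e, c.n_f, c.l_n, c.l_e, c.l_f, c.e_n, c.e_e, c.e_f,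
    c.f_n, c.f_e, c.f_f, cov_add_right, cov_sub_right, cov_smul_right, cov_neg_right, g] at r1 r2
  rw [tn1, tn2] at Pdiff
  rw [ts1, ts3, ts4, tn1, tn2] at r1
  rw [ts2, ts3, ts4, tn1, tn2] at r2
  -- The difference of the two Ricci identities for `v`, with multiples of those for `n` that cancel
  -- the derivatives of `a`, `b` and `t`; all connection coefficients cancel too.
  have key : 10 * p ^ 2 = 0 := by
    linear_combination r1 - r2 - Pdiff - 4 * p * rn.1 - p * rn.2.1 - 4 * p * rn.2.2
  simpa using key

end IsScreenFrameOn

lemma IsLeviCivitaOn.mono {W : Set V} (h : IsLeviCivitaOn U B Γ) (hW : IsOpen W) (hWU : W ⊆ U) :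
    IsLeviCivitaOn W B Γ where
  isOpen := hW
  smooth_metric := h.smooth_metric.mono hWU
  smooth_conn := h.smooth_conn.mono hWU
  symm y hy := h.symm y (hWU hy)
  nondeg y hy := h.nondeg y (hWU hy)
  torsion y hy := h.torsion y (hWU hy)
  compat y hy := h.compat y (hWU hy)

lemma IsTransverseOn.mono {d : ℕ} {W : Set V} (h : IsTransverseOn d U B Γ C l n ε μ)
    (hW : IsOpen W) (hWU : W ⊆ U) : IsTransverseOn d W B Γ C l n ε μ where
  lc := h.lc.mono hW hWU
  dim_ge := h.dim_ge
  dim_eq := h.dim_eq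
  smooth_C := h.smooth_C.mono hWU
  smooth_l := h.smooth_l.mono hWU
  smooth_n := h.smooth_n.mono hWU
  eps_ne := h.eps_ne
  decomp y hy := h.decomp y (hWU hy)
  traceless y hy := h.traceless y (hWU hy)
  neg y hy := h.neg y (hWU hy)
  frame y hy := h.frame y (hWU hy)

/-- Two orthonormal screen vectors at a point extend to a screen frame on a neighbourhood. -/
lemma IsTransverseOn.exists_screenFrame {d : ℕ} (h : IsTransverseOn d U B Γ C l n ε μ) (hx : x ∈ U)
    {u v : V} (hu : B x u u = 1) (hv : B x v v = 1) (huv : B x u v = 0) (hul : B x u (l x) = 0)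
    (hun : B x u (n x) = 0) (hvl : B x v (l x) = 0) (hvn : B x v (n x) = 0) :
    ∃ (W : Set V) (e f : V → V), IsOpen W ∧ x ∈ W ∧ W ⊆ U ∧ IsScreenFrameOn W B l n e f ∧
      e x = u ∧ f x = v := by
  obtain ⟨X, Xx, sX, Xl, Xn, -, -⟩ := h.exists_screen_extension hx hul hun
  obtain ⟨Y, Yx, sY, Yl, Yn, -, -⟩ := h.exists_screen_extension hx hvl hvn
  have hB := h.lc.smooth_metric
  have sXX : ContDiffOn ℝ ∞ (fun y => B y (X y) (X y)) U := (hB.clm_apply sX).clm_apply sX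
  set W1 := U ∩ (fun y => B y (X y) (X y)) ⁻¹' Set.Ioi 0 with hW1
  have oW1 : IsOpen W1 := sXX.continuousOn.isOpen_inter_preimage h.lc.isOpen isOpen_Ioi
  have W1U : W1 ⊆ U := Set.inter_subset_left
  set e : V → V := fun y => (Real.sqrt (B y (X y) (X y)))⁻¹ • X y with he
  have pos1 : ∀ y ∈ W1, 0 < B y (X y) (X y) := fun y hy => hy.2
  have se : ContDiffOn ℝ ∞ e W1 :=
    (((sXX.mono W1U).sqrt (fun y hy => (pos1 y hy).ne')).inv
      (fun y hy => (Real.sqrt_pos.2 (pos1 y hy)).ne')).smul (sX.mono W1U)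
  set Z : V → V := fun y => Y y - B y (Y y) (e y) • e y with hZ
  have sZ : ContDiffOn ℝ ∞ Z W1 := (sY.mono W1U).sub
    ((((hB.mono W1U).clm_apply (sY.mono W1U)).clm_apply se).smul se)
  have sZZ : ContDiffOn ℝ ∞ (fun y => B y (Z y) (Z y)) W1 :=
    ((hB.mono W1U).clm_apply sZ).clm_apply sZ
  set W := W1 ∩ (fun y => B y (Z y) (Z y)) ⁻¹' Set.Ioi 0 with hW
  have oW : IsOpen W := sZZ.continuousOn.isOpen_inter_preimage oW1 isOpen_Ioi
  have WW1 : W ⊆ W1 := Set.inter_subset_left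
  have WU : W ⊆ U := WW1.trans W1U
  have pos2 : ∀ y ∈ W, 0 < B y (Z y) (Z y) := fun y hy => hy.2
  set f : V → V := fun y => (Real.sqrt (B y (Z y) (Z y)))⁻¹ • Z y with hf
  have ex : e x = u := by simp [he, Xx, hu]
  have Zx : Z x = v := by
    have : B x v u = 0 := by rw [h.lc.symm x hx]; exact huv
    simp [hZ, ex, Yx, this]
  have xW : x ∈ W := ⟨⟨hx, by simp [Xx, hu]⟩, by simp [Zx, hv]⟩
  have unit : ∀ {r : ℝ}, 0 < r → (Real.sqrt r)⁻¹ * ((Real.sqrt r)⁻¹ * r) = 1 := by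
    intro r hr
    have := Real.sq_sqrt hr.le
    have h0 := (Real.sqrt_pos.2 hr).ne'
    field_simp
    linarith
  have ee : ∀ y ∈ W1, B y (e y) (e y) = 1 := by
    intro y hy
    simp only [he, map_smul, smul_apply, smul_eq_mul]
    exact unit (pos1 y hy)
  have Ze : ∀ y ∈ W1, B y (Z y) (e y) = 0 := by
    intro y hy
    simp [hZ, ee y hy]
  have fe : ∀ y ∈ W1, B y (f y) (e y) = 0 := by
    intro y hy
    simp only [hf, map_smul, smul_apply, smul_eq_mul, Ze y hy, mul_zero]
  have el : ∀ y ∈ W1, B y (e y) (l y) = 0 := by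
    intro y hy; simp [he, Xl y (W1U hy)]
  have en : ∀ y ∈ W1, B y (e y) (n y) = 0 := by
    intro y hy; simp [he, Xn y (W1U hy)]
  refine ⟨W, e, f, oW, xW, WU, ⟨se.mono WW1, ?_, fun y hy => ee y (WW1 hy), ?_, ?_,
    fun y hy => fe y (WW1 hy), fun y hy => el y (WW1 hy), fun y hy => en y (WW1 hy), ?_, ?_⟩, ex, ?_⟩
  · exact (((sZZ.mono WW1).sqrt (fun y hy => (pos2 y hy).ne')).inv
      (fun y hy => (Real.sqrt_pos.2 (pos2 y hy)).ne')).smul (sZ.mono WW1)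
  · intro y hy
    simp only [hf, map_smul, smul_apply, smul_eq_mul]
    exact unit (pos2 y hy)
  · intro y hy
    rw [h.lc.symm y (WU hy)]
    exact fe y (WW1 hy)
  · intro y hy
    simp [hf, hZ, Yl y (WU hy), el y (WW1 hy)]
  · intro y hy
    simp [hf, hZ, Yn y (WU hy), en y (WW1 hy)]
  · simp [hf, Zx, hv]

/-- In dimension four a transverse configuration is conformally flat. -/
theorem IsTransverseOn.weyl_eq_zero_of_four (h : IsTransverseOn 4 U B Γ C l n ε μ) (hx : x ∈ U) :
    C x = 0 := by
  obtain ⟨m, hm⟩ := h.frame x hx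
  have p := h.frame_perp hx hm
  have hmm : ∀ i j : Fin 2, B x (m i) (m j) = if i = j then 1 else 0 := hm.m_m
  -- Cosine and sine of the rotation of the screen that takes the first vector in the direction of
  -- `(ψ, φ)`, so that `φ = 0` at `x`.
  obtain ⟨c, t, h1, h2⟩ : ∃ c t : ℝ, c ^ 2 + t ^ 2 = 1 ∧
      c * C x (l x) (n x) (n x) (m (1 : Fin 2)) = t * C x (l x) (n x) (n x) (m (0 : Fin 2)) := by
    generalize C x (l x) (n x) (n x) (m (1 : Fin 2)) = b
    generalize C x (l x) (n x) (n x) (m (0 : Fin 2)) = a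
    by_cases h0 : a ^ 2 + b ^ 2 = 0
    · refine ⟨1, 0, by norm_num, ?_⟩
      have : b = 0 := by nlinarith [sq_nonneg a, sq_nonneg b]
      simp [this]
    · have hpos : 0 < a ^ 2 + b ^ 2 := lt_of_le_of_ne (by positivity) (Ne.symm h0)
      have hs := Real.sq_sqrt hpos.le
      have hs0 := (Real.sqrt_pos.2 hpos).ne'
      refine ⟨a / Real.sqrt (a ^ 2 + b ^ 2), b / Real.sqrt (a ^ 2 + b ^ 2), ?_, ?_⟩
      · rw [div_pow, div_pow, hs]; field_simp
      · ring
  obtain ⟨W, e, f, oW, xW, WU, s, ex, fx⟩ := h.exists_screenFrame hx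
    (u := c • m (0 : Fin 2) + t • m (1 : Fin 2)) (v := - t • m (0 : Fin 2) + c • m (1 : Fin 2))
    (by simp [hmm]; linear_combination h1) (by simp [hmm]; linear_combination h1)
    (by simp [hmm]; ring) (by simp [(p _).1]) (by simp [(p _).2]) (by simp [(p _).1])
    (by simp [(p _).2])
  have h' := h.mono oW WU
  have hφ : C x (l x) (n x) (n x) (f x) = 0 := by
    rw [fx]; simp; linear_combination h2
  have hψ := s.psi_eq_zero h' xW hφ
  ext u v w z
  rw [s.weyl_formula h' xW hψ hφ]
  simp

end FourDimRicci


/-! ### Algebra of tensors of negative boost order: uniqueness of the WAND and the trace pairing -/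

section Algebraic

set_option maxSynthPendingDepth 3
set_option linter.unusedSectionVars false

variable {V : Type*} [NormedAddCommGroup V] [NormedSpace ℝ V]

/-- A rank-three tensor antisymmetric in its last two indices is determined by its square. -/
lemma eq_zero_of_square_eq {ι : Type*} [Fintype ι] [DecidableEq ι] {Ψ : ι → ι → ι → ℝ} {ψ : ι → ℝ}
    (hanti : ∀ i j k, Ψ i j k = - Ψ i k j) (hψ : ∀ i, ψ i = ∑ j, Ψ j j i)
    (hW : ∀ i j, ∑ k, ∑ r, Ψ i k r * Ψ j k r = 2 * (ψ i * ψ j)) (i j k : ι) : Ψ i j k = 0 := by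
  have key : ∀ u : ι → ℝ, ∑ k, ∑ r, (∑ j, u j * Ψ j k r) ^ 2 = 2 * (∑ j, u j * ψ j) ^ 2 := by
    intro u
    have : ∀ k r, (∑ j, u j * Ψ j k r) ^ 2 = ∑ i, ∑ j, u i * u j * (Ψ i k r * Ψ j k r) := by
      intro k r
      rw [sq, Finset.sum_mul_sum]
      exact Finset.sum_congr rfl (fun i _ => Finset.sum_congr rfl (fun j _ => by ring))
    simp only [this]
    calc ∑ k, ∑ r, ∑ i, ∑ j, u i * u j * (Ψ i k r * Ψ j k r)
        = ∑ i, ∑ j, u i * u j * ∑ k, ∑ r, Ψ i k r * Ψ j k r := by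
          simp only [Finset.mul_sum]
          rw [Finset.sum_congr rfl (fun k _ => Finset.sum_comm), Finset.sum_comm]
          refine Finset.sum_congr rfl (fun i _ => ?_)
          rw [Finset.sum_congr rfl (fun k _ => Finset.sum_comm), Finset.sum_comm]
      _ = 2 * (∑ j, u j * ψ j) ^ 2 := by
          simp only [hW]
          rw [sq, Finset.sum_mul_sum, Finset.mul_sum]
          refine Finset.sum_congr rfl (fun i _ => ?_)
          rw [Finset.mul_sum]
          exact Finset.sum_congr rfl (fun j _ => by ring)
  -- For `u` orthogonal to `ψ` the identity `key` is a vanishing sum of real squares.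
  have van : ∀ u : ι → ℝ, ∑ j, u j * ψ j = 0 → ∀ k r, ∑ j, u j * Ψ j k r = 0 := by
    intro u hu k r
    have h1 := key u
    rw [hu] at h1
    have h2 : ∑ k, ∑ r, (∑ j, u j * Ψ j k r) ^ 2 = 0 := by rw [h1]; ring
    rw [Finset.sum_eq_zero_iff_of_nonneg (fun k _ => Finset.sum_nonneg (fun r _ => sq_nonneg _))]
      at h2
    have h3 := h2 k (Finset.mem_univ k)
    rw [Finset.sum_eq_zero_iff_of_nonneg (fun r _ => sq_nonneg _)] at h3
    exact pow_eq_zero_iff (two_ne_zero) |>.1 (h3 r (Finset.mem_univ r))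
  set S := ∑ j, ψ j * ψ j with hS
  set G := fun k r => ∑ j, ψ j * Ψ j k r with hG
  have hSΨ : ∀ i k r, S * Ψ i k r = ψ i * G k r := by
    intro i k r
    -- The `i`-th basis vector times `|ψ|²`, minus its component along `ψ`, is orthogonal to `ψ`.
    have := van (fun j => S * (if j = i then 1 else 0) - ψ i * ψ j) (by
      simp only [sub_mul, Finset.sum_sub_distrib, mul_assoc, ← Finset.mul_sum]
      simp
      rw [← hS]; ring) k r
    simp only [sub_mul, Finset.sum_sub_distrib, mul_assoc, ← Finset.mul_sum] at this
    simp at this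
    linarith
  have hSψ : ∀ k, S * ψ k = ∑ j, ψ j * G j k := by
    intro k
    rw [hψ, Finset.mul_sum]
    exact Finset.sum_congr rfl (fun j _ => hSΨ j j k)
  have hGanti : ∀ j k, G j k = - G k j := by
    intro j k
    simp only [hG]
    rw [← Finset.sum_neg_distrib]
    exact Finset.sum_congr rfl (fun i _ => by rw [hanti]; ring)
  -- Tracing `S Ψ = ψ ⊗ G` and contracting with `ψ` gives `S² = G(ψ, ψ)`, which is zero because `G`
  -- is antisymmetric.
  have hS2 : S * S = 0 := by
    have h1 : S * S = ∑ k, ∑ j, ψ j * ψ k * G j k := by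
      conv_lhs => rw [hS]
      rw [Finset.sum_mul]
      refine Finset.sum_congr rfl (fun k _ => ?_)
      rw [mul_assoc, mul_comm (ψ k) S, hSψ, Finset.mul_sum]
      exact Finset.sum_congr rfl (fun j _ => by ring)
    have h2 : ∑ k, ∑ j, ψ j * ψ k * G j k = - ∑ k, ∑ j, ψ j * ψ k * G j k := by
      conv_lhs => rw [Finset.sum_comm]
      rw [← Finset.sum_neg_distrib]
      refine Finset.sum_congr rfl (fun k _ => ?_)
      rw [← Finset.sum_neg_distrib]
      exact Finset.sum_congr rfl (fun j _ => by rw [hGanti]; ring)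
    linarith
  have hS0 : S = 0 := mul_self_eq_zero.1 hS2
  have hψ0 : ∀ j, ψ j = 0 := by
    rw [hS, Finset.sum_eq_zero_iff_of_nonneg (fun j _ => mul_self_nonneg _)] at hS0
    exact fun j => mul_self_eq_zero.1 (hS0 j (Finset.mem_univ j))
  have := van (fun r => if r = i then 1 else 0) (by simp [hψ0]) j k
  simpa using this

variable [FiniteDimensional ℝ V] {d : ℕ} {b : V →L[ℝ] V →L[ℝ] ℝ}
  {Q : V →L[ℝ] V →L[ℝ] V →L[ℝ] V →L[ℝ] ℝ} {l n k : V} {m : Fin (d - 2) → V}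

lemma neg_one_le_boostWeight (A : Fin 2 ⊕ Fin (d - 2)) : -1 ≤ boostWeight A := by
  rcases A with A | A
  · fin_cases A <;> simp [boostWeight]
  · simp [boostWeight]

namespace IsNullFrame

variable (hf : IsNullFrame d (fun u v => b u v) l n m) (hs : ∀ u v, b u v = b v u)
include hf hs

lemma weight_perp {X : V} (hX : b X l = 0) (A : Fin 2 ⊕ Fin (d - 2)) (hA : boostWeight A < 0) :
    b X (frameVec l n m (dualIndex A)) = 0 := by
  rcases A with A | A
  · fin_cases A
    · simp [boostWeight] at hA
    · simpa [dualIndex, frameVec] using hX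
  · simp [boostWeight] at hA

lemma weight_l (A : Fin 2 ⊕ Fin (d - 2)) (hA : boostWeight A < 1) :
    b l (frameVec l n m (dualIndex A)) = 0 := by
  have := hf.apply_dual hs (Sum.inl 0) A
  rw [if_neg (by rintro rfl; simp [boostWeight] at hA)] at this
  simpa [frameVec] using this

/-- A tensor of boost order at most `w` vanishes on vectors whose boost weights, bounded below, add
up to more than `w`. -/
lemma apply_eq_zero (hd : 2 ≤ d) (hdim : Module.finrank ℝ V = d) {w : ℤ}
    (hB : BoostOrderLE (fun u v w z => Q u v w z) l n m w) {X Y Z W : V} {w₁ w₂ w₃ w₄ : ℤ}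
    (h1 : ∀ A, boostWeight A < w₁ → b X (frameVec l n m (dualIndex A)) = 0)
    (h2 : ∀ A, boostWeight A < w₂ → b Y (frameVec l n m (dualIndex A)) = 0)
    (h3 : ∀ A, boostWeight A < w₃ → b Z (frameVec l n m (dualIndex A)) = 0)
    (h4 : ∀ A, boostWeight A < w₄ → b W (frameVec l n m (dualIndex A)) = 0)
    (hw : w < w₁ + w₂ + w₃ + w₄) : Q X Y Z W = 0 := by
  have ex : ∀ v : V, v = ∑ A, b v (frameVec l n m (dualIndex A)) • frameVec l n m A := by
    intro v
    conv_lhs => rw [← (hf.basis hs hd hdim).sum_repr v]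
    simp only [hf.basis_repr, hf.basis_apply]
  rw [ex X, ex Y, ex Z, ex W]
  simp only [map_sum, map_smul, sum_apply, smul_apply, smul_eq_mul]
  refine Finset.sum_eq_zero (fun A₄ _ => ?_)
  by_cases hA₄ : boostWeight A₄ < w₄
  · rw [h4 A₄ hA₄, zero_mul]
  refine mul_eq_zero_of_right _ (Finset.sum_eq_zero (fun A₃ _ => ?_))
  by_cases hA₃ : boostWeight A₃ < w₃
  · rw [h3 A₃ hA₃, zero_mul]
  refine mul_eq_zero_of_right _ (Finset.sum_eq_zero (fun A₂ _ => ?_))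
  by_cases hA₂ : boostWeight A₂ < w₂
  · rw [h2 A₂ hA₂, zero_mul]
  refine mul_eq_zero_of_right _ (Finset.sum_eq_zero (fun A₁ _ => ?_))
  by_cases hA₁ : boostWeight A₁ < w₁
  · rw [h1 A₁ hA₁, zero_mul]
  exact mul_eq_zero_of_right _ (hB A₁ A₂ A₃ A₄ (by omega))

/-- Boost-weight count: `l` contributes `1`, a vector orthogonal to `l` at least `0`, an arbitrary
one at least `-1`. This frees the vanishing conditions from the choice of `n` and `m`. -/
lemma hasNegBoost (hd : 2 ≤ d) (hdim : Module.finrank ℝ V = d)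
    (hB : BoostOrderLE (fun u v w z => Q u v w z) l n m (-1)) : HasNegBoost b Q l := by
  have any : ∀ (X : V) (A : Fin 2 ⊕ Fin (d - 2)), boostWeight A < -1 →
      b X (frameVec l n m (dualIndex A)) = 0 := by
    intro X A hA
    have := neg_one_le_boostWeight A
    omega
  have p := fun {X : V} => hf.weight_perp hs (X := X)
  have wl := hf.weight_l hs
  exact ⟨fun X Y Z W hX hY hZ hW =>
      hf.apply_eq_zero hs hd hdim hB (p hX) (p hY) (p hZ) (p hW) (by norm_num),
    fun X Y Z hX hY => hf.apply_eq_zero hs hd hdim hB wl (p hX) (p hY) (any Z) (by norm_num),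
    fun X Y Z hX hY => hf.apply_eq_zero hs hd hdim hB wl (any Z) (p hX) (p hY) (by norm_num),
    fun Z W => hf.apply_eq_zero hs hd hdim hB wl (any Z) wl (any W) (by norm_num)⟩

/-- A null vector orthogonal to `l` is a multiple of `l`. -/
lemma eq_smul_of_perp (hd : 2 ≤ d) (hdim : Module.finrank ℝ V = d) (hk : b k k = 0)
    (hkl : b k l = 0) : k = b k n • l := by
  have ex := hf.expand hs hd hdim k
  -- Without an `n`-part the square of `k` is the sum of squares of its screen components.
  have h0 : ∑ i, b k (m i) * b k (m i) = 0 := by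
    have : b k k = b k (b k n • l + b k l • n + ∑ i, b k (m i) • m i) := by rw [← ex]
    rw [hk, hkl] at this
    simpa [hkl] using this.symm
  rw [Finset.sum_eq_zero_iff_of_nonneg (fun i _ => mul_self_nonneg _)] at h0
  have h1 : ∀ i, b k (m i) = 0 := fun i => mul_self_eq_zero.1 (h0 i (Finset.mem_univ i))
  rw [hkl] at ex
  simpa [h1] using ex

/-- A null vector transverse to `l` belongs to a null frame that starts with a multiple of `l`. -/
lemma null_rotation (hk : b k k = 0) (hkl : b k l ≠ 0) :
    IsNullFrame d (fun u v => b u v) ((b k l)⁻¹ • l) k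
      (fun i => m i - (b k (m i) / b k l) • l) := by
  have h1 := hf.l_l
  have h2 := hf.l_m
  have h3 : ∀ i, b (m i) l = 0 := fun i => by rw [hs]; exact h2 i
  have h4 := hf.m_m
  have h5 : b l k = b k l := hs _ _
  refine ⟨by simp [h1], hk, by simp [h5, hkl], fun i => by simp [h1, h2], fun i => ?_,
    fun i j => by simp [h1, h2, h3, h4]⟩
  simp only [map_sub, map_smul, smul_eq_mul]
  field_simp
  ring

end IsNullFrame

lemma IsNullFrame.l_ne_zero (hf : IsNullFrame d (fun u v => b u v) l n m) : l ≠ 0 := by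
  rintro rfl
  simpa using hf.l_n

lemma HasNegBoost.smul (hn : HasNegBoost b Q l) {c : ℝ} (hc : c ≠ 0) : HasNegBoost b Q (c • l) := by
  have p : ∀ {X : V}, b X (c • l) = 0 → b X l = 0 := by
    intro X hX
    simpa [hc] using hX
  exact ⟨fun X Y Z W hX hY hZ hW => hn.perp _ _ _ _ (p hX) (p hY) (p hZ) (p hW),
    fun X Y Z hX hY => by simp [hn.left_perp _ _ Z (p hX) (p hY)],
    fun X Y Z hX hY => by simp [hn.right_perp _ _ Z (p hX) (p hY)],
    fun Z W => by simp [hn.left_left Z W]⟩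

/-- A nonzero trace-free tensor of negative boost order with respect to `l` has `l` as its only
multiple aligned null direction. -/
lemma HasNegBoost.eq_smul_of_isMultipleWAND (hn : HasNegBoost b Q l) (q : IsCurvatureLike Q)
    (hs : ∀ u v, b u v = b v u) (hd : 2 ≤ d) (hdim : Module.finrank ℝ V = d)
    (ht : ∀ u v, metricTrace b (slot Q u v) = 0) (hf : IsNullFrame d (fun u v => b u v) l n m)
    (hQ : Q ≠ 0) (hk : IsMultipleWAND d (fun u v => b u v) (fun u v w z => Q u v w z) k) :
    ∃ c : ℝ, c ≠ 0 ∧ k = c • l := by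
  obtain ⟨n', m', hf', hB⟩ := hk
  have hk0 := hf'.l_ne_zero
  by_cases hkl : b k l = 0
  · have e := hf.eq_smul_of_perp hs hd hdim hf'.l_l hkl
    refine ⟨_, fun h0 => hk0 ?_, e⟩
    rw [e, h0, zero_smul]
  · refine absurd ?_ hQ
    -- If `k` were transverse to `l`, it could serve as the second null vector of a frame starting
    -- with a multiple of `l`. Absence of positive weights with respect to `k` kills the components
    -- to which `HasNegBoost.eq_zero` reduces the tensor.
    have hfr := hf.null_rotation hs hf'.l_l hkl
    have p := fun {X : V} => hf'.weight_perp hs (X := X)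
    have van : ∀ X Y Z, b X k = 0 → b Y k = 0 → b Z k = 0 → Q k X Y Z = 0 := fun X Y Z hX hY hZ =>
      hf'.apply_eq_zero hs hd hdim hB (hf'.weight_l hs) (p hX) (p hY) (p hZ) (by norm_num)
    have pm := fun i => (hs _ _).trans (hfr.n_m i)
    exact (hn.smul (inv_ne_zero hkl)).eq_zero q hs hd hdim ht hfr
      (fun i j r => van _ _ _ (pm i) (pm j) (pm r)) (fun i j => van _ _ _ (pm i) hf'.l_l (pm j))

/-- In dimension three there is no nonzero trace-free tensor of negative boost order. -/
lemma HasNegBoost.eq_zero_of_three (hn : HasNegBoost b Q l) (q : IsCurvatureLike Q)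
    (hs : ∀ u v, b u v = b v u) (hd : d = 3) (hdim : Module.finrank ℝ V = d)
    (ht : ∀ u v, metricTrace b (slot Q u v) = 0) (hf : IsNullFrame d (fun u v => b u v) l n m) :
    Q = 0 := by
  subst hd
  have hsub : ∀ i j : Fin (3 - 2), i = j := fun i j => Subsingleton.elim (α := Fin 1) i j
  refine hn.eq_zero q hs (by norm_num) hdim ht hf (fun i j r => ?_) (fun i j => ?_)
  · rw [hsub r j, q.self_right]
  · have t := ht n n
    rw [hf.metricTrace_eq hs (by norm_num) hdim] at t
    have h1 : ∑ i, Q (m i) n (m i) n = Q (m i) n (m i) n :=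
      Fintype.sum_eq_single i (fun r hr => absurd (hsub r i) hr)
    simp only [slot_apply, q.self_left, q.self_right, h1] at t
    rw [hsub j i, q.antisymm, q.antisymm']
    linarith

/-- By `left_perp` one of the last two arguments may be arbitrary if the other is orthogonal to `l`.
Only their `n`-parts remain, and these cancel by antisymmetry. -/
lemma HasNegBoost.left_eq_zero (hn : HasNegBoost b Q l) (q : IsCurvatureLike Q) (hnl : b n l = 1)
    {X : V} (hX : b X l = 0) (u v : V) : Q l X u v = 0 := by
  have h1 : ∀ v, Q l X n v = 0 := by
    intro v
    have := hn.left_perp X (v - b v l • n) n hX (by simp [hnl])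
    rw [q.antisymm'] at this
    simpa [q.self_right] using this
  have := hn.left_perp X (u - b u l • n) v hX (by simp [hnl])
  simpa [h1] using this

/-- With weight `-1` absent, each `Q(u, v, ·, ·)` is a two-form `l ∧ φ` with `φ(l) = 0`: the shape
from which `IsNullRicciOn.apply_eq_zero` reads off `l`. -/
lemma HasNegBoost.right_eq_zero (hn : HasNegBoost b Q l) (q : IsCurvatureLike Q)
    (hs : ∀ u v, b u v = b v u) (hd : 2 ≤ d) (hdim : Module.finrank ℝ V = d)
    (ht : ∀ u v, metricTrace b (slot Q u v) = 0) (hf : IsNullFrame d (fun u v => b u v) l n m)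
    (h1 : ∀ i j k, Q n (m i) (m j) (m k) = 0) :
    (∀ u v w, Q u v w l = 0) ∧ ∀ u v X Y, b X l = 0 → b Y l = 0 → Q u v X Y = 0 := by
  obtain ⟨P1, ψ0⟩ := hn.weight_neg_one_eq_zero q hs hd hdim ht hf h1
  have hnl : b n l = 1 := by rw [hs]; exact hf.l_n
  have dec : ∀ v, ∃ (w : V) (c : ℝ), b w l = 0 ∧ v = w + c • n := fun v =>
    ⟨v - b v l • n, b v l, by simp [hnl], by simp⟩
  have second : ∀ u v X Y, b X l = 0 → b Y l = 0 → Q u v X Y = 0 := by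
    intro u v X Y hX hY
    obtain ⟨u, cu, hu, rfl⟩ := dec u
    obtain ⟨v, cv, hv, rfl⟩ := dec v
    have h2 : Q u n X Y = 0 := by rw [q.antisymm, P1 _ _ _ hu hX hY, neg_zero]
    simp [hn.perp _ _ _ _ hu hv hX hY, P1 _ _ _ hv hX hY, h2, q.self_left]
  refine ⟨fun u v w => ?_, second⟩
  obtain ⟨w, c, hw, rfl⟩ := dec w
  have h3 : Q l n u v = 0 := by
    obtain ⟨u, cu, hu, rfl⟩ := dec u
    obtain ⟨v, cv, hv, rfl⟩ := dec v
    have h2 : Q l n u n = 0 := by rw [q.antisymm', ψ0 _ hu, neg_zero]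
    simp [hn.right_perp _ _ _ hu hv, h2, ψ0 _ hv, q.self_right]
  have h4 : Q u v n l = 0 := by rw [q.pair, q.antisymm, h3, neg_zero]
  simp [second u v _ _ hw hf.l_l, h4]

/-- The endomorphism with matrix elements `b(F v, w) = Q(u, u', v, w)`. -/
def curvOp (b : V →L[ℝ] V →L[ℝ] ℝ) (Q : V →L[ℝ] V →L[ℝ] V →L[ℝ] V →L[ℝ] ℝ) (u u' : V) : V →L[ℝ] V :=
  b.inverse ∘L Q u u'

/-- The bilinear form `(v, w) ↦ tr (G ∘ F)`, where `F` is the endomorphism given by `Q(v, w, ·, ·)`. -/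
def tracePairing (b : V →L[ℝ] V →L[ℝ] ℝ) (Q : V →L[ℝ] V →L[ℝ] V →L[ℝ] V →L[ℝ] ℝ) (G : V →L[ℝ] V) :
    V →L[ℝ] V →L[ℝ] ℝ :=
  ContinuousLinearMap.compL ℝ V (V →L[ℝ] V →L[ℝ] ℝ) ℝ
    ((LinearMap.toContinuousLinearMap (LinearMap.trace ℝ V ∘ₗ ContinuousLinearMap.coeLM ℝ)) ∘L
      ContinuousLinearMap.compL ℝ V (V →L[ℝ] ℝ) V (G ∘L b.inverse)) ∘L Q

lemma tracePairing_apply (G : V →L[ℝ] V) (v w : V) :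
    tracePairing b Q G v w = LinearMap.trace ℝ V ((G ∘L curvOp b Q v w : V →L[ℝ] V) : V →ₗ[ℝ] V) :=
  rfl

lemma apply_curvOp (hb : ∀ u, (∀ v, b u v = 0) → u = 0) (u u' v w : V) :
    b (curvOp b Q u u' v) w = Q u u' v w := by
  simp [curvOp, apply_inverse hb]

lemma tracePairing_comm (u u' v w : V) :
    tracePairing b Q (curvOp b Q u u') v w = tracePairing b Q (curvOp b Q v w) u u' := by
  simp only [tracePairing_apply]
  exact LinearMap.trace_mul_comm ℝ ((curvOp b Q u u' : V →L[ℝ] V) : V →ₗ[ℝ] V)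
    ((curvOp b Q v w : V →L[ℝ] V) : V →ₗ[ℝ] V)

/-- Bivectors `Q(v, w, ·, ·)` of the form `l ∧ φ` are orthogonal to all `Q(u, u', ·, ·)`. -/
lemma HasNegBoost.tracePairing_eq_zero (hn : HasNegBoost b Q l) (q : IsCurvatureLike Q)
    (hs : ∀ u v, b u v = b v u) (hb : ∀ u, (∀ v, b u v = 0) → u = 0) (hnl : b n l = 1)
    (u u' : V) {v w : V} (h1 : ∀ X Y, b X l = 0 → b Y l = 0 → Q v w X Y = 0)
    (h2 : Q v w n l = 0) : tracePairing b Q (curvOp b Q u u') v w = 0 := by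
  set φ := b.inverse (Q v w n) with hφ
  have hφb : b φ = Q v w n := apply_inverse hb _
  have hφl : b φ l = 0 := by rw [hφb, h2]
  -- The operator of the bivector `l ∧ φ` has rank at most two, so its pairing with `Q(u, u', ·, ·)`
  -- is twice a component on `l` and `φ`. As `φ` is orthogonal to `l`, `left_eq_zero` applies.
  have e1 : ∀ x, curvOp b Q v w x = b x l • φ - b φ x • l := by
    intro x
    rw [← sub_eq_zero]
    refine hb _ (fun y => ?_)
    have h3 := h1 (x - b x l • n) (y - b y l • n) (by simp [hnl]) (by simp [hnl])
    simp [q.self_right, q.antisymm' v w x n] at h3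
    simp [apply_curvOp hb, hφb, hs l y]
    linarith
  have e2 : ((curvOp b Q u u' ∘L curvOp b Q v w : V →L[ℝ] V) : V →ₗ[ℝ] V) =
      ((b l : V →L[ℝ] ℝ) : V →ₗ[ℝ] ℝ).smulRight (curvOp b Q u u' φ)
        - ((b φ : V →L[ℝ] ℝ) : V →ₗ[ℝ] ℝ).smulRight (curvOp b Q u u' l) := by
    ext x
    simp [e1, hs l x]
  have h4 : Q u u' l φ = 0 := by
    rw [q.pair, hn.left_eq_zero q hnl hφl]
  rw [tracePairing_apply, e2, map_sub, LinearMap.trace_smulRight, LinearMap.trace_smulRight]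
  simp only [ContinuousLinearMap.coe_coe]
  rw [hs l, hs φ, apply_curvOp hb, apply_curvOp hb, q.antisymm', h4]
  simp

/-- The pairing of `Q(n, m_i, ·, ·)` with `Q(n, m_j, ·, ·)`. -/
lemma HasNegBoost.tracePairing_screen (hn : HasNegBoost b Q l) (q : IsCurvatureLike Q)
    (hs : ∀ u v, b u v = b v u) (hd : 2 ≤ d) (hdim : Module.finrank ℝ V = d)
    (hf : IsNullFrame d (fun u v => b u v) l n m) (i j : Fin (d - 2)) :
    tracePairing b Q (curvOp b Q n (m i)) n (m j) = 2 * (Q l n n (m i) * Q l n n (m j))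
      - ∑ k, ∑ r, Q n (m i) (m k) (m r) * Q n (m j) (m k) (m r) := by
  have hb := hf.nondeg hs hd hdim
  have hnl : b n l = 1 := by rw [hs]; exact hf.l_n
  have p : ∀ i, b (m i) l = 0 := fun i => by rw [hs]; exact hf.l_m i
  have e : tracePairing b Q (curvOp b Q n (m i)) n (m j)
      = metricTrace b (Q n (m i) ∘L curvOp b Q n (m j)) := rfl
  have z1 : ∀ u v k, Q u v l (m k) = 0 := fun u v k => by
    rw [q.pair, hn.left_eq_zero q hnl (p k)]
  have z2 : ∀ u v k, Q u v (m k) l = 0 := fun u v k => by rw [q.antisymm', z1, neg_zero]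
  have z3 : ∀ k, Q n (m k) l n = Q l n n (m k) := fun k => q.pair _ _ _ _
  have z4 : ∀ k, Q n (m k) n l = - Q l n n (m k) := fun k => by rw [q.antisymm', z3]
  have ex : ∀ u, curvOp b Q n (m j) u = Q n (m j) u n • l + Q n (m j) u l • n
      + ∑ r, Q n (m j) u (m r) • m r := by
    intro u
    conv_lhs => rw [hf.expand hs hd hdim (curvOp b Q n (m j) u)]
    simp only [apply_curvOp hb]
  rw [e, hf.metricTrace_eq hs hd hdim]
  simp only [ContinuousLinearMap.comp_apply, ex]
  simp only [map_add, map_smul, map_sum, add_apply, smul_apply, sum_apply, smul_eq_mul, z1, z2, z3,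
    z4, q.self_right, mul_zero, Finset.sum_const_zero, add_zero, zero_add, zero_mul]
  have s1 : ∑ k, ∑ r, Q n (m j) (m k) (m r) * Q n (m i) (m r) (m k) =
      - ∑ k, ∑ r, Q n (m i) (m k) (m r) * Q n (m j) (m k) (m r) := by
    rw [← Finset.sum_neg_distrib]
    refine Finset.sum_congr rfl (fun k _ => ?_)
    rw [← Finset.sum_neg_distrib]
    exact Finset.sum_congr rfl (fun r _ => by rw [q.antisymm' n (m i) (m r)]; ring)
  rw [s1]
  ring

/-- If the bivectors `Q(n, m_i, ·, ·)` are pairwise orthogonal and null, the components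
`Q(n, m_i, m_j, m_k)` vanish. -/
lemma HasNegBoost.eq_zero_of_tracePairing (hn : HasNegBoost b Q l) (q : IsCurvatureLike Q)
    (hs : ∀ u v, b u v = b v u) (hd : 2 ≤ d) (hdim : Module.finrank ℝ V = d)
    (ht : ∀ u v, metricTrace b (slot Q u v) = 0) (hf : IsNullFrame d (fun u v => b u v) l n m)
    (h0 : ∀ i j, tracePairing b Q (curvOp b Q n (m i)) n (m j) = 0) (i j k : Fin (d - 2)) :
    Q n (m i) (m j) (m k) = 0 := by
  refine eq_zero_of_square_eq (Ψ := fun i j k => Q n (m i) (m j) (m k))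
    (ψ := fun i => Q l n n (m i)) (fun i j k => q.antisymm' _ _ _ _) (fun i => ?_)
    (fun i j => ?_) i j k
  · have t := ht n (m i)
    rw [hf.metricTrace_eq hs hd hdim] at t
    simp only [slot_apply, q.self_left, fun j => q.antisymm (m j) n, Finset.sum_neg_distrib] at t
    linarith
  · have := h0 i j
    rw [hn.tracePairing_screen q hs hd hdim hf] at this
    linarith

end Algebraic


/-! ### Recovering a smooth principal null field, and alignment of `n` -/

section Alignment

set_option maxSynthPendingDepth 3
set_option linter.unusedSectionVars false

variable {V : Type*} [NormedAddCommGroup V] [NormedSpace ℝ V] [FiniteDimensional ℝ V] {d : ℕ}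
  {U : Set V} {B : V → V →L[ℝ] V →L[ℝ] ℝ} {Γ : V → V →L[ℝ] V →L[ℝ] V}
  {C : V → V →L[ℝ] V →L[ℝ] V →L[ℝ] V →L[ℝ] ℝ} {n : V → V} {ε μ : ℝ} {x : V}

/-- `l` is a null vector with respect to which `Q` has negative boost order. -/
def IsPrincipalNull (d : ℕ) (b : V →L[ℝ] V →L[ℝ] ℝ) (Q : V →L[ℝ] V →L[ℝ] V →L[ℝ] V →L[ℝ] ℝ)
    (l : V) : Prop :=
  HasNegBoost b Q l ∧ ∃ (n : V) (m : Fin (d - 2) → V), IsNullFrame d (fun u v => b u v) l n m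

/-- A spacetime region with Ricci tensor `λ g + ε n ⊗ n` for a null vector field `n`, and with a
nowhere vanishing Weyl tensor of negative boost order. -/
structure IsNullRicciOn (d : ℕ) (U : Set V) (B : V → V →L[ℝ] V →L[ℝ] ℝ)
    (Γ : V → V →L[ℝ] V →L[ℝ] V) (C : V → V →L[ℝ] V →L[ℝ] V →L[ℝ] V →L[ℝ] ℝ) (n : V → V)
    (ε μ : ℝ) : Prop where
  lc : IsLeviCivitaOn U B Γ
  dim_ge : 3 ≤ d
  dim_eq : Module.finrank ℝ V = d
  smooth_C : ContDiffOn ℝ ∞ C U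
  smooth_n : ContDiffOn ℝ ∞ n U
  eps_ne : ε ≠ 0
  decomp : IsWeylDecompOn U B Γ C n (1 / ((d : ℝ) - 2)) ε μ
  traceless : ∀ x ∈ U, ∀ b e, metricTrace (B x) (slot (C x) b e) = 0
  n_n : ∀ x ∈ U, B x (n x) (n x) = 0
  weyl_ne : ∀ x ∈ U, C x ≠ 0
  principal : ∀ x ∈ U, ∃ l, IsPrincipalNull d (B x) (C x) l

namespace IsNullRicciOn

variable (h : IsNullRicciOn d U B Γ C n ε μ)
include h

lemma mono {W : Set V} (hW : IsOpen W) (hWU : W ⊆ U) : IsNullRicciOn d W B Γ C n ε μ where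
  lc := h.lc.mono hW hWU
  dim_ge := h.dim_ge
  dim_eq := h.dim_eq
  smooth_C := h.smooth_C.mono hWU
  smooth_n := h.smooth_n.mono hWU
  eps_ne := h.eps_ne
  decomp y hy := h.decomp y (hWU hy)
  traceless y hy := h.traceless y (hWU hy)
  n_n y hy := h.n_n y (hWU hy)
  weyl_ne y hy := h.weyl_ne y (hWU hy)
  principal y hy := h.principal y (hWU hy)

lemma two_le : 2 ≤ d := by have := h.dim_ge; omega

lemma curvatureLike (hx : x ∈ U) : IsCurvatureLike (C x) := h.lc.curvatureLike_of_decomp h.decomp hx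

lemma four_le (hx : x ∈ U) : 4 ≤ d := by
  by_contra hd
  obtain ⟨l, hn, n', m, hf⟩ := h.principal x hx
  have := h.dim_ge
  exact h.weyl_ne x hx (hn.eq_zero_of_three (h.curvatureLike hx) (h.lc.symm x hx) (by omega)
    h.dim_eq (h.traceless x hx) hf)

lemma smooth_inverse : ContDiffOn ℝ ∞ (fun y => (B y).inverse) U := fun _ hy =>
  (h.lc.contDiffAt_inverse hy).contDiffWithinAt

/-- There is no field `α` of bilinear forms that singles out the principal null direction and does
not vanish along a transverse `n`. -/
lemma apply_eq_zero {α : V → V →L[ℝ] V →L[ℝ] ℝ} (hα : ContDiffOn ℝ ∞ α U)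
    (h1 : ∀ y ∈ U, ∀ v, α y v v = 0)
    (h2 : ∀ y ∈ U, ∀ l, IsPrincipalNull d (B y) (C y) l → (∀ v, α y v l = 0) ∧
      (∀ v w, B y v l = 0 → B y w l = 0 → α y v w = 0) ∧ (B y (n y) l = 0 → α y = 0))
    (hx : x ∈ U) : α x (n x) = 0 := by
  by_contra hne
  have hinv := h.smooth_inverse
  -- Pointwise `α = l₀ ∧ φ` with `φ(l₀) = 0`. The vector `w` dual to `α(n, ·)` is orthogonal to
  -- `l₀`, so `α(·, w)` is a multiple of `l₀`.
  set w : V → V := fun y => (B y).inverse (α y (n y)) with hw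
  have sw : ContDiffOn ℝ ∞ w U := hinv.clm_apply (hα.clm_apply h.smooth_n)
  have bw : ∀ y ∈ U, ∀ v, B y (w y) v = α y (n y) v := by
    intro y hy v
    rw [hw, apply_inverse (h.lc.nondeg y hy)]
  set ρ : V → ℝ := fun y => α y (n y) (w y) with hρ
  have sρ : ContDiffOn ℝ ∞ ρ U := (hα.clm_apply h.smooth_n).clm_apply sw
  set W := U ∩ ρ ⁻¹' {0}ᶜ with hW
  have oW : IsOpen W := sρ.continuousOn.isOpen_inter_preimage h.lc.isOpen isOpen_compl_singleton
  have WU : W ⊆ U := Set.inter_subset_left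
  -- Dividing by `ρ = α(n, w)` normalises to `l · n = 1`. Thus `l` is smooth although the pointwise
  -- `l₀` are arbitrary choices.
  set l : V → V := fun y => (ρ y)⁻¹ • (B y).inverse ((α y).flip (w y)) with hl
  have sl : ContDiffOn ℝ ∞ l W := by
    refine ((sρ.mono WU).inv (fun y hy => hy.2)).smul ((hinv.mono WU).clm_apply ?_)
    rw [contDiffOn_clm_apply]
    intro v
    exact ((hα.mono WU).clm_apply contDiffOn_const).clm_apply (sw.mono WU)
  have transverse : ∀ y ∈ U, ∀ l₀, IsPrincipalNull d (B y) (C y) l₀ → α y (n y) ≠ 0 →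
      B y (n y) l₀ ≠ 0 := by
    intro y hy l₀ hl₀ hn hnl
    rw [(h2 y hy l₀ hl₀).2.2 hnl] at hn
    simp at hn
  have leq : ∀ y ∈ W, ∀ l₀, IsPrincipalNull d (B y) (C y) l₀ → l y = (B y (n y) l₀)⁻¹ • l₀ := by
    intro y hy l₀ hl₀
    have hyU := WU hy
    have hρ0 : ρ y ≠ 0 := hy.2
    have hn0 : B y (n y) l₀ ≠ 0 := transverse y hyU l₀ hl₀ (fun h0 => hρ0 (by simp [hρ, h0]))
    obtain ⟨a1, a2, -⟩ := h2 y hyU l₀ hl₀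
    rw [← sub_eq_zero]
    refine h.lc.nondeg y hyU _ (fun v => ?_)
    have hwl : B y (w y) l₀ = 0 := by rw [bw y hyU, a1]
    have e1 := a2 (v - (B y v l₀ / B y (n y) l₀) • n y) (w y) (by simp [hn0]) hwl
    simp only [map_sub, map_smul, sub_apply, smul_apply, smul_eq_mul] at e1
    simp only [hl, map_sub, map_smul, sub_apply, smul_apply, smul_eq_mul,
      apply_inverse (h.lc.nondeg y hyU), ContinuousLinearMap.flip_apply, h.lc.symm y hyU l₀ v]
    have e2 : α y v (w y) = B y v l₀ / B y (n y) l₀ * ρ y := by linarith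
    rw [e2]
    field_simp
    ring
  -- If `ρ` vanished at `x`, `w` would be null and orthogonal to `l₀`, hence a multiple of it. Its
  -- product with `n` is `α(n, n) = 0`, so `w`, and with it `α(n, ·)`, would vanish.
  have xW : x ∈ W := by
    refine ⟨hx, fun h0 => ?_⟩
    obtain ⟨l₀, hl₀⟩ := h.principal x hx
    have hn0 := transverse x hx l₀ hl₀ hne
    obtain ⟨n', m, hf⟩ := hl₀.2
    have hs := h.lc.symm x hx
    have hfr := hf.null_rotation hs (h.n_n x hx) hn0
    have e := hfr.eq_smul_of_perp hs h.two_le h.dim_eq (k := w x) (by rw [bw x hx]; exact h0)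
      (by rw [map_smul, bw x hx, (h2 x hx l₀ hl₀).1]; simp)
    rw [bw x hx, h1 x hx, zero_smul] at e
    refine hne ?_
    ext v
    rw [← bw x hx, e]
    simp
  have key : IsTransverseOn d W B Γ C l n ε μ :=
    { lc := h.lc.mono oW WU
      dim_ge := h.four_le hx
      dim_eq := h.dim_eq
      smooth_C := h.smooth_C.mono WU
      smooth_l := sl
      smooth_n := h.smooth_n.mono WU
      eps_ne := h.eps_ne
      decomp := fun y hy => h.decomp y (WU hy)
      traceless := fun y hy => h.traceless y (WU hy)
      neg := fun y hy => by
        obtain ⟨l₀, hl₀⟩ := h.principal y (WU hy)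
        rw [leq y hy l₀ hl₀]
        have hn0 := transverse y (WU hy) l₀ hl₀ (fun h0 => hy.2 (by simp [hρ, h0]))
        exact hl₀.1.smul (inv_ne_zero hn0)
      frame := fun y hy => by
        obtain ⟨l₀, hl₀⟩ := h.principal y (WU hy)
        rw [leq y hy l₀ hl₀]
        have hn0 := transverse y (WU hy) l₀ hl₀ (fun h0 => hy.2 (by simp [hρ, h0]))
        obtain ⟨n', m, hf⟩ := hl₀.2
        exact ⟨_, hf.null_rotation (h.lc.symm y (WU hy)) (h.n_n y (WU hy)) hn0⟩ }
  refine h.weyl_ne x hx ?_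
  rcases (h.four_le hx).eq_or_lt with hd | hd
  · subst hd
    exact key.weyl_eq_zero_of_four xW
  · exact key.weyl_eq_zero_of_five_le xW hd

lemma exists_transverse_frame (hx : x ∈ U) {l : V} (hl : IsPrincipalNull d (B x) (C x) l)
    (hnl : B x (n x) l ≠ 0) : ∃ l' m, HasNegBoost (B x) (C x) l' ∧
      IsNullFrame d (fun u v => B x u v) l' (n x) m ∧ ∃ c : ℝ, c ≠ 0 ∧ l' = c • l := by
  obtain ⟨hn, n', m, hf⟩ := hl
  exact ⟨_, _, hn.smul (inv_ne_zero hnl), hf.null_rotation (h.lc.symm x hx) (h.n_n x hx) hnl, _,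
    inv_ne_zero hnl, rfl⟩

/-- Where `n` is transverse, the Weyl tensor has no components of boost weight `-1`. -/
lemma weight_neg_one_eq_zero (hx : x ∈ U) {l : V} (hl : HasNegBoost (B x) (C x) l)
    {m : Fin (d - 2) → V} (hf : IsNullFrame d (fun u v => B x u v) l (n x) m)
    (i j k : Fin (d - 2)) : C x (n x) (m i) (m j) (m k) = 0 := by
  refine hl.eq_zero_of_tracePairing (h.curvatureLike hx) (h.lc.symm x hx) h.two_le h.dim_eq
    (h.traceless x hx) hf (fun i j => ?_) i j k
  -- Quadratic in `C`; `m i` is kept constant near `x`. Bivectors `C(v, l₀, ·, ·)`, and `C(v, w, ·,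
  -- ·)` with `v`, `w` orthogonal to `l₀`, pair to zero, which gives `α` its shape `l₀ ∧ φ`.
  set α : V → V →L[ℝ] V →L[ℝ] ℝ := fun y => tracePairing (B y) (C y) (curvOp (B y) (C y) (n y) (m i))
    with hα
  have sop : ∀ {u v : V → V}, ContDiffOn ℝ ∞ u U → ContDiffOn ℝ ∞ v U →
      ContDiffOn ℝ ∞ (fun y => curvOp (B y) (C y) (u y) (v y)) U := fun hu hv =>
    h.smooth_inverse.clm_comp ((h.smooth_C.clm_apply hu).clm_apply hv)
  have sα : ContDiffOn ℝ ∞ α U := by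
    rw [contDiffOn_clm_apply]; intro v
    rw [contDiffOn_clm_apply]; intro w
    have := (sop h.smooth_n (contDiffOn_const (c := m i))).clm_comp
      (sop (contDiffOn_const (c := v)) (contDiffOn_const (c := w)))
    exact (LinearMap.toContinuousLinearMap
      (LinearMap.trace ℝ V ∘ₗ ContinuousLinearMap.coeLM ℝ)).contDiff.comp_contDiffOn this
  have := h.apply_eq_zero sα (fun y hy v => ?_) (fun y hy l₀ hl₀ => ?_) hx
  · exact DFunLike.congr_fun this (m j)
  · have h0 : curvOp (B y) (C y) v v = 0 := by
      ext w
      have : C y v v = 0 := by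
        ext a b; exact (h.curvatureLike hy).self_left v a b
      simp [curvOp, this]
    rw [hα, tracePairing_apply, h0]
    simp
  · obtain ⟨hn, n', m', hf'⟩ := hl₀
    have hs := h.lc.symm y hy
    have q := h.curvatureLike hy
    have hb := h.lc.nondeg y hy
    have hnl : B y n' l₀ = 1 := by rw [hs]; exact hf'.l_n
    have left : ∀ v u u', tracePairing (B y) (C y) (curvOp (B y) (C y) u u') l₀ v = 0 := by
      intro v u u'
      refine hn.tracePairing_eq_zero q hs hb hnl u u' (fun X Y hX hY => hn.right_perp _ _ _ hX hY) ?_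
      rw [q.antisymm', hn.left_left, neg_zero]
    have flip : ∀ G v, tracePairing (B y) (C y) G v l₀ = - tracePairing (B y) (C y) G l₀ v := by
      intro G v
      have : curvOp (B y) (C y) v l₀ = - curvOp (B y) (C y) l₀ v := by
        ext w
        have : C y v l₀ = - C y l₀ v := by
          ext a b; exact q.antisymm v l₀ a b
        simp [curvOp, this]
      rw [tracePairing_apply, tracePairing_apply, this, ← map_neg]
      simp
    refine ⟨fun v => ?_, fun v w hv hw => ?_, fun h0 => ?_⟩
    · rw [hα, flip, left, neg_zero]
    · refine hn.tracePairing_eq_zero q hs hb hnl _ _ (fun X Y hX hY => hn.perp _ _ _ _ hv hw hX hY) ?_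
      rw [q.antisymm', q.pair, hn.right_perp _ _ _ hv hw, neg_zero]
    · have e := hf'.eq_smul_of_perp hs h.two_le h.dim_eq (h.n_n y hy) h0
      ext v w
      -- Where `n` is aligned, symmetry of the pairing exchanges the roles of the two bivectors, and
      -- the one containing `n` lies in the kernel.
      simp only [hα]
      rw [tracePairing_comm, e]
      simp [left]

/-- The vector field `n` is aligned with the principal null direction. -/
theorem aligned (hx : x ∈ U) {l : V} (hl : IsPrincipalNull d (B x) (C x) l) :
    B x (n x) l = 0 := by
  by_contra hnl
  have hs := h.lc.symm x hx
  obtain ⟨l', m, hn, hf, -⟩ := h.exists_transverse_frame hx hl hnl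
  obtain ⟨i, j, hij⟩ : ∃ i j, C x (n x) (m i) (n x) (m j) ≠ 0 := by
    by_contra! h0
    exact h.weyl_ne x hx (hn.eq_zero (h.curvatureLike hx) hs h.two_le h.dim_eq (h.traceless x hx) hf
      (h.weight_neg_one_eq_zero hx hn hf) h0)
  have sC : ContDiffOn ℝ ∞ (fun y => C y (n y) (m i)) U :=
    (h.smooth_C.clm_apply h.smooth_n).clm_apply contDiffOn_const
  -- This nonvanishing is an open condition that forces transversality, since `left_left` kills the
  -- component where `n` is aligned. Hence weight `-1` is absent on all of `W`, and `C(n, m_i, ·,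
  -- ·)` has the shape required of `α`.
  set W := U ∩ (fun y => C y (n y) (m i) (n y) (m j)) ⁻¹' {0}ᶜ with hW
  have oW : IsOpen W := ((sC.clm_apply h.smooth_n).clm_apply
    contDiffOn_const).continuousOn.isOpen_inter_preimage h.lc.isOpen isOpen_compl_singleton
  have WU : W ⊆ U := Set.inter_subset_left
  have := (h.mono oW WU).apply_eq_zero (α := fun y => C y (n y) (m i)) (sC.mono WU)
    (fun y hy v => (h.curvatureLike (WU hy)).self_right _ _ _) (fun y hy l₀ hl₀ => ?_)
    (x := x) ⟨hx, hij⟩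
  · exact hij (by rw [this]; simp)
  · have hyU := WU hy
    have htr : B y (n y) l₀ ≠ 0 := by
      intro h0
      obtain ⟨hn, n', m', hf'⟩ := hl₀
      have e := hf'.eq_smul_of_perp (h.lc.symm y hyU) h.two_le h.dim_eq (h.n_n y hyU) h0
      refine hy.2 ?_
      change C y (n y) (m i) (n y) (m j) = 0
      rw [e]
      simp [hn.left_left]
    obtain ⟨l', m', hn', hf', c, hc, rfl⟩ := h.exists_transverse_frame hyU hl₀ htr
    obtain ⟨r1, r2⟩ := hn'.right_eq_zero (h.curvatureLike hyU) (h.lc.symm y hyU) h.two_le h.dim_eq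
      (h.traceless y hyU) hf' (h.weight_neg_one_eq_zero hyU hn' hf')
    refine ⟨fun v => ?_, fun v w hv hw => r2 _ _ _ _ (by simp [hv]) (by simp [hw]),
      fun h0 => absurd h0 htr⟩
    have := r1 (n y) (m i) v
    simpa [hc] using this

end IsNullRicciOn

lemma exists_isPrincipalNull {b : V →L[ℝ] V →L[ℝ] ℝ} {Q : V →L[ℝ] V →L[ℝ] V →L[ℝ] V →L[ℝ] ℝ}
    (hs : ∀ u v, b u v = b v u) (hd : 2 ≤ d) (hdim : Module.finrank ℝ V = d)
    (ht : IsTypeIII d (fun u v => b u v) (fun u v w z => Q u v w z) ∨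
      IsTypeN d (fun u v => b u v) (fun u v w z => Q u v w z)) :
    Q ≠ 0 ∧ ∃ l, IsPrincipalNull d b Q l := by
  have ne : ∀ {l n : V} {m : Fin (d - 2) → V} {w : ℤ},
      ¬ BoostOrderLE (fun u v w z => Q u v w z) l n m w → Q ≠ 0 := by
    rintro l n m w h0 rfl
    exact h0 (fun i j r s _ => by simp)
  rcases ht with ⟨l, n, m, hf, hB, h0⟩ | ⟨l, n, m, hf, hB, h0⟩
  · exact ⟨ne h0, l, hf.hasNegBoost hs hd hdim hB, n, m, hf⟩
  · exact ⟨ne h0, l, hf.hasNegBoost hs hd hdim (fun i j r s hw => hB i j r s (by omega)), n, m, hf⟩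

/-- If the Ricci tensor minus a constant multiple of the metric is `T = η k ⊗ k` for a null vector
field `k`, and the Weyl tensor is of type III or N, then `k` is aligned. -/
theorem aligned_of_null_ricci {k : V → V} {η : V → ℝ} {T : V → V →L[ℝ] V →L[ℝ] ℝ}
    (hlc : IsLeviCivitaOn U B Γ) (hd : 3 ≤ d) (hdim : Module.finrank ℝ V = d)
    (hC : ContDiffOn ℝ ∞ C U) (hT : ContDiffOn ℝ ∞ T U)
    (hTk : ∀ y ∈ U, ∀ u v, T y u v = η y * B y (k y) u * B y (k y) v)
    (hη : ∀ y ∈ U, η y ≠ 0) (hk : ∀ y ∈ U, k y ≠ 0) (hnull : ∀ y ∈ U, B y (k y) (k y) = 0)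
    (hdec : ∀ y ∈ U, ∀ a b c e, B y a (curv Γ y c e b) = C y a b c e
      + 1 / ((d : ℝ) - 2) * (B y a c * T y b e - B y a e * T y b c - B y b c * T y a e
        + B y b e * T y a c) + μ * (B y a c * B y b e - B y a e * B y b c))
    (htr : ∀ y ∈ U, ∀ b e, metricTrace (B y) (slot (C y) b e) = 0)
    (htype : ∀ y ∈ U, IsTypeIII d (fun u v => B y u v) (fun u v w z => C y u v w z) ∨
      IsTypeN d (fun u v => B y u v) (fun u v w z => C y u v w z))
    (hx : x ∈ U) {l : V}
    (hl : IsMultipleWAND d (fun u v => B x u v) (fun u v w z => C x u v w z) l) :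
    ∃ c : ℝ, c ≠ 0 ∧ k x = c • l := by
  have hd2 : 2 ≤ d := by omega
  have alg := fun y (hy : y ∈ U) => exists_isPrincipalNull (hlc.symm y hy) hd2 hdim (htype y hy)
  obtain ⟨u₀, hu₀⟩ : ∃ u₀, B x (k x) u₀ ≠ 0 := by
    by_contra! h0
    exact hk x hx (hlc.nondeg x hx _ h0)
  have hT0 : T x u₀ u₀ ≠ 0 := by
    rw [hTk x hx]
    exact mul_ne_zero (mul_ne_zero (hη x hx) hu₀) hu₀
  -- The constant `ε` carries the sign of `η`, so that the square root below is of a positive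
  -- function near `x`.
  obtain ⟨ε, hε, hpos⟩ : ∃ ε : ℝ, ε ≠ 0 ∧ 0 < ε * T x u₀ u₀ :=
    ⟨T x u₀ u₀, hT0, mul_self_pos.2 hT0⟩
  have sT0 : ContDiffOn ℝ ∞ (fun y => ε * T y u₀ u₀) U :=
    contDiffOn_const.mul ((hT.clm_apply contDiffOn_const).clm_apply contDiffOn_const)
  set W := U ∩ (fun y => ε * T y u₀ u₀) ⁻¹' Set.Ioi 0 with hW
  have oW : IsOpen W := sT0.continuousOn.isOpen_inter_preimage hlc.isOpen isOpen_Ioi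
  have WU : W ⊆ U := Set.inter_subset_left
  have posW : ∀ y ∈ W, 0 < ε * T y u₀ u₀ := fun y hy => hy.2
  have xW : x ∈ W := ⟨hx, hpos⟩
  set σ : V → ℝ := fun y => (Real.sqrt (ε * T y u₀ u₀))⁻¹ with hσ
  -- The vector dual to `T(u₀, ·)` is a multiple of `k` and is smooth because `T` is; the factor `σ`
  -- makes `T = ε n ⊗ n` with constant `ε`.
  set n : V → V := fun y => σ y • (B y).inverse (T y u₀) with hn
  have sn : ContDiffOn ℝ ∞ n W := by
    refine (((sT0.mono WU).sqrt (fun y hy => (posW y hy).ne')).inv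
      (fun y hy => (Real.sqrt_pos.2 (posW y hy)).ne')).smul ?_
    exact ContDiffOn.clm_apply (fun y hy => (hlc.contDiffAt_inverse (WU hy)).contDiffWithinAt)
      ((hT.mono WU).clm_apply contDiffOn_const)
  have bn : ∀ y ∈ W, ∀ v, B y (n y) v = σ y * (η y * B y (k y) u₀) * B y (k y) v := by
    intro y hy v
    simp only [hn, map_smul, smul_apply, smul_eq_mul, apply_inverse (hlc.nondeg y (WU hy)),
      hTk y (WU hy)]
    ring
  have nk : ∀ y ∈ W, n y = (σ y * (η y * B y (k y) u₀)) • k y := by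
    intro y hy
    rw [← sub_eq_zero]
    refine hlc.nondeg y (WU hy) _ (fun v => ?_)
    simp [bn y hy]
  have hσ2 : ∀ y ∈ W, σ y * σ y * (ε * T y u₀ u₀) = 1 := by
    intro y hy
    have h1 := Real.sq_sqrt (posW y hy).le
    have h2 := (Real.sqrt_pos.2 (posW y hy)).ne'
    simp only [hσ]
    field_simp
    linarith
  have Tn : ∀ y ∈ W, ∀ u v, T y u v = ε * B y (n y) u * B y (n y) v := by
    intro y hy u v
    have h1 := hσ2 y hy
    rw [hTk y (WU hy)] at h1
    rw [bn y hy, bn y hy, hTk y (WU hy)]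
    linear_combination - (η y * B y (k y) u * B y (k y) v) * h1
  have key : IsNullRicciOn d W B Γ C n ε μ :=
    { lc := hlc.mono oW WU
      dim_ge := hd
      dim_eq := hdim
      smooth_C := hC.mono WU
      smooth_n := sn
      eps_ne := hε
      decomp := fun y hy a b c e => by
        rw [hdec y (WU hy)]
        simp only [Tn y hy]
      traceless := fun y hy => htr y (WU hy)
      n_n := fun y hy => by
        rw [nk y hy]
        simp [hnull y (WU hy)]
      weyl_ne := fun y hy => (alg y (WU hy)).1
      principal := fun y hy => (alg y (WU hy)).2 }
  obtain ⟨hC0, l₀, hl₀⟩ := alg x hx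
  have hal := key.aligned xW hl₀
  obtain ⟨hneg, n', m, hf⟩ := hl₀
  have hs := hlc.symm x hx
  obtain ⟨c, hc, hlc'⟩ := hneg.eq_smul_of_isMultipleWAND (key.curvatureLike xW) hs hd2 hdim
    (htr x hx) hf hC0 hl
  have hcoef : σ x * (η x * B x (k x) u₀) ≠ 0 := by
    have := hσ2 x xW
    refine mul_ne_zero (fun h0 => ?_) (mul_ne_zero (hη x hx) hu₀)
    rw [h0] at this
    simp at this
  have hkl : B x (k x) l₀ = 0 := by
    rw [bn x xW] at hal
    exact (mul_eq_zero.1 hal).resolve_left hcoef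
  have ek := hf.eq_smul_of_perp hs hd2 hdim (hnull x hx) hkl
  have hc' : B x (k x) n' ≠ 0 := by
    intro h0
    rw [h0, zero_smul] at ek
    exact hk x hx ek
  refine ⟨B x (k x) n' * c⁻¹, mul_ne_zero hc' (inv_ne_zero hc), ?_⟩
  rw [hlc', smul_smul, mul_assoc, inv_mul_cancel₀ hc, mul_one]
  exact ek

end Alignment


/-! ### Multilinear forms from coordinate coefficients -/

section CoordinateTensors

set_option maxSynthPendingDepth 3
set_option linter.unusedSectionVars false

variable {d : ℕ} {F : Type*} [NormedAddCommGroup F] [NormedSpace ℝ F]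

/-- The coordinate basis vector. -/
def basisVec (i : Fin d) : EuclideanSpace ℝ (Fin d) := EuclideanSpace.single i 1

@[simp] lemma basisVec_apply (i j : Fin d) : basisVec i j = if j = i then 1 else 0 := by
  simp [basisVec]

/-- The linear map with given values on the coordinate basis. -/
def ofCoeff (c : Fin d → F) : EuclideanSpace ℝ (Fin d) →L[ℝ] F :=
  ∑ i, (EuclideanSpace.proj (𝕜 := ℝ) i : EuclideanSpace ℝ (Fin d) →L[ℝ] ℝ).smulRight (c i)

lemma ofCoeff_apply (c : Fin d → F) (u : EuclideanSpace ℝ (Fin d)) :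
    ofCoeff c u = ∑ i, u i • c i := by
  simp [ofCoeff]

@[simp] lemma ofCoeff_basisVec (c : Fin d → F) (i : Fin d) : ofCoeff c (basisVec i) = c i := by
  simp [ofCoeff_apply]

lemma contDiffOn_ofCoeff {E : Type*} [NormedAddCommGroup E] [NormedSpace ℝ E] {U : Set E}
    {c : E → Fin d → F} (hc : ∀ i, ContDiffOn ℝ ∞ (fun y => c y i) U) :
    ContDiffOn ℝ ∞ (fun y => ofCoeff (c y)) U := by
  rw [contDiffOn_clm_apply]
  intro u
  simp only [ofCoeff_apply]
  exact ContDiffOn.sum (fun i _ => contDiffOn_const.smul (hc i))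

lemma sum_smul_basisVec (u : EuclideanSpace ℝ (Fin d)) : ∑ i, u i • basisVec i = u := by
  ext j
  simp

lemma linear_eq_sum {f : EuclideanSpace ℝ (Fin d) → F} (hf : IsLinearMap ℝ f)
    (u : EuclideanSpace ℝ (Fin d)) : f u = ∑ i, u i • f (basisVec i) := by
  have := map_sum (hf.mk' f) (fun i => u i • basisVec i) Finset.univ
  simp only [map_smul, sum_smul_basisVec] at this
  exact this

/-- Applied slot by slot, this reduces multilinear identities to basis vectors. -/
lemma linear_eq_zero {f : EuclideanSpace ℝ (Fin d) → F} (hf : IsLinearMap ℝ f)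
    (h : ∀ i, f (basisVec i) = 0) (u : EuclideanSpace ℝ (Fin d)) : f u = 0 := by
  rw [linear_eq_sum hf]
  simp [h]

/-- The bilinear form with matrix `M`. -/
def form₂ (M : Matrix (Fin d) (Fin d) ℝ) :
    EuclideanSpace ℝ (Fin d) →L[ℝ] EuclideanSpace ℝ (Fin d) →L[ℝ] ℝ :=
  ofCoeff fun i => ofCoeff (M i)

/-- The quadrilinear form with given coefficients. -/
def form₄ (Q : Fin d → Fin d → Fin d → Fin d → ℝ) :
    EuclideanSpace ℝ (Fin d) →L[ℝ] EuclideanSpace ℝ (Fin d) →L[ℝ] EuclideanSpace ℝ (Fin d) →L[ℝ]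
      EuclideanSpace ℝ (Fin d) →L[ℝ] ℝ :=
  ofCoeff fun a => ofCoeff fun b => ofCoeff fun c => ofCoeff (Q a b c)

@[simp] lemma form₂_basisVec (M : Matrix (Fin d) (Fin d) ℝ) (i j : Fin d) :
    form₂ M (basisVec i) (basisVec j) = M i j := by
  simp [form₂]

@[simp] lemma form₄_basisVec (Q : Fin d → Fin d → Fin d → Fin d → ℝ) (a b c e : Fin d) :
    form₄ Q (basisVec a) (basisVec b) (basisVec c) (basisVec e) = Q a b c e := by
  simp [form₄]

lemma form₂_apply (M : Matrix (Fin d) (Fin d) ℝ) (u v : EuclideanSpace ℝ (Fin d)) :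
    form₂ M u v = ∑ i, ∑ j, M i j * u i * v j := by
  simp only [form₂, ofCoeff_apply, sum_apply, smul_apply, smul_eq_mul, Finset.mul_sum]
  exact Finset.sum_congr rfl (fun i _ => Finset.sum_congr rfl (fun j _ => by ring))

lemma form₄_apply (Q : Fin d → Fin d → Fin d → Fin d → ℝ) (u v w z : EuclideanSpace ℝ (Fin d)) :
    form₄ Q u v w z = ∑ a, ∑ b, ∑ c, ∑ e, Q a b c e * u a * v b * w c * z e := by
  simp only [form₄, ofCoeff_apply, sum_apply, smul_apply, smul_eq_mul, Finset.mul_sum]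
  exact Finset.sum_congr rfl (fun a _ => Finset.sum_congr rfl (fun b _ =>
    Finset.sum_congr rfl (fun c _ => Finset.sum_congr rfl (fun e _ => by ring))))

lemma form₂_symm {M : Matrix (Fin d) (Fin d) ℝ} (hM : ∀ i j, M i j = M j i)
    (u v : EuclideanSpace ℝ (Fin d)) : form₂ M u v = form₂ M v u := by
  rw [form₂_apply, form₂_apply, Finset.sum_comm]
  exact Finset.sum_congr rfl (fun i _ => Finset.sum_congr rfl (fun j _ => by rw [hM]; ring))

lemma form₂_nondeg {M : Matrix (Fin d) (Fin d) ℝ} (hM : M.det ≠ 0) (u : EuclideanSpace ℝ (Fin d))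
    (hu : ∀ v, form₂ M u v = 0) : u = 0 := by
  have h1 : Matrix.vecMul u.ofLp M = 0 := by
    ext j
    have := hu (basisVec j)
    simp only [form₂, ofCoeff_apply, sum_apply, smul_apply, smul_eq_mul] at this
    simpa [Matrix.vecMul, dotProduct] using this
  have h2 := Matrix.eq_zero_of_vecMul_eq_zero hM h1
  ext i
  exact congrFun h2 i

/-- The metric trace in coordinates. -/
lemma metricTrace_form₂ {M : Matrix (Fin d) (Fin d) ℝ} (hM : M.det ≠ 0) (hs : ∀ i j, M i j = M j i)
    (f : EuclideanSpace ℝ (Fin d) →L[ℝ] EuclideanSpace ℝ (Fin d) →L[ℝ] ℝ) :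
    metricTrace (form₂ M) f = ∑ a, ∑ c, M⁻¹ a c * f (basisVec a) (basisVec c) := by
  have hunit : IsUnit M.det := isUnit_iff_ne_zero.2 hM
  set φ : Fin d → EuclideanSpace ℝ (Fin d) := fun a =>
    ∑ c, (∑ r, f (basisVec a) (basisVec r) * M⁻¹ r c) • basisVec c with hφ
  have key : ∀ a, (form₂ M).inverse (f (basisVec a)) = φ a := by
    intro a
    rw [← inverse_apply (form₂_nondeg hM) (φ a)]
    congr 1
    ext v
    rw [← sub_eq_zero]
    refine linear_eq_zero (f := fun v => f (basisVec a) v - form₂ M (φ a) v)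
      ⟨fun u v => by simp; ring, fun c v => by simp; ring⟩ (fun j => ?_) v
    have e1 : form₂ M (φ a) (basisVec j) = ∑ r, f (basisVec a) (basisVec r) * (M⁻¹ * M) r j := by
      simp only [hφ, map_sum, map_smul, sum_apply, smul_apply, form₂_basisVec, smul_eq_mul,
        Matrix.mul_apply, Finset.mul_sum, Finset.sum_mul]
      rw [Finset.sum_comm]
      exact Finset.sum_congr rfl (fun r _ => Finset.sum_congr rfl (fun c _ => by ring))
    rw [e1, Matrix.nonsing_inv_mul M hunit]
    simp [Matrix.one_apply]
  rw [metricTrace, LinearMap.trace_eq_matrix_trace ℝ (EuclideanSpace.basisFun (Fin d) ℝ).toBasis,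
    Matrix.trace]
  refine Finset.sum_congr rfl (fun a _ => ?_)
  have hinv : ∀ r c, M⁻¹ r c = M⁻¹ c r := by
    have hT : M.transpose = M := by ext i j; exact hs j i
    intro r c
    have := Matrix.transpose_nonsing_inv M
    rw [hT] at this
    exact congrFun (congrFun this c) r
  simp only [Matrix.diag, LinearMap.toMatrix_apply, OrthonormalBasis.coe_toBasis,
    EuclideanSpace.basisFun_apply, OrthonormalBasis.coe_toBasis_repr_apply]
  change (EuclideanSpace.basisFun (Fin d) ℝ).repr ((form₂ M).inverse (f (basisVec a))) a = _
  rw [key]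
  simp [hφ]
  exact Finset.sum_congr rfl (fun r _ => by rw [hinv]; ring)

end CoordinateTensors


/-! ### Christoffel symbols as a Levi-Civita connection -/

section CoordinateCurvature

set_option maxSynthPendingDepth 3
set_option linter.unusedSectionVars false

variable {d : ℕ}

/-- `G` is a smooth symmetric invertible matrix on the open set `U`. -/
structure IsMetricOn (U : Set (EuclideanSpace ℝ (Fin d)))
    (G : EuclideanSpace ℝ (Fin d) → Matrix (Fin d) (Fin d) ℝ) : Prop where
  isOpen : IsOpen U
  smooth : ∀ i j, ContDiffOn ℝ ∞ (fun y => G y i j) U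
  symm : ∀ y ∈ U, ∀ i j, G y i j = G y j i
  det_ne : ∀ y ∈ U, (G y).det ≠ 0

lemma contDiffOn_det {E : Type*} [NormedAddCommGroup E] [NormedSpace ℝ E] {U : Set E}
    {A : E → Matrix (Fin d) (Fin d) ℝ} (hA : ∀ i j, ContDiffOn ℝ ∞ (fun y => A y i j) U) :
    ContDiffOn ℝ ∞ (fun y => (A y).det) U := by
  simp only [Matrix.det_apply']
  exact ContDiffOn.sum (fun σ _ => contDiffOn_const.mul (contDiffOn_prod (fun i _ => hA _ _)))

lemma contDiffOn_inv_apply {E : Type*} [NormedAddCommGroup E] [NormedSpace ℝ E] {U : Set E}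
    {A : E → Matrix (Fin d) (Fin d) ℝ} (hA : ∀ i j, ContDiffOn ℝ ∞ (fun y => A y i j) U)
    (hdet : ∀ y ∈ U, (A y).det ≠ 0) (i j : Fin d) : ContDiffOn ℝ ∞ (fun y => (A y)⁻¹ i j) U := by
  simp only [Matrix.inv_def, Ring.inverse_eq_inv', Matrix.smul_apply, Matrix.adjugate_apply,
    smul_eq_mul]
  refine ((contDiffOn_det hA).inv hdet).mul (contDiffOn_det (fun r s => ?_))
  simp only [Matrix.updateRow_apply]
  by_cases hr : r = j
  · simp only [hr, if_true]
    exact contDiffOn_const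
  · simp only [hr, if_false]
    exact hA r s

lemma contDiffOn_pderiv {U : Set (EuclideanSpace ℝ (Fin d))} (hU : IsOpen U)
    {f : EuclideanSpace ℝ (Fin d) → ℝ} (hf : ContDiffOn ℝ ∞ f U) (i : Fin d) :
    ContDiffOn ℝ ∞ (pderiv i f) U :=
  (hf.fderiv_of_isOpen hU (by simp)).clm_apply contDiffOn_const

/-- The Levi-Civita connection in coordinates. -/
def connForm (G : EuclideanSpace ℝ (Fin d) → Matrix (Fin d) (Fin d) ℝ)
    (x : EuclideanSpace ℝ (Fin d)) :
    EuclideanSpace ℝ (Fin d) →L[ℝ] EuclideanSpace ℝ (Fin d) →L[ℝ] EuclideanSpace ℝ (Fin d) :=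
  ofCoeff fun b => ofCoeff fun c => ∑ a, christoffel G a b c x • basisVec a

@[simp] lemma connForm_basisVec (G : EuclideanSpace ℝ (Fin d) → Matrix (Fin d) (Fin d) ℝ)
    (x : EuclideanSpace ℝ (Fin d)) (b c : Fin d) :
    connForm G x (basisVec b) (basisVec c) = ∑ a, christoffel G a b c x • basisVec a := by
  simp [connForm]

lemma contDiffOn_form₄ {U : Set (EuclideanSpace ℝ (Fin d))}
    {Q : EuclideanSpace ℝ (Fin d) → Fin d → Fin d → Fin d → Fin d → ℝ}
    (hQ : ∀ a b c e, ContDiffOn ℝ ∞ (fun y => Q y a b c e) U) :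
    ContDiffOn ℝ ∞ (fun y => form₄ (Q y)) U :=
  contDiffOn_ofCoeff fun a => contDiffOn_ofCoeff fun b => contDiffOn_ofCoeff fun c =>
    contDiffOn_ofCoeff fun e => hQ a b c e

lemma contDiffOn_form₂ {U : Set (EuclideanSpace ℝ (Fin d))}
    {M : EuclideanSpace ℝ (Fin d) → Matrix (Fin d) (Fin d) ℝ}
    (hM : ∀ a b, ContDiffOn ℝ ∞ (fun y => M y a b) U) : ContDiffOn ℝ ∞ (fun y => form₂ (M y)) U :=
  contDiffOn_ofCoeff fun a => contDiffOn_ofCoeff fun b => hM a b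

namespace IsMetricOn

variable {U : Set (EuclideanSpace ℝ (Fin d))}
  {G : EuclideanSpace ℝ (Fin d) → Matrix (Fin d) (Fin d) ℝ} {x : EuclideanSpace ℝ (Fin d)}
  (h : IsMetricOn U G)
include h

lemma smooth_inv (i j : Fin d) : ContDiffOn ℝ ∞ (fun y => (G y)⁻¹ i j) U :=
  contDiffOn_inv_apply h.smooth h.det_ne i j

lemma smooth_christoffel (a b c : Fin d) : ContDiffOn ℝ ∞ (christoffel G a b c) U :=
  contDiffOn_const.mul (ContDiffOn.sum fun s _ => (h.smooth_inv a s).mul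
    (((contDiffOn_pderiv h.isOpen (h.smooth c s) b).add
      (contDiffOn_pderiv h.isOpen (h.smooth b s) c)).sub
        (contDiffOn_pderiv h.isOpen (h.smooth b c) s)))

lemma smooth_riemannUp (a b c e : Fin d) : ContDiffOn ℝ ∞ (riemannUp G a b c e) U :=
  ((contDiffOn_pderiv h.isOpen (h.smooth_christoffel a b e) c).sub
    (contDiffOn_pderiv h.isOpen (h.smooth_christoffel a b c) e)).add
    (ContDiffOn.sum fun s _ => ((h.smooth_christoffel a c s).mul (h.smooth_christoffel s b e)).sub
      ((h.smooth_christoffel a e s).mul (h.smooth_christoffel s b c)))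

lemma smooth_ricciCoeff (a b : Fin d) : ContDiffOn ℝ ∞ (ricciCoeff G a b) U :=
  ContDiffOn.sum fun s _ => h.smooth_riemannUp s a s b

lemma smooth_scalarCurv : ContDiffOn ℝ ∞ (scalarCurv G) U :=
  ContDiffOn.sum fun a _ => ContDiffOn.sum fun b _ => (h.smooth_inv a b).mul (h.smooth_ricciCoeff a b)

lemma smooth_weylCoeff (a b c e : Fin d) : ContDiffOn ℝ ∞ (weylCoeff G a b c e) U := by
  have hg := h.smooth
  have hr := h.smooth_ricciCoeff
  refine ((ContDiffOn.sum fun s _ => (hg a s).mul (h.smooth_riemannUp s b c e)).sub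
    (ContDiffOn.div_const ?_ _)).add ((h.smooth_scalarCurv.mul ?_).div_const _)
  · exact ((((hg a c).mul (hr b e)).sub ((hg a e).mul (hr b c))).sub ((hg b c).mul (hr a e))).add
      ((hg b e).mul (hr a c))
  · exact ((hg a c).mul (hg b e)).sub ((hg a e).mul (hg b c))

lemma isUnit_det (hx : x ∈ U) : IsUnit (G x).det := isUnit_iff_ne_zero.2 (h.det_ne x hx)

lemma sum_mul_inv (hx : x ∈ U) (i j : Fin d) :
    ∑ s, G x i s * (G x)⁻¹ s j = if i = j then 1 else 0 := by
  have := congrFun (congrFun (Matrix.mul_nonsing_inv (G x) (h.isUnit_det hx)) i) j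
  rwa [Matrix.mul_apply, Matrix.one_apply] at this

lemma sum_inv_mul (hx : x ∈ U) (i j : Fin d) :
    ∑ s, (G x)⁻¹ i s * G x s j = if i = j then 1 else 0 := by
  have := congrFun (congrFun (Matrix.nonsing_inv_mul (G x) (h.isUnit_det hx)) i) j
  rwa [Matrix.mul_apply, Matrix.one_apply] at this

lemma pderiv_symm (hx : x ∈ U) (s i j : Fin d) :
    pderiv s (fun y => G y i j) x = pderiv s (fun y => G y j i) x := by
  rw [pderiv, pderiv, fderiv_congr_of_mem h.isOpen hx (fun y hy => h.symm y hy i j)]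

lemma christoffel_symm (hx : x ∈ U) (a b c : Fin d) : christoffel G a b c x = christoffel G a c b x := by
  simp only [christoffel]
  congr 1
  refine Finset.sum_congr rfl (fun s _ => ?_)
  rw [h.pderiv_symm hx s c b]
  ring

/-- The Christoffel symbols of the first kind. -/
lemma sum_mul_christoffel (hx : x ∈ U) (v b c : Fin d) :
    ∑ a, G x v a * christoffel G a b c x =
      1 / 2 * (pderiv b (fun y => G y c v) x + pderiv c (fun y => G y b v) x
        - pderiv v (fun y => G y b c) x) := by
  simp only [christoffel]
  set X : Fin d → ℝ := fun s => pderiv b (fun y => G y c s) x + pderiv c (fun y => G y b s) x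
    - pderiv s (fun y => G y b c) x with hX
  calc ∑ a, G x v a * (1 / 2 * ∑ s, (G x)⁻¹ a s * X s)
      = 1 / 2 * ∑ s, (∑ a, G x v a * (G x)⁻¹ a s) * X s := by
        simp only [Finset.mul_sum, Finset.sum_mul]
        rw [Finset.sum_comm]
        exact Finset.sum_congr rfl (fun s _ => Finset.sum_congr rfl (fun a _ => by ring))
    _ = 1 / 2 * X v := by
        simp [h.sum_mul_inv hx]

lemma smooth_form : ContDiffOn ℝ ∞ (fun y => form₂ (G y)) U := contDiffOn_form₂ h.smooth

lemma smooth_connForm : ContDiffOn ℝ ∞ (connForm G) U :=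
  contDiffOn_ofCoeff fun b => contDiffOn_ofCoeff fun c => ContDiffOn.sum fun a _ =>
    (h.smooth_christoffel a b c).smul contDiffOn_const

lemma diffAt {F : Type*} [NormedAddCommGroup F] [NormedSpace ℝ F]
    {f : EuclideanSpace ℝ (Fin d) → F} (hf : ContDiffOn ℝ ∞ f U) (hx : x ∈ U) :
    DifferentiableAt ℝ f x :=
  (hf.contDiffAt (h.isOpen.mem_nhds hx)).differentiableAt (by simp)

lemma fderiv_form (hx : x ∈ U) (e u v : Fin d) :
    fderiv ℝ (fun y => form₂ (G y)) x (basisVec e) (basisVec u) (basisVec v) =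
      pderiv e (fun y => G y u v) x := by
  have k := fun v : EuclideanSpace ℝ (Fin d) => hasFDerivAt_const (𝕜 := ℝ) v x
  have t := ((h.diffAt h.smooth_form hx).hasFDerivAt.clm_apply (k (basisVec u))).clm_apply
    (k (basisVec v))
  simp only [form₂_basisVec] at t
  rw [pderiv, t.fderiv]
  simp [basisVec]

lemma fderiv_connForm (hx : x ∈ U) (c e b : Fin d) :
    fderiv ℝ (connForm G) x (basisVec c) (basisVec e) (basisVec b) =
      ∑ a, pderiv c (christoffel G a e b) x • basisVec a := by
  have k := fun v : EuclideanSpace ℝ (Fin d) => hasFDerivAt_const (𝕜 := ℝ) v x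
  have t := ((h.diffAt h.smooth_connForm hx).hasFDerivAt.clm_apply (k (basisVec e))).clm_apply
    (k (basisVec b))
  simp only [connForm_basisVec] at t
  have t' := HasFDerivAt.fun_sum (u := Finset.univ) (fun a _ =>
    ((h.diffAt (h.smooth_christoffel a e b) hx).hasFDerivAt.smul (k (basisVec a))))
  have := DFunLike.congr_fun (t.unique t') (basisVec c)
  simpa [pderiv, basisVec] using this

lemma isLeviCivitaOn : IsLeviCivitaOn U (fun y => form₂ (G y)) (connForm G) where
  isOpen := h.isOpen
  smooth_metric := h.smooth_form
  smooth_conn := h.smooth_connForm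
  symm y hy := form₂_symm (h.symm y hy)
  nondeg y hy := form₂_nondeg (h.det_ne y hy)
  torsion y hy u v := by
    rw [← sub_eq_zero]
    refine linear_eq_zero (f := fun u => connForm G y u v - connForm G y v u)
      ⟨fun a b => by simp; abel, fun c a => by simp [smul_sub]⟩ (fun i => ?_) u
    refine linear_eq_zero (f := fun v => connForm G y (basisVec i) v - connForm G y v (basisVec i))
      ⟨fun a b => by simp; abel, fun c a => by simp [smul_sub]⟩ (fun j => ?_) v
    rw [connForm_basisVec, connForm_basisVec, sub_eq_zero]
    exact Finset.sum_congr rfl (fun a _ => by rw [h.christoffel_symm hy])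
  compat y hy e u v := by
    rw [← sub_eq_zero]
    set B := fun y => form₂ (G y)
    refine linear_eq_zero (f := fun e => fderiv ℝ B y e u v -
      (B y (connForm G y e u) v + B y u (connForm G y e v)))
      ⟨fun a b => by simp; ring, fun c a => by simp; ring⟩ (fun i => ?_) e
    refine linear_eq_zero (f := fun u => fderiv ℝ B y (basisVec i) u v -
      (B y (connForm G y (basisVec i) u) v + B y u (connForm G y (basisVec i) v)))
      ⟨fun a b => by simp; ring, fun c a => by simp; ring⟩ (fun j => ?_) u
    refine linear_eq_zero (f := fun v => fderiv ℝ B y (basisVec i) (basisVec j) v -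
      (B y (connForm G y (basisVec i) (basisVec j)) v
        + B y (basisVec j) (connForm G y (basisVec i) v)))
      ⟨fun a b => by simp [-connForm_basisVec]; ring,
        fun c a => by simp [-connForm_basisVec]; ring⟩ (fun r => ?_) v
    have e1 : ∀ r i j, B y (connForm G y (basisVec i) (basisVec j)) (basisVec r) =
        ∑ a, G y r a * christoffel G a i j y := by
      intro r i j
      simp only [B, connForm_basisVec, map_sum, map_smul, sum_apply, smul_apply, form₂_basisVec,
        smul_eq_mul]
      exact Finset.sum_congr rfl (fun a _ => by rw [h.symm y hy]; ring)
    rw [form₂_symm (h.symm y hy) (basisVec j), e1, e1, h.sum_mul_christoffel hy,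
      h.sum_mul_christoffel hy, h.fderiv_form hy, h.pderiv_symm hy i r j, h.pderiv_symm hy j i r,
      h.pderiv_symm hy r i j]
    ring

/-- The curvature operator in coordinates. -/
lemma curv_basisVec (hx : x ∈ U) (b c e : Fin d) :
    curv (connForm G) x (basisVec c) (basisVec e) (basisVec b) =
      ∑ a, riemannUp G a b c e x • basisVec a := by
  have e1 : ∀ c e b, connForm G x (basisVec c) (connForm G x (basisVec e) (basisVec b)) =
      ∑ a, (∑ s, christoffel G a c s x * christoffel G s b e x) • basisVec a := by
    intro c e b
    simp only [connForm_basisVec, map_sum, map_smul, Finset.smul_sum, smul_smul, Finset.sum_smul]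
    rw [Finset.sum_comm]
    exact Finset.sum_congr rfl (fun a _ => Finset.sum_congr rfl (fun s _ => by
      rw [h.christoffel_symm hx s e b, mul_comm]))
  have e2 : ∀ c a e b, pderiv c (christoffel G a e b) x = pderiv c (christoffel G a b e) x := by
    intro c a e b
    rw [pderiv, pderiv, fderiv_congr_of_mem h.isOpen hx (fun y hy => h.christoffel_symm hy a e b)]
  simp only [curv]
  rw [h.fderiv_connForm hx, h.fderiv_connForm hx, e1, e1, ← Finset.sum_sub_distrib,
    ← Finset.sum_add_distrib, ← Finset.sum_sub_distrib]
  refine Finset.sum_congr rfl (fun a _ => ?_)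
  rw [e2 c a e b, e2 e a c b, ← sub_smul, ← add_smul, ← sub_smul, riemannUp,
    Finset.sum_sub_distrib]
  congr 1
  ring

lemma riemann_basisVec (hx : x ∈ U) (a b c e : Fin d) :
    form₂ (G x) (basisVec a) (curv (connForm G) x (basisVec c) (basisVec e) (basisVec b)) =
      riemannCoeff G a b c e x := by
  rw [h.curv_basisVec hx, riemannCoeff, map_sum]
  exact Finset.sum_congr rfl (fun s _ => by simp [mul_comm])

end IsMetricOn

end CoordinateCurvature


/-! ### The coordinate Weyl tensor and the alignment theorem on an open set -/

section CoordinateWeyl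

set_option maxSynthPendingDepth 3
set_option linter.unusedSectionVars false

variable {d : ℕ}

/-- The Weyl tensor in coordinates. -/
def weylForm (G : EuclideanSpace ℝ (Fin d) → Matrix (Fin d) (Fin d) ℝ)
    (x : EuclideanSpace ℝ (Fin d)) :
    EuclideanSpace ℝ (Fin d) →L[ℝ] EuclideanSpace ℝ (Fin d) →L[ℝ] EuclideanSpace ℝ (Fin d) →L[ℝ]
      EuclideanSpace ℝ (Fin d) →L[ℝ] ℝ :=
  form₄ fun a b c e => weylCoeff G a b c e x

/-- The trace-adjusted Ricci tensor `R_{ab} - λ g_{ab}` in coordinates. -/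
def ricciForm (G : EuclideanSpace ℝ (Fin d) → Matrix (Fin d) (Fin d) ℝ) (cosm : ℝ)
    (x : EuclideanSpace ℝ (Fin d)) :
    EuclideanSpace ℝ (Fin d) →L[ℝ] EuclideanSpace ℝ (Fin d) →L[ℝ] ℝ :=
  form₂ (Matrix.of fun a b => ricciCoeff G a b x - cosm * G x a b)

@[simp] lemma weylForm_basisVec (G : EuclideanSpace ℝ (Fin d) → Matrix (Fin d) (Fin d) ℝ)
    (x : EuclideanSpace ℝ (Fin d)) (a b c e : Fin d) :
    weylForm G x (basisVec a) (basisVec b) (basisVec c) (basisVec e) = weylCoeff G a b c e x := by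
  simp [weylForm]

@[simp] lemma ricciForm_basisVec (G : EuclideanSpace ℝ (Fin d) → Matrix (Fin d) (Fin d) ℝ)
    (cosm : ℝ) (x : EuclideanSpace ℝ (Fin d)) (a b : Fin d) :
    ricciForm G cosm x (basisVec a) (basisVec b) = ricciCoeff G a b x - cosm * G x a b := by
  simp [ricciForm]

namespace IsMetricOn

variable {U : Set (EuclideanSpace ℝ (Fin d))}
  {G : EuclideanSpace ℝ (Fin d) → Matrix (Fin d) (Fin d) ℝ} {x : EuclideanSpace ℝ (Fin d)}
  (h : IsMetricOn U G)
include h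

lemma inv_symm (hx : x ∈ U) (i j : Fin d) : (G x)⁻¹ i j = (G x)⁻¹ j i := by
  have hT : (G x).transpose = G x := by ext i j; exact h.symm x hx j i
  have := Matrix.transpose_nonsing_inv (G x)
  rw [hT] at this
  exact congrFun (congrFun this j) i

/-- The Weyl tensor is trace-free. -/
lemma weyl_traceless (hd : 3 ≤ d) (hx : x ∈ U) (u v : EuclideanSpace ℝ (Fin d)) :
    metricTrace (form₂ (G x)) (slot (weylForm G x) u v) = 0 := by
  have hdR : (3 : ℝ) ≤ d := by exact_mod_cast hd
  rw [metricTrace_form₂ (h.det_ne x hx) (h.symm x hx)]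
  simp only [slot_apply]
  refine linear_eq_zero (f := fun u => ∑ a, ∑ c, (G x)⁻¹ a c *
      weylForm G x (basisVec a) u (basisVec c) v)
    ⟨fun p q => by simp [mul_add, Finset.sum_add_distrib],
      fun r p => by
        simp only [map_smul, smul_apply, smul_eq_mul, Finset.mul_sum]
        exact Finset.sum_congr rfl fun a _ => Finset.sum_congr rfl fun c _ => by ring⟩ (fun b => ?_) u
  refine linear_eq_zero (f := fun v => ∑ a, ∑ c, (G x)⁻¹ a c *
      weylForm G x (basisVec a) (basisVec b) (basisVec c) v)
    ⟨fun p q => by simp [mul_add, Finset.sum_add_distrib],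
      fun r p => by
        simp only [map_smul, smul_eq_mul, Finset.mul_sum]
        exact Finset.sum_congr rfl fun a _ => Finset.sum_congr rfl fun c _ => by ring⟩ (fun e => ?_) v
  simp only [weylForm_basisVec, weylCoeff]
  have gs := h.symm x hx
  have is := h.inv_symm hx
  have t0 : ∀ (i j : Fin d), ∑ s, (G x)⁻¹ s i * G x s j = if i = j then 1 else 0 := by
    intro i j
    rw [← h.sum_inv_mul hx]
    exact Finset.sum_congr rfl fun s _ => by rw [is]
  have s1 : ∑ a, ∑ c, (G x)⁻¹ a c * riemannCoeff G a b c e x = ricciCoeff G b e x := by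
    rw [Finset.sum_comm, ricciCoeff]
    refine Finset.sum_congr rfl fun c _ => ?_
    simp only [riemannCoeff, Finset.mul_sum]
    rw [Finset.sum_comm]
    calc ∑ s, ∑ a, (G x)⁻¹ a c * (G x a s * riemannUp G s b c e x)
        = ∑ s, (∑ a, (G x)⁻¹ a c * G x a s) * riemannUp G s b c e x := by
          simp only [Finset.sum_mul, mul_assoc]
      _ = riemannUp G c b c e x := by simp [t0]
  have s2 : ∑ a, ∑ c, (G x)⁻¹ a c * G x a c = d := by
    rw [Finset.sum_comm]
    simp [t0]
  have s3 : ∀ (X : Fin d → ℝ), ∑ a, ∑ c, (G x)⁻¹ a c * (G x a e * X c) = X e := by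
    intro X
    rw [Finset.sum_comm]
    calc ∑ c, ∑ a, (G x)⁻¹ a c * (G x a e * X c) = ∑ c, (∑ a, (G x)⁻¹ a c * G x a e) * X c := by
          simp only [Finset.sum_mul, mul_assoc]
      _ = X e := by simp [t0]
  have s4 : ∀ (X : Fin d → ℝ), ∑ a, ∑ c, (G x)⁻¹ a c * (G x b c * X a) = X b := by
    intro X
    calc ∑ a, ∑ c, (G x)⁻¹ a c * (G x b c * X a) = ∑ a, (∑ c, (G x)⁻¹ a c * G x c b) * X a := by
          simp only [Finset.sum_mul]
          exact Finset.sum_congr rfl fun a _ => Finset.sum_congr rfl fun c _ => by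
            rw [gs b c]; ring
      _ = X b := by simp [h.sum_inv_mul hx]
  have split : ∀ a c, (G x)⁻¹ a c * (riemannCoeff G a b c e x
      - (G x a c * ricciCoeff G b e x - G x a e * ricciCoeff G b c x
        - G x b c * ricciCoeff G a e x + G x b e * ricciCoeff G a c x) / ((d : ℝ) - 2)
      + scalarCurv G x * (G x a c * G x b e - G x a e * G x b c) / (((d : ℝ) - 1) * ((d : ℝ) - 2))) =
      (G x)⁻¹ a c * riemannCoeff G a b c e x
      - ((G x)⁻¹ a c * G x a c * ricciCoeff G b e x - (G x)⁻¹ a c * (G x a e * ricciCoeff G b c x)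
        - (G x)⁻¹ a c * (G x b c * ricciCoeff G a e x)
        + (G x)⁻¹ a c * ricciCoeff G a c x * G x b e) * ((d : ℝ) - 2)⁻¹
      + ((G x)⁻¹ a c * G x a c * G x b e - (G x)⁻¹ a c * (G x a e * G x b c))
        * (scalarCurv G x * (((d : ℝ) - 1) * ((d : ℝ) - 2))⁻¹) := by
    intro a c
    simp only [div_eq_mul_inv]
    ring
  simp only [split, Finset.sum_add_distrib, Finset.sum_sub_distrib, ← Finset.sum_mul, s1, s2,
    s3, s4]
  have s5 : ∑ a, ∑ c, (G x)⁻¹ a c * ricciCoeff G a c x = scalarCurv G x := rfl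
  rw [s5]
  have h1 : (d : ℝ) - 2 ≠ 0 := by linarith
  have h2 : (d : ℝ) - 1 ≠ 0 := by linarith
  field_simp
  ring

/-- The decomposition of the Riemann tensor if the Ricci tensor minus `λ g` is trace-free. -/
lemma riemann_decomp (hd : 3 ≤ d) (hx : x ∈ U) {cosm : ℝ}
    (htr : metricTrace (form₂ (G x)) (ricciForm G cosm x) = 0) (a b c e : EuclideanSpace ℝ (Fin d)) :
    form₂ (G x) a (curv (connForm G) x c e b) = weylForm G x a b c e
      + 1 / ((d : ℝ) - 2) * (form₂ (G x) a c * ricciForm G cosm x b e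
        - form₂ (G x) a e * ricciForm G cosm x b c - form₂ (G x) b c * ricciForm G cosm x a e
        + form₂ (G x) b e * ricciForm G cosm x a c)
      + cosm / ((d : ℝ) - 1) * (form₂ (G x) a c * form₂ (G x) b e
        - form₂ (G x) a e * form₂ (G x) b c) := by
  have hdR : (3 : ℝ) ≤ d := by exact_mod_cast hd
  have h1 : (d : ℝ) - 2 ≠ 0 := by linarith
  have h2 : (d : ℝ) - 1 ≠ 0 := by linarith
  -- With scalar curvature `d λ` the multiples of the metric combine to `2λ/(d-2) - dλ/((d-1)(d-2))
  -- = λ/(d-1)`.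
  have hS : scalarCurv G x = d * cosm := by
    rw [metricTrace_form₂ (h.det_ne x hx) (h.symm x hx)] at htr
    simp only [ricciForm_basisVec, mul_sub, Finset.sum_sub_distrib] at htr
    have e1 : ∑ a, ∑ c, (G x)⁻¹ a c * (cosm * G x a c) = d * cosm := by
      have e2 : ∀ a c, (G x)⁻¹ a c * (cosm * G x a c) = (G x)⁻¹ a c * G x c a * cosm := by
        intro a c; rw [h.symm x hx c a]; ring
      simp only [e2, ← Finset.sum_mul, h.sum_inv_mul hx]
      simp
    rw [e1] at htr
    exact sub_eq_zero.1 htr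
  rw [← sub_eq_zero]
  set g := form₂ (G x) with hg
  set T := ricciForm G cosm x with hT
  set R := curv (connForm G) x with hR
  set C := weylForm G x with hC
  set ν := 1 / ((d : ℝ) - 2) with hν
  set μ := cosm / ((d : ℝ) - 1) with hμ
  set Φ : EuclideanSpace ℝ (Fin d) → EuclideanSpace ℝ (Fin d) → EuclideanSpace ℝ (Fin d) →
      EuclideanSpace ℝ (Fin d) → ℝ := fun a b c e => g a (R c e b) - (C a b c e
      + ν * (g a c * T b e - g a e * T b c - g b c * T a e + g b e * T a c)
      + μ * (g a c * g b e - g a e * g b c)) with hΦ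
  have radd : ∀ c c' e b, R (c + c') e b = R c e b + R c' e b := by
    intro c c' e b; simp [hR, curv]; abel
  have rsmul : ∀ (r : ℝ) c e b, R (r • c) e b = r • R c e b := by
    intro r c e b; simp [hR, curv, smul_sub, smul_add]
  have radd' : ∀ c e e' b, R c (e + e') b = R c e b + R c e' b := by
    intro c e e' b; simp [hR, curv]; abel
  have rsmul' : ∀ (r : ℝ) c e b, R c (r • e) b = r • R c e b := by
    intro r c e b; simp [hR, curv, smul_sub, smul_add]
  have radd'' : ∀ c e b b', R c e (b + b') = R c e b + R c e b' := by
    intro c e b b'; simp [hR, curv]; abel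
  have rsmul'' : ∀ (r : ℝ) c e b, R c e (r • b) = r • R c e b := by
    intro r c e b; simp [hR, curv, smul_sub, smul_add]
  change Φ a b c e = 0
  refine linear_eq_zero (f := fun a => Φ a b c e) ⟨fun p q => by simp [hΦ]; ring,
    fun r p => by simp [hΦ]; ring⟩ (fun a => ?_) a
  refine linear_eq_zero (f := fun b => Φ _ b c e) ⟨fun p q => by simp [hΦ, radd'']; ring,
    fun r p => by simp [hΦ, rsmul'']; ring⟩ (fun b => ?_) b
  refine linear_eq_zero (f := fun c => Φ _ _ c e) ⟨fun p q => by simp [hΦ, radd]; ring,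
    fun r p => by simp [hΦ, rsmul]; ring⟩ (fun c => ?_) c
  refine linear_eq_zero (f := fun e => Φ _ _ _ e) ⟨fun p q => by simp [hΦ, radd']; ring,
    fun r p => by simp [hΦ, rsmul']; ring⟩ (fun e => ?_) e
  simp only [hΦ, hg, hT, hC, hR, hν, hμ]
  rw [h.riemann_basisVec hx]
  simp only [weylForm_basisVec, ricciForm_basisVec, form₂_basisVec, weylCoeff, hS]
  field_simp
  ring

/-- Coordinate form of the alignment theorem. -/
theorem aligned (hd : 3 ≤ d) {cosm : ℝ} {η : EuclideanSpace ℝ (Fin d) → ℝ}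
    {k : EuclideanSpace ℝ (Fin d) → EuclideanSpace ℝ (Fin d)} (hη : ∀ y ∈ U, η y ≠ 0)
    (hk : ∀ y ∈ U, k y ≠ 0) (hnull : ∀ y ∈ U, form₂ (G y) (k y) (k y) = 0)
    (hRic : ∀ y ∈ U, ∀ u v, ricciForm G cosm y u v =
      η y * form₂ (G y) (k y) u * form₂ (G y) (k y) v)
    (htype : ∀ y ∈ U,
      IsTypeIII d (fun u v => form₂ (G y) u v) (fun u v w z => weylForm G y u v w z) ∨
      IsTypeN d (fun u v => form₂ (G y) u v) (fun u v w z => weylForm G y u v w z))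
    (hx : x ∈ U) {l : EuclideanSpace ℝ (Fin d)}
    (hl : IsMultipleWAND d (fun u v => form₂ (G x) u v) (fun u v w z => weylForm G x u v w z) l) :
    ∃ c : ℝ, c ≠ 0 ∧ k x = c • l := by
  refine aligned_of_null_ricci (T := ricciForm G cosm) (μ := cosm / ((d : ℝ) - 1)) h.isLeviCivitaOn
    hd (by simp) (contDiffOn_form₄ h.smooth_weylCoeff)
    (contDiffOn_form₂ fun a b => (h.smooth_ricciCoeff a b).sub (contDiffOn_const.mul (h.smooth a b)))
    hRic hη hk hnull (fun y hy a b c e => h.riemann_decomp hd hy ?_ a b c e)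
    (fun y hy => h.weyl_traceless hd hy) htype hx hl
  -- Raising an index of `η k ⊗ k` gives an operator of rank one with trace `η (k · k) = 0`.
  have e1 : (form₂ (G y)).inverse ∘L ricciForm G cosm y =
      (form₂ (G y) (k y)).smulRight (η y • k y) := by
    ext1 u
    have : ricciForm G cosm y u = form₂ (G y) ((η y * form₂ (G y) (k y) u) • k y) := by
      ext1 v
      rw [hRic y hy]
      simp
    rw [ContinuousLinearMap.comp_apply, this, inverse_apply (form₂_nondeg (h.det_ne y hy))]
    simp [smul_smul, mul_comm]
  rw [metricTrace, e1]
  have e2 : (((form₂ (G y) (k y)).smulRight (η y • k y) : EuclideanSpace ℝ (Fin d) →L[ℝ]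
      EuclideanSpace ℝ (Fin d)) : EuclideanSpace ℝ (Fin d) →ₗ[ℝ] EuclideanSpace ℝ (Fin d)) =
      ((form₂ (G y) (k y) : EuclideanSpace ℝ (Fin d) →L[ℝ] ℝ) :
        EuclideanSpace ℝ (Fin d) →ₗ[ℝ] ℝ).smulRight (η y • k y) := rfl
  rw [e2, LinearMap.trace_smulRight]
  simp [hnull y hy]

end IsMetricOn

end CoordinateWeyl


/-! ### Invariance of the algebraic classification under maps preserving `B` and `C` -/

section FrameTransport

variable {d : ℕ} {V W : Type*} {B : V → V → ℝ} {C : V → V → V → V → ℝ}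
  {B' : W → W → ℝ} {C' : W → W → W → W → ℝ} {φ : V → W} {l n : V} {m : Fin (d - 2) → V}

lemma frameVec_map (φ : V → W) (l n : V) (m : Fin (d - 2) → V) (i : Fin 2 ⊕ Fin (d - 2)) :
    frameVec (φ l) (φ n) (φ ∘ m) i = φ (frameVec l n m i) := by
  rcases i with i | i
  · fin_cases i <;> rfl
  · rfl

lemma IsNullFrame.map (h : IsNullFrame d B l n m) (hB : ∀ u v, B' (φ u) (φ v) = B u v) :
    IsNullFrame d B' (φ l) (φ n) (φ ∘ m) := by
  constructor <;> simp [hB, h.l_l, h.n_n, h.l_n, h.l_m, h.n_m, h.m_m]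

lemma boostOrderLE_map_iff (hC : ∀ u v w z, C' (φ u) (φ v) (φ w) (φ z) = C u v w z) {w : ℤ} :
    BoostOrderLE C' (φ l) (φ n) (φ ∘ m) w ↔ BoostOrderLE C l n m w := by
  simp only [BoostOrderLE, frameVec_map, hC]

lemma IsMultipleWAND.map (hB : ∀ u v, B' (φ u) (φ v) = B u v)
    (hC : ∀ u v w z, C' (φ u) (φ v) (φ w) (φ z) = C u v w z) (h : IsMultipleWAND d B C l) :
    IsMultipleWAND d B' C' (φ l) := by
  obtain ⟨n, m, hf, hb⟩ := h
  exact ⟨φ n, φ ∘ m, hf.map hB, (boostOrderLE_map_iff hC).2 hb⟩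

lemma IsTypeIII.map (hB : ∀ u v, B' (φ u) (φ v) = B u v)
    (hC : ∀ u v w z, C' (φ u) (φ v) (φ w) (φ z) = C u v w z) (h : IsTypeIII d B C) :
    IsTypeIII d B' C' := by
  obtain ⟨l, n, m, hf, hb, hb'⟩ := h
  exact ⟨φ l, φ n, φ ∘ m, hf.map hB, (boostOrderLE_map_iff hC).2 hb,
    fun h' => hb' ((boostOrderLE_map_iff hC).1 h')⟩

lemma IsTypeN.map (hB : ∀ u v, B' (φ u) (φ v) = B u v)
    (hC : ∀ u v w z, C' (φ u) (φ v) (φ w) (φ z) = C u v w z) (h : IsTypeN d B C) :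
    IsTypeN d B' C' := by
  obtain ⟨l, n, m, hf, hb, hb'⟩ := h
  exact ⟨φ l, φ n, φ ∘ m, hf.map hB, (boostOrderLE_map_iff hC).2 hb,
    fun h' => hb' ((boostOrderLE_map_iff hC).1 h')⟩

end FrameTransport

/-! ### Passage from the manifold to a chart -/

section ChartTransport

variable {d : ℕ} {M : Type*} [TopologicalSpace M] [ChartedSpace (EuclideanSpace ℝ (Fin d)) M]
  {e : OpenPartialHomeomorph M (EuclideanSpace ℝ (Fin d))}

local notation "ℰ" => EuclideanSpace ℝ (Fin d)

/-- The differential of the chart `e` at `p`. -/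
def chartDeriv (e : OpenPartialHomeomorph M ℰ) (p : M) : TangentSpace (𝓡 d) p →L[ℝ] ℰ :=
  @mfderiv ℝ _ _ _ _ _ _ (𝓡 d) M _ _ _ _ _ _ _ (𝓡 d) _ _ (chartedSpaceSelf _) e p

/-- The differential of the inverse of the chart `e` at `x`. -/
def chartSymmDeriv (e : OpenPartialHomeomorph M ℰ) (x : ℰ) :
    ℰ →L[ℝ] TangentSpace (𝓡 d) (e.symm x) :=
  @mfderiv ℝ _ _ _ _ _ _ (𝓡 d) _ _ (chartedSpaceSelf _) _ _ _ _ _ (𝓡 d) M _ _ e.symm x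

lemma coordVec_eq (e : OpenPartialHomeomorph M ℰ) (x : ℰ) (i : Fin d) :
    coordVec e x i = chartSymmDeriv e x (basisVec i) := rfl

lemma comp_eq (e : OpenPartialHomeomorph M ℰ) (p : M) (u : TangentSpace (𝓡 d) p) (i : Fin d) :
    comp e p u i = chartDeriv e p u i := rfl

lemma mdifferentiable_of_mem_maximalAtlas (he : e ∈ IsManifold.maximalAtlas (𝓡 d) ∞ M) :
    e.MDifferentiable (𝓡 d) (𝓡 d) :=
  ⟨(contMDiffOn_of_mem_maximalAtlas he).mdifferentiableOn (by simp),
    (contMDiffOn_symm_of_mem_maximalAtlas he).mdifferentiableOn (by simp)⟩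

lemma chartDeriv_chartSymmDeriv (he : e ∈ IsManifold.maximalAtlas (𝓡 d) ∞ M) {x : ℰ}
    (hx : x ∈ e.target) (u : ℰ) : chartDeriv e (e.symm x) (chartSymmDeriv e x u) = u :=
  congrArg (fun f => f u) ((mdifferentiable_of_mem_maximalAtlas he).comp_symm_deriv hx)

lemma chartSymmDeriv_chartDeriv (he : e ∈ IsManifold.maximalAtlas (𝓡 d) ∞ M) {x : ℰ}
    (hx : x ∈ e.target) (u : TangentSpace (𝓡 d) (e.symm x)) :
    chartSymmDeriv e x (chartDeriv e (e.symm x) u) = u := by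
  have hinj := (mdifferentiable_of_mem_maximalAtlas he).mfderiv_injective (e.map_target hx)
  exact hinj (chartDeriv_chartSymmDeriv he hx _)

variable [IsManifold (𝓡 d) ∞ M]

lemma form₂_metricCoeff (g : LorentzMetric d M) (e : OpenPartialHomeomorph M ℰ) (x u v : ℰ) :
    form₂ (metricCoeff g e x) u v =
      g.inner (e.symm x) (chartSymmDeriv e x u) (chartSymmDeriv e x v) := by
  rw [form₂_apply]
  conv_rhs => rw [← sum_smul_basisVec u, ← sum_smul_basisVec v]
  simp only [map_sum, map_smul, sum_apply, smul_apply,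
    smul_eq_mul, metricCoeff, Matrix.of_apply, coordVec_eq, Finset.mul_sum]
  rw [Finset.sum_comm]
  exact Finset.sum_congr rfl fun j _ => Finset.sum_congr rfl fun i _ => by ring

lemma form₂_metricCoeff_chartDeriv (g : LorentzMetric d M)
    (he : e ∈ IsManifold.maximalAtlas (𝓡 d) ∞ M) {x : ℰ} (hx : x ∈ e.target)
    (u v : TangentSpace (𝓡 d) (e.symm x)) :
    form₂ (metricCoeff g e x) (chartDeriv e _ u) (chartDeriv e _ v) = g.inner _ u v := by
  rw [form₂_metricCoeff, chartSymmDeriv_chartDeriv he hx, chartSymmDeriv_chartDeriv he hx]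

lemma weylForm_chartDeriv (g : LorentzMetric d M) {x : ℰ} (hx : x ∈ e.target)
    (u v w z : TangentSpace (𝓡 d) (e.symm x)) :
    weylForm (metricCoeff g e) x (chartDeriv e _ u) (chartDeriv e _ v) (chartDeriv e _ w)
      (chartDeriv e _ z) = weyl g e (e.symm x) u v w z := by
  simp only [weylForm, form₄_apply, weyl, comp_eq, e.right_inv hx]

lemma ricciForm_chartDeriv (g : LorentzMetric d M) (cosm : ℝ)
    (he : e ∈ IsManifold.maximalAtlas (𝓡 d) ∞ M) {x : ℰ} (hx : x ∈ e.target)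
    (u v : TangentSpace (𝓡 d) (e.symm x)) :
    ricciForm (metricCoeff g e) cosm x (chartDeriv e _ u) (chartDeriv e _ v) =
      ricci g e (e.symm x) u v - cosm * g.inner _ u v := by
  rw [← form₂_metricCoeff_chartDeriv g he hx]
  simp only [ricciForm, form₂_apply, ricci, comp_eq, e.right_inv hx, Matrix.of_apply, sub_mul,
    Finset.sum_sub_distrib, Finset.mul_sum, mul_assoc]

lemma LorentzMetric.eq_zero_of_forall_inner_eq_zero (g : LorentzMetric d M) {p : M}
    {u : TangentSpace (𝓡 d) p} (h : ∀ v, g.inner p u v = 0) : u = 0 := by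
  obtain ⟨b, t, hb⟩ := g.lorentzian p
  refine b.ext_elem fun i => ?_
  have hi := h (b i)
  rw [← b.sum_repr u] at hi
  simp only [map_sum, map_smul, sum_apply, smul_apply,
    smul_eq_mul, hb, mul_ite, mul_zero, Finset.sum_ite_eq', Finset.mem_univ, if_true] at hi
  split_ifs at hi <;> simpa using hi

/-- The coordinate field is the image of a constant section under the tangent map of the inverse
chart; as a section along `e.symm` it can be inserted into the metric. -/
lemma contMDiffOn_coordVec (he : e ∈ IsManifold.maximalAtlas (𝓡 d) ∞ M) (i : Fin d) :
    ContMDiffOn (𝓡 d) ((𝓡 d).prod (𝓡 d)) ∞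
      (fun x => Bundle.TotalSpace.mk' ℰ (E := fun q : M => TangentSpace (𝓡 d) q) (e.symm x)
        (coordVec e x i)) e.target := by
  have h1 : ContMDiffOn (𝓡 d) (𝓡 d) ∞ e.symm e.target := contMDiffOn_symm_of_mem_maximalAtlas he
  have h2 := h1.contMDiffOn_tangentMapWithin (m := ∞) (by simp) e.open_target.uniqueMDiffOn
  have h3 : ContMDiffOn (𝓡 d) ((𝓡 d).prod (𝓡 d)) ∞
      (fun x : ℰ => (⟨x, basisVec i⟩ : TangentBundle (𝓡 d) ℰ)) e.target :=
    contMDiffOn_vectorSpace_iff_contDiffOn.2 contDiffOn_const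
  refine (h2.comp h3 fun x hx => hx).congr fun x hx => ?_
  simp only [Function.comp, tangentMapWithin, mfderivWithin_of_isOpen e.open_target hx]
  rfl

lemma contDiffOn_metricCoeff (g : LorentzMetric d M)
    (he : e ∈ IsManifold.maximalAtlas (𝓡 d) ∞ M) (i j : Fin d) :
    ContDiffOn ℝ ∞ (fun x => metricCoeff g e x i j) e.target := by
  have h1 : ContMDiffOn (𝓡 d) (𝓡 d) ∞ e.symm e.target := contMDiffOn_symm_of_mem_maximalAtlas he
  have h2 := g.contMDiff.comp_contMDiffOn h1
  have h3 := ContMDiffOn.clm_bundle_apply₂ (F₁ := ℰ) (F₂ := ℰ) (F₃ := ℝ)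
    (E₁ := fun q : M => TangentSpace (𝓡 d) q) (E₂ := fun q : M => TangentSpace (𝓡 d) q)
    (E₃ := Bundle.Trivial M ℝ) h2 (contMDiffOn_coordVec he i) (contMDiffOn_coordVec he j)
  rw [← contMDiffOn_iff_contDiffOn]
  intro x hx
  have h4 := h3 x hx
  rw [Bundle.contMDiffWithinAt_totalSpace] at h4
  exact h4.2

lemma isMetricOn_metricCoeff (g : LorentzMetric d M)
    (he : e ∈ IsManifold.maximalAtlas (𝓡 d) ∞ M) : IsMetricOn e.target (metricCoeff g e) where
  isOpen := e.open_target
  smooth := contDiffOn_metricCoeff g he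
  symm := fun y _ i j => g.symm _ _ _
  det_ne := by
    intro y hy hdet
    -- A kernel vector of the coefficient matrix would be a nonzero tangent vector orthogonal to
    -- everything.
    obtain ⟨c, hc, hc'⟩ := Matrix.exists_vecMul_eq_zero_iff.2 hdet
    apply hc
    have h0 : chartSymmDeriv e y (WithLp.toLp 2 c) = 0 := by
      refine g.eq_zero_of_forall_inner_eq_zero fun v => ?_
      rw [← chartSymmDeriv_chartDeriv he hy v, ← form₂_metricCoeff, form₂_apply, Finset.sum_comm]
      refine Finset.sum_eq_zero fun j _ => ?_
      have hj : ∑ i, c i * metricCoeff g e y i j = 0 := congrFun hc' j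
      calc _ = (∑ i, c i * metricCoeff g e y i j) * chartDeriv e (e.symm y) v j := by
            rw [Finset.sum_mul]
            exact Finset.sum_congr rfl fun i _ => by ring
        _ = 0 := by rw [hj, zero_mul]
    have h1 := chartDeriv_chartSymmDeriv he hy (WithLp.toLp 2 c)
    rw [h0, map_zero] at h1
    funext i
    exact congrArg (fun w : ℰ => w i) h1.symm

/-- The differential of the chart is an isometry onto the coordinate metric that carries Ricci and
Weyl tensors along, so the coordinate theorem pulls back. No smoothness of `k` or `η` is needed for
this. -/
theorem aligned_of_ricci (hd : 3 ≤ d) (g : LorentzMetric d M) {cosm : ℝ} {η : M → ℝ}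
    {k : (p : M) → TangentSpace (𝓡 d) p} (he : e ∈ IsManifold.maximalAtlas (𝓡 d) ∞ M)
    (hη : ∀ p ∈ e.source, η p ≠ 0) (hk : ∀ p ∈ e.source, k p ≠ 0)
    (hnull : ∀ p ∈ e.source, g.inner p (k p) (k p) = 0)
    (hRicci : ∀ p ∈ e.source, ∀ u v : TangentSpace (𝓡 d) p, ricci g e p u v =
      cosm * g.inner p u v + η p * g.inner p (k p) u * g.inner p (k p) v)
    (hWeyl : ∀ p ∈ e.source, IsTypeIII d (fun u v => g.inner p u v) (weyl g e p) ∨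
      IsTypeN d (fun u v => g.inner p u v) (weyl g e p))
    {x : ℰ} (hx : x ∈ e.target) {l : TangentSpace (𝓡 d) (e.symm x)}
    (hl : IsMultipleWAND d (fun u v => g.inner (e.symm x) u v) (weyl g e (e.symm x)) l) :
    ∃ c : ℝ, c ≠ 0 ∧ k (e.symm x) = c • l := by
  have hinv := fun y (hy : y ∈ e.target) => chartSymmDeriv_chartDeriv he hy
  obtain ⟨c, hc, h⟩ := (isMetricOn_metricCoeff g he).aligned hd (cosm := cosm)
    (η := fun y => η (e.symm y)) (k := fun y => chartDeriv e (e.symm y) (k (e.symm y)))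
    (fun y hy => hη _ (e.map_target hy))
    (fun y hy h0 => hk _ (e.map_target hy) (by rw [← hinv y hy (k _), h0, map_zero]))
    (fun y hy => (form₂_metricCoeff_chartDeriv g he hy _ _).trans (hnull _ (e.map_target hy)))
    (fun y hy u v => by
      rw [← chartDeriv_chartSymmDeriv he hy u, ← chartDeriv_chartSymmDeriv he hy v,
        ricciForm_chartDeriv g cosm he hy, hRicci _ (e.map_target hy),
        form₂_metricCoeff_chartDeriv g he hy, form₂_metricCoeff_chartDeriv g he hy]
      ring)
    (fun y hy => (hWeyl _ (e.map_target hy)).imp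
      (IsTypeIII.map (form₂_metricCoeff_chartDeriv g he hy) (weylForm_chartDeriv g hy))
      (IsTypeN.map (form₂_metricCoeff_chartDeriv g he hy) (weylForm_chartDeriv g hy)))
    hx (hl.map (form₂_metricCoeff_chartDeriv g he hx) (weylForm_chartDeriv g hx))
  refine ⟨c, hc, ?_⟩
  rw [← hinv x hx (k _), h, map_smul, hinv x hx]

end ChartTransport

end Spacetime

end

theorem proposition1 (d : ℕ) (hd : 3 ≤ d) (M : Type*) [TopologicalSpace M]
    [ChartedSpace (EuclideanSpace ℝ (Fin d)) M] [IsManifold (𝓡 d) ∞ M]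
    (g : Spacetime.LorentzMetric d M)
    (cosm : ℝ) (η : M → ℝ) (k : (p : M) → TangentSpace (𝓡 d) p)
    (hη : ∀ p, η p ≠ 0) (hk : ∀ p, k p ≠ 0) (hnull : ∀ p, g.inner p (k p) (k p) = 0)
    (hRicci : ∀ e ∈ IsManifold.maximalAtlas (𝓡 d) ∞ M, ∀ p ∈ e.source,
      ∀ u v : TangentSpace (𝓡 d) p,
        Spacetime.ricci g e p u v =
          cosm * g.inner p u v + η p * g.inner p (k p) u * g.inner p (k p) v)
    (hWeyl : ∀ e ∈ IsManifold.maximalAtlas (𝓡 d) ∞ M, ∀ p ∈ e.source,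
      Spacetime.IsTypeIII d (fun u v => g.inner p u v) (Spacetime.weyl g e p) ∨
        Spacetime.IsTypeN d (fun u v => g.inner p u v) (Spacetime.weyl g e p)) :
    ∀ e ∈ IsManifold.maximalAtlas (𝓡 d) ∞ M, ∀ p ∈ e.source, ∀ l : TangentSpace (𝓡 d) p,
      Spacetime.IsMultipleWAND d (fun u v => g.inner p u v) (Spacetime.weyl g e p) l →
        ∃ c : ℝ, c ≠ 0 ∧ k p = c • l := by
  intro e he p hp
  obtain ⟨x, hx, rfl⟩ : ∃ x ∈ e.target, e.symm x = p := ⟨e p, e.map_source hp, e.left_inv hp⟩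
  intro l hl
  -- The statement is local: only the single chart `e` around the point enters.
  exact Spacetime.aligned_of_ricci hd g he (fun p _ => hη p) (fun p _ => hk p) (fun p _ => hnull p)
    (hRicci e he) (hWeyl e he) hx hl
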